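/- **Setting.** Fix a first-order language whose terms include at least two distinct ground terms ($0$ and $1$). Goal formulas are given by $$G ::= s=t \mid p(t_1,\dots,t_n) \mid G\wedge G \mid G\vee G \mid \neg G \mid \exists x\,G \mid if[\vec x](G,G),$$ where $if[\vec x](B,C)$ binds the variables $\vec x$ in both $B$ and $C$. Formulas are identified up to renaming of bound variables, and substitution is capture-avoiding. A goal is *ground* if it has no free variables. A program $P$ (a finite sequence of clauses) is in *completed form* if each clause is $p(x_1,\dots,x_n)\,\text{:-}\,B$ with distinct variables $x_i$ and a single formula $B$ whose free variables are among the $x_i$, and no predicate is defined by two clauses. **Conservative operational semantics.** Judgements $\theta:\alpha\Rightarrow\rho$ relate a substitution $\theta$ and a finite sequence $\alpha$ of formulas to a result $\rho$, which is a substitution, $fail$, $flounder$ or $diverge$. They are generated by the following rules. * $\theta:\epsilon\Rightarrow\theta$. * $\theta:(s=t),\alpha\Rightarrow\rho$ if $\theta\sigma:\alpha\sigma\Rightarrow\rho$ for a (relevant, idempotent) most general unifier $\sigma$ of $s,t$; and $\theta:(s=t),\alpha\Rightarrow fail$ if $s,t$ are not unifiable. * $\theta:B\wedge C,\alpha\Rightarrow\rho$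 if $\theta:B,C,\alpha\Rightarrow\rho$. * $\theta:B\vee C,\alpha\Rightarrow\rho$ if $\theta:B,\alpha\Rightarrow\rho$ with $\rho\neq fail$, or if $\theta:B,\alpha\Rightarrow fail$ and $\theta:C,\alpha\Rightarrow\rho$. * $\theta:\exists x\,B,\alpha\Rightarrow\rho$ if $\theta:B[x:=x'],\alpha\Rightarrow\rho$ with $x'$ fresh. * $\theta:\neg B,\alpha\Rightarrow flounder$ if $B$ has free variables. If $B$ has none: $\theta:\neg B,\alpha\Rightarrow fail$ if $\theta:B\Rightarrow\theta'$ for some substitution $\theta'$; $\theta:\neg B,\alpha\Rightarrow\rho$ if $\theta:B\Rightarrow fail$ and $\theta:\alpha\Rightarrow\rho$; and $\theta:\neg B,\alpha\Rightarrow\rho$ if $\theta:B\Rightarrow\rho$ with $\rho\in\{flounder,diverge\}$. * $\theta:if[\vec x](B,C),\alpha\Rightarrow flounder$ if $\exists\vec x\,B$ has free variables. If it has none, then for fresh distinct $\vec x'$: $\theta:if[\vec x](B,C),\alpha\Rightarrow\rho$ if $\theta:B[\vec x:=\vec x']\Rightarrow\theta'$ and $\theta':C[\vec x:=\vec x']\theta',\alpha\Rightarrow\rho$;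 and $\theta:if[\vec x](B,C),\alpha\Rightarrow\rho$ if $\theta:B[\vec x:=\vec x']\Rightarrow\rho$ with $\rho\in\{fail,flounder,diverge\}$. * $\theta:p(t_1,\dots,t_n),\alpha\Rightarrow\rho$ if $\theta:B[x_1:=t_1,\dots,x_n:=t_n],\alpha\Rightarrow\rho$, where $p(x_1,\dots,x_n)\,\text{:-}\,B$ is the clause of $P$ defining $p$. Here "fresh" means: not occurring in $\theta$ or in the goal sequence of the conclusion, nor, inside the computation of the condition $B$ of an $if$ formula, among the variables of that $if$ formula and of the goals after it, among the $\vec x'$ chosen for it, or among the variables so protected by an enclosing $if$ condition. With $()$ the empty substitution, $G$ *succeeds* if $():G\Rightarrow\theta'$ for some substitution $\theta'$, *fails* if $():G\Rightarrow fail$, and *flounders* if $():G\Rightarrow flounder$. Let $outcome_P(G)$ be $T$ if $G$ succeeds, $F$ if $G$ fails, and $U$ otherwise. **Abstract semantics.** A *$P$-unfolding* of $G$ is a formula obtained from $G$ by zero or more steps, each replacing one occurrence of a call $p(t_1,\dots,t_n)$ by $B[x_1:=t_1,\dots,x_n:=t_n]$, where $p(x_1,\dots,x_n)\,\text{:-}\,B$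 is in $P$. Let $$N ::= p(\vec t)\mid s=t\mid N\wedge N\mid \exists x\,N\mid \neg O,\qquad O ::= N\mid O\vee O .$$ The *depth-first normal form* $dfnf(G)$ is the normal form of $G$ under the following rewrite rules, applied anywhere in a formula: $$\begin{aligned} (B_1\vee B_2)\wedge C &\to (B_1\wedge C)\vee(B_2\wedge C),\\ B\wedge(C_1\vee C_2) &\to (B\wedge C_1)\vee(B\wedge C_2)\quad (B\in N),\\ \exists x(B_1\vee B_2) &\to \exists x B_1\vee\exists x B_2,\\ if[\vec x](B_1\vee B_2,C) &\to if[\vec x](B_1,C)\vee(\neg\exists\vec x B_1\wedge if[\vec x](B_2,C)),\\ if[\vec x](B,C) &\to \exists\vec x(B\wedge C)\quad (B\in N). \end{aligned}$$ On ground $O$ formulas the valuation $v$ is defined by: $v(t=t)=T$; $v(s=t)=F$ if $s,t$ are not identical; $v(p(\vec t))=U$; $v(B\wedge C)=v(C)$ if $v(B)=T$, and $v(B)$ otherwise; $v(B\vee C)=v(C)$ if $v(B)=F$, and $v(B)$ otherwise; $v(\neg B)=F,U,T$ if $v(B)=T,U,F$ respectively; and $v(\exists x B)$ is the maximum of $\{v(B[x:=t])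 \mid t \text{ a ground term}\}$ in the truth ordering $F<U<T$. For a non-empty set $S$ of truth values, $\max_k(S)$ is its maximum in the definedness ordering, in which $U<T$, $U<F$, and $T,F$ are incomparable; it is undefined if $\{T,F\}\subseteq S$. **Theorem (Denotation).** Every formula has exactly one depth-first normal form. Let $P$ be a program in completed form and $G$ a ground goal that does not flounder. Then $G$ does not both succeed and fail; for every $P$-unfolding $G'$ of $G$, $dfnf(G')$ is a ground $O$ formula; and $$v_P(G) := \max\nolimits_k\{v(dfnf(G')) \mid G' \text{ is a } P\text{-unfolding of } G\}$$ is defined and equal to $outcome_P(G)$. -/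

import Mathlib

namespace FirmCut

universe u v

/-! ## Terms and substitutions

Terms are Mathlib's first-order terms over `ℕ`; the natural numbers are the variables.  Binders are
represented by de Bruijn indices, so that formulas which differ only in the names of their bound
variables are equal, and substitution cannot capture variables. -/

section Terms

variable {L : FirstOrder.Language.{u, v}}

/-- A term without variables. -/
def GroundTerm (t : L.Term ℕ) : Prop := t.varFinset = ∅

/-- A substitution, as a function from variables to terms; `FirstOrder.Language.Term.var` is the empty one. -/
abbrev Subst (L : FirstOrder.Language.{u, v}) : Type u := ℕ → L.Term ℕ

namespace Subst

/-- The composition `θσ`: first `θ`, then `σ`. -/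
def comp (θ σ : Subst L) : Subst L := fun x => (θ x).subst σ

/-- The domain of a substitution. -/
def dom (θ : Subst L) : Set ℕ := {x | θ x ≠ FirstOrder.Language.Term.var x}

/-- The variables that occur in (the finite representation of) a substitution: those in its domain
and those in the terms it assigns to its domain. -/
def vars (θ : Subst L) : Set ℕ := θ.dom ∪ {y | ∃ x ∈ θ.dom, y ∈ (θ x).varFinset}

/-- The substitution that acts below one more binder as `σ` acts above it. -/
def up (σ : Subst L) : Subst L
  | 0 => FirstOrder.Language.Term.var 0
  | x + 1 => (σ x).relabel Nat.succ

/-- The substitution that acts below `k` more binders as `σ` acts above them. -/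
def upN (k : ℕ) (σ : Subst L) : Subst L := up^[k] σ

/-- The substitution that opens `k` binders: the `k` innermost bound variables are replaced by the
terms `ts`, and the other variables are seen from outside these binders. -/
def inst {k : ℕ} (ts : Fin k → L.Term ℕ) : Subst L :=
  fun x => if h : x < k then ts ⟨x, h⟩ else FirstOrder.Language.Term.var (x - k)

open Classical in
/-- The substitution `[x₁ := t₁, …, xₙ := tₙ]`, for distinct variables `x₁, …, xₙ`. -/
noncomputable def assign {n : ℕ} (xs : Fin n → ℕ) (ts : Fin n → L.Term ℕ) : Subst L :=
  fun x => if h : ∃ i, xs i = x then ts h.choose else FirstOrder.Language.Term.var x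

end Subst

/-- `s` and `t` have a common instance under one substitution. -/
def Unifiable (s t : L.Term ℕ) : Prop := ∃ τ : Subst L, s.subst τ = t.subst τ

/-- `σ` is a most general unifier of `s` and `t`.  As usual, most general unifiers are taken to be
idempotent and relevant (they involve only variables of `s` and `t`). -/
structure IsMGU (s t : L.Term ℕ) (σ : Subst L) : Prop where
  unifies : s.subst σ = t.subst σ
  most_general : ∀ τ : Subst L, s.subst τ = t.subst τ → ∃ δ : Subst L, τ = σ.comp δ
  idempotent : σ.comp σ = σ
  relevant : ∀ x ∈ σ.vars, x ∈ s.varFinset ∨ x ∈ t.varFinset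

end Terms

/-! ## Goals, clauses and programs -/

/-- Goal formulas.  `ex B` binds the variable `0` of `B`, and `ifThen k B C`, which stands for
`if[x₁, …, x_k](B, C)`, binds the variables `0, …, k - 1` of both `B` and `C`. -/
inductive Goal (L : FirstOrder.Language.{u, v}) : Type (max u v)
  | eq (s t : L.Term ℕ) : Goal L
  | call {n : ℕ} (p : L.Relations n) (ts : Fin n → L.Term ℕ) : Goal L
  | conj (B C : Goal L) : Goal L
  | disj (B C : Goal L) : Goal L
  | neg (B : Goal L) : Goal L
  | ex (B : Goal L) : Goal L
  | ifThen (k : ℕ) (B C : Goal L) : Goal L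

section Syn

variable {L : FirstOrder.Language.{u, v}}

namespace Goal

/-- Capture-avoiding substitution for the free variables of a formula. -/
def subst : Goal L → Subst L → Goal L
  | eq s t, σ => eq (s.subst σ) (t.subst σ)
  | call p ts, σ => call p (fun i => (ts i).subst σ)
  | conj B C, σ => conj (B.subst σ) (C.subst σ)
  | disj B C, σ => disj (B.subst σ) (C.subst σ)
  | neg B, σ => neg (B.subst σ)
  | ex B, σ => ex (B.subst σ.up)
  | ifThen k B C, σ => ifThen k (B.subst (σ.upN k)) (C.subst (σ.upN k))

/-- Replacement of the `k` innermost bound variables of a formula by terms. -/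
def inst {k : ℕ} (B : Goal L) (ts : Fin k → L.Term ℕ) : Goal L := B.subst (Subst.inst ts)

/-- Replacement of the variable bound by a single quantifier: `B[x := t]` for `∃ x B`. -/
def inst1 (B : Goal L) (t : L.Term ℕ) : Goal L := B.inst (fun _ : Fin 1 => t)

/-- The free variables of a formula. -/
def freeVars : Goal L → Set ℕ
  | eq s t => {x | x ∈ s.varFinset ∨ x ∈ t.varFinset}
  | call _ ts => {x | ∃ i, x ∈ (ts i).varFinset}
  | conj B C => B.freeVars ∪ C.freeVars
  | disj B C => B.freeVars ∪ C.freeVars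
  | neg B => B.freeVars
  | ex B => {x | x + 1 ∈ B.freeVars}
  | ifThen k B C => {x | x + k ∈ B.freeVars ∪ C.freeVars}

/-- A goal is ground if it has no free variables. -/
def Ground (G : Goal L) : Prop := G.freeVars = ∅

/-- `∃ x₁ … ∃ x_k B`. -/
def exN (k : ℕ) (B : Goal L) : Goal L := ex^[k] B

/-- The number of connectives and atoms. -/
def size : Goal L → ℕ
  | eq _ _ => 1
  | call _ _ => 1
  | conj B C => B.size + C.size + 1
  | disj B C => B.size + C.size + 1
  | neg B => B.size + 1
  | ex B => B.size + 1
  | ifThen _ B C => B.size + C.size + 1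

theorem size_subst (B : Goal L) : ∀ σ : Subst L, (B.subst σ).size = B.size := by
  induction B <;> intro σ <;> simp_all [subst, size]

theorem size_inst1 (B : Goal L) (t : L.Term ℕ) : (B.inst1 t).size = B.size := size_subst B _

end Goal

/-- The free variables of a sequence of formulas. -/
def stackVars (α : List (Goal L)) : Set ℕ := {x | ∃ B ∈ α, x ∈ B.freeVars}

/-- An element of a clause body: a goal formula or a cut. -/
inductive BodyElt (L : FirstOrder.Language.{u, v}) : Type (max u v)
  | goal (G : Goal L) : BodyElt L
  | cut : BodyElt L

/-- A clause `p(t₁, …, tₙ) :- body`. -/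
structure Clause (L : FirstOrder.Language.{u, v}) : Type (max u v) where
  pred : (n : ℕ) × L.Relations n
  params : Fin pred.1 → L.Term ℕ
  body : List (BodyElt L)

/-- A program is a finite sequence of clauses. -/
abbrev Program (L : FirstOrder.Language.{u, v}) : Type (max u v) := List (Clause L)

/-- `p(x₁, …, xₙ) :- B`, with variables as parameters and a single formula as body. -/
def simpleClause {n : ℕ} (p : L.Relations n) (xs : Fin n → ℕ) (B : Goal L) : Clause L where
  pred := ⟨n, p⟩
  params := fun i => FirstOrder.Language.Term.var (xs i)
  body := [BodyElt.goal B]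

/-- A program is in completed form if the parameters in each clause head are distinct variables,
the body of each clause is a single formula whose free variables are among these parameters, and no
predicate is defined by two clauses. -/
def Completed (P : Program L) : Prop :=
  (∀ c ∈ P, ∃ (n : ℕ) (p : L.Relations n) (xs : Fin n → ℕ) (B : Goal L),
    c = simpleClause p xs B ∧ Function.Injective xs ∧ B.freeVars ⊆ Set.range xs) ∧
  P.Pairwise (fun c d => c.pred ≠ d.pred)

/-- `Expands P p ts G`: the goal `G` is `B[x₁ := t₁, …, xₙ := tₙ]`, where `p(x₁, …, xₙ) :- B` is a
clause of `P`. -/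
def Expands (P : Program L) {n : ℕ} (p : L.Relations n) (ts : Fin n → L.Term ℕ) (G : Goal L) :
    Prop :=
  ∃ (xs : Fin n → ℕ) (B : Goal L),
    simpleClause p xs B ∈ P ∧ G = B.subst (Subst.assign xs ts)

end Syn

/-! ## The conservative operational semantics -/

/-- The result of a computation. -/
inductive Result (L : FirstOrder.Language.{u, v}) : Type u
  | success (θ : Subst L) : Result L
  | fail : Result L
  | flounder : Result L
  | diverge : Result L

section Semantics

variable {L : FirstOrder.Language.{u, v}}

open FirstOrder.Language.Term (var)

/-- `Eval P V θ α ρ` is the judgement `θ : α ⟹ ρ` of the conservative semantics: the computation of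
the goal stack `α` under the current substitution `θ` and the program `P` has the result `ρ`.

The set `V` only serves the renaming of bound variables.  It holds the variables that are in use in
the part of the enclosing computation to which the result of this computation is handed over, and a
variable that replaces a bound variable must not occur in `θ`, in `α` or in `V`. -/
inductive Eval (P : Program L) : Set ℕ → Subst L → List (Goal L) → Result L → Prop
  | unif_succ {V : Set ℕ} {θ σ : Subst L} {s t : L.Term ℕ} {α : List (Goal L)} {ρ : Result L} :
      IsMGU s t σ → Eval P V (θ.comp σ) (α.map (fun B => B.subst σ)) ρ →
      Eval P V θ (Goal.eq s t :: α) ρ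
  | unif_fail {V : Set ℕ} {θ : Subst L} {s t : L.Term ℕ} {α : List (Goal L)} :
      ¬ Unifiable s t → Eval P V θ (Goal.eq s t :: α) Result.fail
  | success {V : Set ℕ} {θ : Subst L} : Eval P V θ [] (Result.success θ)
  | conj {V : Set ℕ} {θ : Subst L} {B C : Goal L} {α : List (Goal L)} {ρ : Result L} :
      Eval P V θ (B :: C :: α) ρ → Eval P V θ (Goal.conj B C :: α) ρ
  | disj_nofail {V : Set ℕ} {θ : Subst L} {B C : Goal L} {α : List (Goal L)} {ρ : Result L} :
      Eval P V θ (B :: α) ρ → ρ ≠ Result.fail → Eval P V θ (Goal.disj B C :: α) ρ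
  | disj_fail {V : Set ℕ} {θ : Subst L} {B C : Goal L} {α : List (Goal L)} {ρ : Result L} :
      Eval P V θ (B :: α) Result.fail → Eval P V θ (C :: α) ρ →
      Eval P V θ (Goal.disj B C :: α) ρ
  | ex {V : Set ℕ} {θ : Subst L} {B : Goal L} {α : List (Goal L)} {ρ : Result L} {x : ℕ} :
      x ∉ V ∪ θ.vars ∪ stackVars (Goal.ex B :: α) →
      Eval P V θ (B.inst1 (var x) :: α) ρ → Eval P V θ (Goal.ex B :: α) ρ
  | not_succ {V : Set ℕ} {θ θ' : Subst L} {B : Goal L} {α : List (Goal L)} :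
      B.freeVars = ∅ → Eval P V θ [B] (Result.success θ') →
      Eval P V θ (Goal.neg B :: α) Result.fail
  | not_fail {V : Set ℕ} {θ : Subst L} {B : Goal L} {α : List (Goal L)} {ρ : Result L} :
      B.freeVars = ∅ → Eval P V θ [B] Result.fail → Eval P V θ α ρ →
      Eval P V θ (Goal.neg B :: α) ρ
  | not_flounder {V : Set ℕ} {θ : Subst L} {B : Goal L} {α : List (Goal L)} :
      B.freeVars ≠ ∅ → Eval P V θ (Goal.neg B :: α) Result.flounder
  | not_sub {V : Set ℕ} {θ : Subst L} {B : Goal L} {α : List (Goal L)} {ρ : Result L} :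
      B.freeVars = ∅ → ρ = Result.flounder ∨ ρ = Result.diverge → Eval P V θ [B] ρ →
      Eval P V θ (Goal.neg B :: α) ρ
  | if_succ {V : Set ℕ} {θ θ' : Subst L} {k : ℕ} {B C : Goal L} {α : List (Goal L)}
      {ρ : Result L} {xs : Fin k → ℕ} :
      (Goal.exN k B).freeVars = ∅ → Function.Injective xs →
      (∀ i, xs i ∉ V ∪ θ.vars ∪ stackVars (Goal.ifThen k B C :: α)) →
      Eval P (V ∪ stackVars (Goal.ifThen k B C :: α) ∪ Set.range xs) θ
        [B.inst (fun i => var (xs i))] (Result.success θ') →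
      Eval P V θ' ((C.inst (fun i => var (xs i))).subst θ' :: α) ρ →
      Eval P V θ (Goal.ifThen k B C :: α) ρ
  | if_fail {V : Set ℕ} {θ : Subst L} {k : ℕ} {B C : Goal L} {α : List (Goal L)}
      {xs : Fin k → ℕ} :
      (Goal.exN k B).freeVars = ∅ → Function.Injective xs →
      (∀ i, xs i ∉ V ∪ θ.vars ∪ stackVars (Goal.ifThen k B C :: α)) →
      Eval P (V ∪ stackVars (Goal.ifThen k B C :: α) ∪ Set.range xs) θ
        [B.inst (fun i => var (xs i))] Result.fail →
      Eval P V θ (Goal.ifThen k B C :: α) Result.fail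
  | if_flounder {V : Set ℕ} {θ : Subst L} {k : ℕ} {B C : Goal L} {α : List (Goal L)} :
      (Goal.exN k B).freeVars ≠ ∅ → Eval P V θ (Goal.ifThen k B C :: α) Result.flounder
  | if_sub {V : Set ℕ} {θ : Subst L} {k : ℕ} {B C : Goal L} {α : List (Goal L)}
      {ρ : Result L} {xs : Fin k → ℕ} :
      (Goal.exN k B).freeVars = ∅ → Function.Injective xs →
      (∀ i, xs i ∉ V ∪ θ.vars ∪ stackVars (Goal.ifThen k B C :: α)) →
      ρ = Result.flounder ∨ ρ = Result.diverge →
      Eval P (V ∪ stackVars (Goal.ifThen k B C :: α) ∪ Set.range xs) θ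
        [B.inst (fun i => var (xs i))] ρ →
      Eval P V θ (Goal.ifThen k B C :: α) ρ
  | pred {V : Set ℕ} {θ : Subst L} {n : ℕ} {p : L.Relations n} {ts : Fin n → L.Term ℕ}
      {B : Goal L} {α : List (Goal L)} {ρ : Result L} :
      Expands P p ts B → Eval P V θ (B :: α) ρ → Eval P V θ (Goal.call p ts :: α) ρ

/-- The computation of `G` from the empty substitution has the result `ρ`. -/
def HasResult (P : Program L) (G : Goal L) (ρ : Result L) : Prop := Eval P ∅ var [G] ρ

/-- `G` succeeds. -/
def Succeeds (P : Program L) (G : Goal L) : Prop := ∃ θ, HasResult P G (Result.success θ)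

/-- `G` fails. -/
def Fails (P : Program L) (G : Goal L) : Prop := HasResult P G Result.fail

/-- `G` flounders. -/
def Flounders (P : Program L) (G : Goal L) : Prop := HasResult P G Result.flounder

end Semantics

/-! ## Truth values -/

/-- The truth values: true, undefined and false. -/
inductive Truth : Type
  | T : Truth
  | U : Truth
  | F : Truth

namespace Truth

/-- The definedness ordering: the least partial order with `U ≤ T` and `U ≤ F`. -/
def leK (a b : Truth) : Prop := a = b ∨ a = U

/-- The truth ordering `F ≤ U ≤ T`. -/
def leT (a b : Truth) : Prop := a = b ∨ a = F ∨ b = T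

open Classical in
/-- The maximum of a set of truth values in the definedness ordering, undefined if the set contains
both `T` and `F`. -/
noncomputable def maxK (S : Set Truth) : Option Truth :=
  if T ∈ S ∧ F ∈ S then none else if T ∈ S then some T else if F ∈ S then some F else some U

open Classical in
/-- The maximum of a non-empty set of truth values in the truth ordering. -/
noncomputable def maxT (S : Set Truth) : Truth :=
  if T ∈ S then T else if U ∈ S then U else F

theorem maxK_eq_some_iff {S : Set Truth} (hS : S.Nonempty) (a : Truth) :
    maxK S = some a ↔ a ∈ S ∧ ∀ b ∈ S, leK b a := by
  constructor
  · intro h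
    have hU : T ∉ S → F ∉ S → U ∈ S := by
      obtain ⟨b, hb⟩ := hS
      cases b <;> tauto
    unfold maxK at h
    split_ifs at h <;> simp only [Option.some.injEq] at h <;> subst h <;>
      refine ⟨by tauto, fun b hb => ?_⟩ <;> cases b <;> simp_all [leK]
  · rintro ⟨h1, h2⟩
    have hT := h2 T
    have hF := h2 F
    unfold maxK
    by_cases h3 : T ∈ S <;> by_cases h4 : F ∈ S <;> cases a <;> simp_all [leK]
    exact absurd (h2 T h3) (by simp)

theorem maxT_eq_iff {S : Set Truth} (hS : S.Nonempty) (a : Truth) :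
    maxT S = a ↔ a ∈ S ∧ ∀ b ∈ S, leT b a := by
  constructor
  · intro h
    have hF : T ∉ S → U ∉ S → F ∈ S := by
      obtain ⟨b, hb⟩ := hS
      cases b <;> tauto
    unfold maxT at h
    split_ifs at h <;> subst h <;>
      refine ⟨by tauto, fun b hb => ?_⟩ <;> cases b <;> simp_all [leT]
  · rintro ⟨h1, h2⟩
    have hT := h2 T
    have hU := h2 U
    unfold maxT
    by_cases h3 : T ∈ S <;> by_cases h4 : U ∈ S <;> cases a <;> simp_all [leT]

end Truth

section Denotation

variable {L : FirstOrder.Language.{u, v}}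

open Classical in
/-- The outcome of a goal: `T` if it succeeds, `F` if it fails, and `U` otherwise. -/
noncomputable def outcome (P : Program L) (G : Goal L) : Truth :=
  if Succeeds P G then Truth.T else if Fails P G then Truth.F else Truth.U

/-! ## Unfoldings -/

/-- `Unfold1 P G G'`: the formula `G'` is `G` with one occurrence of a predicate call replaced by
the corresponding instance of the body of its definition in `P`. -/
inductive Unfold1 (P : Program L) : Goal L → Goal L → Prop
  | call {n : ℕ} {p : L.Relations n} {ts : Fin n → L.Term ℕ} {B : Goal L} :
      Expands P p ts B → Unfold1 P (Goal.call p ts) B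
  | conj_left {B B' C : Goal L} : Unfold1 P B B' → Unfold1 P (Goal.conj B C) (Goal.conj B' C)
  | conj_right {B C C' : Goal L} : Unfold1 P C C' → Unfold1 P (Goal.conj B C) (Goal.conj B C')
  | disj_left {B B' C : Goal L} : Unfold1 P B B' → Unfold1 P (Goal.disj B C) (Goal.disj B' C)
  | disj_right {B C C' : Goal L} : Unfold1 P C C' → Unfold1 P (Goal.disj B C) (Goal.disj B C')
  | neg {B B' : Goal L} : Unfold1 P B B' → Unfold1 P (Goal.neg B) (Goal.neg B')
  | ex {B B' : Goal L} : Unfold1 P B B' → Unfold1 P (Goal.ex B) (Goal.ex B')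
  | if_left {k : ℕ} {B B' C : Goal L} :
      Unfold1 P B B' → Unfold1 P (Goal.ifThen k B C) (Goal.ifThen k B' C)
  | if_right {k : ℕ} {B C C' : Goal L} :
      Unfold1 P C C' → Unfold1 P (Goal.ifThen k B C) (Goal.ifThen k B C')

/-- `G'` is a `P`-unfolding of `G`. -/
def Unfolding (P : Program L) (G G' : Goal L) : Prop := Relation.ReflTransGen (Unfold1 P) G G'

/-! ## Depth-first normal form -/

mutual

/-- Negated-disjunction formulas. -/
inductive NegDisj : Goal L → Prop
  | call {n : ℕ} (p : L.Relations n) (ts : Fin n → L.Term ℕ) : NegDisj (Goal.call p ts)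
  | eq (s t : L.Term ℕ) : NegDisj (Goal.eq s t)
  | conj {B C : Goal L} : NegDisj B → NegDisj C → NegDisj (Goal.conj B C)
  | ex {B : Goal L} : NegDisj B → NegDisj (Goal.ex B)
  | neg {B : Goal L} : OuterDisj B → NegDisj (Goal.neg B)

/-- Outer-disjunction formulas. -/
inductive OuterDisj : Goal L → Prop
  | negDisj {B : Goal L} : NegDisj B → OuterDisj B
  | disj {B C : Goal L} : OuterDisj B → OuterDisj C → OuterDisj (Goal.disj B C)

end

/-- One step of the rewriting system, applied anywhere in a formula. -/
inductive Rewrites : Goal L → Goal L → Prop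
  | r1 (B₁ B₂ C : Goal L) :
      Rewrites (Goal.conj (Goal.disj B₁ B₂) C) (Goal.disj (Goal.conj B₁ C) (Goal.conj B₂ C))
  | r2 (B C₁ C₂ : Goal L) : NegDisj B →
      Rewrites (Goal.conj B (Goal.disj C₁ C₂)) (Goal.disj (Goal.conj B C₁) (Goal.conj B C₂))
  | r3 (B₁ B₂ : Goal L) :
      Rewrites (Goal.ex (Goal.disj B₁ B₂)) (Goal.disj (Goal.ex B₁) (Goal.ex B₂))
  | r4 (k : ℕ) (B₁ B₂ C : Goal L) :
      Rewrites (Goal.ifThen k (Goal.disj B₁ B₂) C)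
        (Goal.disj (Goal.ifThen k B₁ C)
          (Goal.conj (Goal.neg (Goal.exN k B₁)) (Goal.ifThen k B₂ C)))
  | r5 (k : ℕ) (B C : Goal L) : NegDisj B →
      Rewrites (Goal.ifThen k B C) (Goal.exN k (Goal.conj B C))
  | conj_left {B B' C : Goal L} : Rewrites B B' → Rewrites (Goal.conj B C) (Goal.conj B' C)
  | conj_right {B C C' : Goal L} : Rewrites C C' → Rewrites (Goal.conj B C) (Goal.conj B C')
  | disj_left {B B' C : Goal L} : Rewrites B B' → Rewrites (Goal.disj B C) (Goal.disj B' C)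
  | disj_right {B C C' : Goal L} : Rewrites C C' → Rewrites (Goal.disj B C) (Goal.disj B C')
  | neg {B B' : Goal L} : Rewrites B B' → Rewrites (Goal.neg B) (Goal.neg B')
  | ex {B B' : Goal L} : Rewrites B B' → Rewrites (Goal.ex B) (Goal.ex B')
  | if_left {k : ℕ} {B B' C : Goal L} :
      Rewrites B B' → Rewrites (Goal.ifThen k B C) (Goal.ifThen k B' C)
  | if_right {k : ℕ} {B C C' : Goal L} :
      Rewrites C C' → Rewrites (Goal.ifThen k B C) (Goal.ifThen k B C')

/-- `D` is a normal form of `G`. -/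
def IsDFNF (G D : Goal L) : Prop :=
  Relation.ReflTransGen Rewrites G D ∧ ∀ D' : Goal L, ¬ Rewrites D D'

instance : Nonempty (Goal L) := ⟨Goal.eq (FirstOrder.Language.Term.var 0) (FirstOrder.Language.Term.var 0)⟩

/-- The depth-first normal form of a formula: its (unique) normal form. -/
noncomputable def dfnf (G : Goal L) : Goal L := Classical.epsilon (IsDFNF G)

/-! ## The valuation and the denotation of a program -/

open Classical in
/-- The valuation function on ground outer-disjunction formulas.  Its value on `if` formulas, which
are not outer-disjunction formulas, is immaterial. -/
noncomputable def val : Goal L → Truth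
  | Goal.eq s t => if s = t then Truth.T else Truth.F
  | Goal.call _ _ => Truth.U
  | Goal.conj B C =>
      match val B with
      | Truth.T => val C
      | Truth.U => Truth.U
      | Truth.F => Truth.F
  | Goal.disj B C =>
      match val B with
      | Truth.T => Truth.T
      | Truth.U => Truth.U
      | Truth.F => val C
  | Goal.neg B =>
      match val B with
      | Truth.T => Truth.F
      | Truth.U => Truth.U
      | Truth.F => Truth.T
  | Goal.ex B => Truth.maxT {w | ∃ t : L.Term ℕ, GroundTerm t ∧ w = val (B.inst1 t)}
  | Goal.ifThen _ _ _ => Truth.U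
  termination_by G => G.size
  decreasing_by
    all_goals simp only [Goal.size, Goal.size_inst1]; omega

/-- The denotation `v_P` of a program `P`: the maximum, in the definedness ordering, of the
valuations of the depth-first normal forms of the unfoldings of a goal. -/
noncomputable def denotation (P : Program L) (G : Goal L) : Option Truth :=
  Truth.maxK {w | ∃ G' : Goal L, Unfolding P G G' ∧ w = val (dfnf G')}

end Denotation

end FirmCut

/-!
A formula is interpreted by the list `sem` of the truth functions of the disjuncts of its depth-first
normal form; a truth function sends each assignment of ground terms to the variables to one of the
three truth values.  This list is computed by recursion on the formula and does not change under the
rewrite rules (`Rewrites.sem_eq`), and the valuation of the normal form of a ground goal is the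
sequential disjunction of the list (`val_dfnf`).  The normal form itself, `Goal.nf`, is also given by
recursion; it is unique because it is invariant under the rewrite rules and every formula rewrites to
it (`existsUnique_isDFNF`).

A goal stack is read as a conjunction, whose disjuncts are lists of truth functions (`stackSem`).
The computation of a stack goes through these disjuncts from left to right, and may end in three ways
on an unfolded goal, where calls are not evaluated any further: every disjunct is false everywhere;
or the first disjunct for which this is not so is true exactly on the instances of an answer `δ`; or
it is stuck at a conjunct that is undefined somewhere and true nowhere as far as the conjuncts before
it are true.  These are the verdicts of `Status` and `Matches`, and for a ground goal they determine
the valuation (`Matches.disj_sem_eq`).  Each rule of the operational semantics transports verdicts.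
The central point is that a conjunct which is true exactly on the instances of a substitution acts
like this substitution on the conjuncts after it (`Status.guard`); equations, where the substitution
is a most general unifier, and conditionals, where it is the answer for the condition, are cases of
this.  In a verdict the answer is described only on the variables that are in use; as the variables
that replace bound variables are new, existential quantifiers can then be dropped (`Status.exN`).

Soundness and completeness follow.  If a computation does not flounder, its result is the verdict of
all unfoldings in which the remaining calls are sufficiently deep (`Eval.sound`, by induction on the
computation).  Conversely, for every unfolding that is not stuck there is a computation that flounders
or has the verdict of the unfolding (`follows_of_stackUnf`, by induction on the size of the unfolding
and on the number of replacements of calls that lead to it).  For a ground goal that does not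
flounder, the value of each unfolding therefore is undefined or agrees with the outcome, and the
outcome, if it is defined, is attained by the deep unfoldings (`denotation_eq_outcome`).  A goal that
both succeeds and fails would have deep unfoldings that are both true and false.
-/

namespace FirmCut

universe u v

open FirstOrder.Language.Term (var func)

variable {L : FirstOrder.Language.{u, v}}

/-! ### Substitution in terms -/

namespace Subst

theorem term_subst_subst (t : L.Term ℕ) (σ τ : Subst L) :
    (t.subst σ).subst τ = t.subst (σ.comp τ) := by
  induction t with
  | var => rfl
  | func f ts ih => simp [ih]

theorem term_subst_congr {t : L.Term ℕ} {σ τ : Subst L} (h : ∀ x ∈ t.varFinset, σ x = τ x) :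
    t.subst σ = t.subst τ := by
  induction t with
  | var => simpa using h
  | func f ts ih =>
    simp only [FirstOrder.Language.Term.subst]
    congr 1
    funext i
    refine ih i fun x hx => h x ?_
    simp only [FirstOrder.Language.Term.varFinset, Finset.mem_biUnion]
    exact ⟨i, Finset.mem_univ i, hx⟩

theorem term_subst_var (t : L.Term ℕ) : t.subst var = t := by
  induction t with
  | var => rfl
  | func f ts ih => simp [ih]

theorem term_subst_eq_self {t : L.Term ℕ} {σ : Subst L} (h : ∀ x ∈ t.varFinset, σ x = var x) :
    t.subst σ = t :=
  (term_subst_congr h).trans (term_subst_var t)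

theorem mem_varFinset_subst {t : L.Term ℕ} {σ : Subst L} {x : ℕ} :
    x ∈ (t.subst σ).varFinset ↔ ∃ y ∈ t.varFinset, x ∈ (σ y).varFinset := by
  induction t with
  | var => simp
  | func f ts ih =>
    simp only [FirstOrder.Language.Term.subst, FirstOrder.Language.Term.varFinset,
      Finset.mem_biUnion, Finset.mem_univ, true_and, ih]
    exact ⟨fun ⟨i, y, hy, hx⟩ => ⟨y, ⟨i, hy⟩, hx⟩, fun ⟨y, ⟨i, hy⟩, hx⟩ => ⟨i, y, hy, hx⟩⟩

theorem term_relabel_eq_subst (t : L.Term ℕ) (f : ℕ → ℕ) :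
    t.relabel f = t.subst (fun x => var (f x)) := by
  induction t with
  | var => rfl
  | func f ts ih => simp [ih]

theorem comp_assoc (ρ σ τ : Subst L) : (ρ.comp σ).comp τ = ρ.comp (σ.comp τ) :=
  funext fun x => term_subst_subst (ρ x) σ τ

theorem comp_var (σ : Subst L) : σ.comp var = σ := funext fun x => term_subst_var (σ x)

theorem up_comp (σ τ : Subst L) : (σ.comp τ).up = σ.up.comp τ.up := by
  funext x
  cases x with
  | zero => rfl
  | succ x =>
    simp only [up, comp, term_relabel_eq_subst, term_subst_subst]
    refine term_subst_congr fun y _ => ?_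
    simp [comp, up, term_relabel_eq_subst]

theorem upN_succ (k : ℕ) (σ : Subst L) : upN (k + 1) σ = (upN k σ).up :=
  Function.iterate_succ_apply' up k σ

theorem upN_comp (k : ℕ) (σ τ : Subst L) : (σ.comp τ).upN k = (σ.upN k).comp (τ.upN k) := by
  induction k with
  | zero => rfl
  | succ k ih => rw [upN_succ, upN_succ, upN_succ, ih, up_comp]

theorem upN_of_lt {k x : ℕ} (σ : Subst L) (h : x < k) : σ.upN k x = var x := by
  induction k generalizing x with
  | zero => omega
  | succ k ih =>
    rw [upN_succ]
    cases x with
    | zero => rfl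
    | succ x => simp [up, ih (Nat.lt_of_succ_lt_succ h)]

theorem upN_add (k x : ℕ) (σ : Subst L) :
    σ.upN k (x + k) = (σ x).subst (fun y => var (y + k)) := by
  induction k with
  | zero => exact (term_subst_var _).symm
  | succ k ih =>
    rw [upN_succ, ← Nat.add_assoc]
    simp only [up, ih, term_relabel_eq_subst, term_subst_subst]
    rfl

theorem upN_var (k : ℕ) : upN k (var : Subst L) = var := by
  funext x
  rcases lt_or_ge x k with h | h
  · exact upN_of_lt _ h
  · obtain ⟨y, rfl⟩ := Nat.exists_eq_add_of_le' h
    rw [upN_add]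
    rfl

theorem inst_of_lt {k x : ℕ} (ts : Fin k → L.Term ℕ) (h : x < k) : inst ts x = ts ⟨x, h⟩ := by
  simp [inst, h]

theorem inst_add {k : ℕ} (x : ℕ) (ts : Fin k → L.Term ℕ) : inst ts (x + k) = var x := by
  simp [inst]

theorem assign_apply {n : ℕ} {xs : Fin n → ℕ} (hxs : Function.Injective xs)
    (ts : Fin n → L.Term ℕ) (i : Fin n) : assign xs ts (xs i) = ts i := by
  have h : ∃ j, xs j = xs i := ⟨i, rfl⟩
  rw [assign, dif_pos h, hxs h.choose_spec]

theorem mem_dom {σ : Subst L} {x : ℕ} : x ∈ σ.dom ↔ σ x ≠ var x := Iff.rfl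

theorem notMem_dom {σ : Subst L} {x : ℕ} : x ∉ σ.dom ↔ σ x = var x := not_not

theorem eq_var_of_notMem_vars {σ : Subst L} {x : ℕ} (h : x ∉ σ.vars) : σ x = var x :=
  notMem_dom.1 fun hx => h (Or.inl hx)

/-- A variable outside `σ.vars` is mapped to itself and occurs in no other image. -/
theorem eq_of_mem_varFinset {σ : Subst L} {x y : ℕ} (h : x ∉ σ.vars)
    (hy : x ∈ (σ y).varFinset) : y = x := by
  by_cases hd : y ∈ σ.dom
  · exact absurd (Or.inr ⟨y, hd, hy⟩) h
  · rw [notMem_dom.1 hd] at hy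
    exact (Finset.mem_singleton.1 hy).symm

theorem mem_vars_of_mem_varFinset {σ : Subst L} {x y : ℕ} (hy : x ∈ (σ y).varFinset) :
    x = y ∨ x ∈ σ.vars := by
  by_cases h : x ∈ σ.vars
  · exact Or.inr h
  · exact Or.inl (eq_of_mem_varFinset h hy).symm

theorem vars_comp_subset (σ τ : Subst L) : (σ.comp τ).vars ⊆ σ.vars ∪ τ.vars := by
  intro x hx
  by_contra hn
  rw [Set.mem_union, not_or] at hn
  rcases hx with hx | ⟨y, hy, hx⟩
  · apply hx
    simp [comp, eq_var_of_notMem_vars hn.1, eq_var_of_notMem_vars hn.2]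
  · obtain ⟨z, hz, hxz⟩ := mem_varFinset_subst.1 hx
    obtain rfl := eq_of_mem_varFinset hn.2 hxz
    obtain rfl := eq_of_mem_varFinset hn.1 hz
    exact hy (by simp [comp, eq_var_of_notMem_vars hn.1, eq_var_of_notMem_vars hn.2])

theorem mem_vars_comp_of_left {θ σ : Subst L} {x : ℕ} (h : x ∈ θ.vars) (hσ : x ∉ σ.vars) :
    x ∈ (θ.comp σ).vars := by
  have hx := eq_var_of_notMem_vars hσ
  rcases h with h | ⟨y, hy, h⟩
  · refine Or.inl fun he => h ?_
    have hmem : x ∈ ((θ x).subst σ).varFinset := by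
      change (θ x).subst σ = var x at he
      rw [he]; simp
    obtain ⟨z, hz, hxz⟩ := mem_varFinset_subst.1 hmem
    obtain rfl := eq_of_mem_varFinset hσ hxz
    change (θ z).subst σ = var z at he
    cases hθ : θ z with
    | var w => rw [hθ] at hz; simp at hz; rw [hz]
    | func f ts => rw [hθ] at he; simp at he
  · have hmem : x ∈ ((θ.comp σ) y).varFinset := mem_varFinset_subst.2 ⟨x, h, by simp [hx]⟩
    by_cases hd : y ∈ (θ.comp σ).dom
    · exact Or.inr ⟨y, hd, hmem⟩
    · -- `θ y` would be a variable that `σ` maps to `y`, hence equal to `x`, which `σ` fixes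
      exfalso
      have he : (θ y).subst σ = var y := notMem_dom.1 hd
      obtain rfl : x = y := by
        rw [notMem_dom.1 hd] at hmem
        simpa using hmem
      cases hθ : θ x with
      | var w => rw [hθ] at h; simp at h; exact hy (by rw [hθ, h])
      | func f ts => rw [hθ] at he; simp at he

theorem vars_subset_comp_of_dom {θ δ : Subst L} (h : ∀ x ∈ δ.dom, θ x = var x) :
    δ.vars ⊆ (θ.comp δ).vars := by
  have hd : ∀ x ∈ δ.dom, (θ.comp δ) x = δ x := fun x hx => by simp [comp, h x hx]
  rintro x (hx | ⟨y, hy, hx⟩)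
  · exact Or.inl (by rw [mem_dom, hd x hx]; exact hx)
  · exact Or.inr ⟨y, by rw [mem_dom, hd y hy]; exact hy, by rw [hd y hy]; exact hx⟩

theorem notMem_dom_of_idem {σ : Subst L} (h : σ.comp σ = σ) {x z : ℕ}
    (hz : z ∈ (σ x).varFinset) : σ z = var z := by
  have h1 : (σ x).subst σ = (σ x).subst var := by
    rw [term_subst_var]; exact congrFun h x
  generalize σ x = t at *
  induction t with
  | var y => simp at hz; subst hz; simpa using h1
  | func f ts ih =>
    simp only [FirstOrder.Language.Term.varFinset, Finset.mem_biUnion] at hz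
    obtain ⟨i, -, hi⟩ := hz
    refine ih i hi ?_
    simp only [FirstOrder.Language.Term.subst] at h1
    have := (FirstOrder.Language.Term.func.inj h1).2
    exact congrFun (eq_of_heq this.2) i

theorem idem_of_forall {σ : Subst L} (h : ∀ x, ∀ z ∈ (σ x).varFinset, σ z = var z) :
    σ.comp σ = σ :=
  funext fun x => term_subst_eq_self (h x)

end Subst

/-! ### Substitution in formulas -/

namespace Goal

theorem subst_subst (B : Goal L) : ∀ σ τ : Subst L,
    (B.subst σ).subst τ = B.subst (σ.comp τ) := by
  induction B <;> intro σ τ <;>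
    simp_all [subst, Subst.term_subst_subst, Subst.up_comp, Subst.upN_comp]

theorem subst_congr {B : Goal L} : ∀ {σ τ : Subst L}, (∀ x ∈ B.freeVars, σ x = τ x) →
    B.subst σ = B.subst τ := by
  induction B with
  | eq s t =>
    intro σ τ h
    simp only [subst]
    rw [Subst.term_subst_congr fun x hx => h x (Or.inl hx),
      Subst.term_subst_congr fun x hx => h x (Or.inr hx)]
  | call p ts =>
    intro σ τ h
    simp only [subst]
    congr 1
    funext i
    exact Subst.term_subst_congr fun x hx => h x ⟨i, hx⟩
  | conj B C ihB ihC =>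
    intro σ τ h
    simp only [subst]
    rw [ihB fun x hx => h x (Or.inl hx), ihC fun x hx => h x (Or.inr hx)]
  | disj B C ihB ihC =>
    intro σ τ h
    simp only [subst]
    rw [ihB fun x hx => h x (Or.inl hx), ihC fun x hx => h x (Or.inr hx)]
  | neg B ih =>
    intro σ τ h
    simp only [subst]
    rw [ih h]
  | ex B ih =>
    intro σ τ h
    simp only [subst]
    rw [ih]
    intro x hx
    cases x with
    | zero => rfl
    | succ x => simp [Subst.up, h x hx]
  | ifThen k B C ihB ihC =>
    intro σ τ h
    have key : ∀ x ∈ B.freeVars ∪ C.freeVars, σ.upN k x = τ.upN k x := by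
      intro x hx
      rcases lt_or_ge x k with hk | hk
      · rw [Subst.upN_of_lt _ hk, Subst.upN_of_lt _ hk]
      · obtain ⟨y, rfl⟩ := Nat.exists_eq_add_of_le' hk
        rw [Subst.upN_add, Subst.upN_add, h y hx]
    simp only [subst]
    rw [ihB fun x hx => key x (Or.inl hx), ihC fun x hx => key x (Or.inr hx)]

theorem subst_var (B : Goal L) : B.subst var = B := by
  have h1 : Subst.up (var : Subst L) = var := Subst.upN_var 1
  induction B <;> simp_all [subst, Subst.term_subst_var, Subst.upN_var]

theorem subst_eq_self {B : Goal L} {σ : Subst L} (h : ∀ x ∈ B.freeVars, σ x = var x) :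
    B.subst σ = B :=
  (subst_congr h).trans (subst_var B)

theorem Ground.subst_eq {B : Goal L} (h : B.Ground) (σ : Subst L) : B.subst σ = B :=
  subst_eq_self fun x hx => by rw [h] at hx; exact hx.elim

theorem exists_upN_iff {S : Set ℕ} {k x : ℕ} {σ : Subst L} :
    (∃ y ∈ S, x + k ∈ (σ.upN k y).varFinset) ↔ ∃ y, y + k ∈ S ∧ x ∈ (σ y).varFinset := by
  constructor
  · rintro ⟨y, hy, hx⟩
    rcases lt_or_ge y k with hk | hk
    · rw [Subst.upN_of_lt _ hk] at hx
      simp at hx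
      omega
    · obtain ⟨z, rfl⟩ := Nat.exists_eq_add_of_le' hk
      rw [Subst.upN_add, Subst.mem_varFinset_subst] at hx
      obtain ⟨w, hw, hxw⟩ := hx
      simp at hxw
      exact ⟨z, hy, hxw ▸ hw⟩
  · rintro ⟨y, hy, hx⟩
    exact ⟨y + k, hy, by
      rw [Subst.upN_add, Subst.mem_varFinset_subst]; exact ⟨x, hx, by simp⟩⟩

theorem mem_freeVars_subst {B : Goal L} : ∀ {σ : Subst L} {x : ℕ},
    x ∈ (B.subst σ).freeVars ↔ ∃ y ∈ B.freeVars, x ∈ (σ y).varFinset := by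
  induction B with
  | eq s t =>
    intro σ x
    simp only [subst, freeVars, Set.mem_ofPred_eq, Subst.mem_varFinset_subst, or_and_right,
      exists_or]
  | call p ts =>
    intro σ x
    simp only [subst, freeVars, Set.mem_ofPred_eq, Subst.mem_varFinset_subst]
    exact ⟨fun ⟨i, y, hy, hx⟩ => ⟨y, ⟨i, hy⟩, hx⟩, fun ⟨y, ⟨i, hy⟩, hx⟩ => ⟨i, y, hy, hx⟩⟩
  | conj B C ihB ihC =>
    intro σ x
    simp only [subst, freeVars, Set.mem_union, ihB, ihC, or_and_right, exists_or]
  | disj B C ihB ihC =>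
    intro σ x
    simp only [subst, freeVars, Set.mem_union, ihB, ihC, or_and_right, exists_or]
  | neg B ih => exact ih
  | ex B ih =>
    intro σ x
    simp only [subst, freeVars, Set.mem_ofPred_eq, ih]
    exact exists_upN_iff (k := 1)
  | ifThen k B C ihB ihC =>
    intro σ x
    simp only [subst, freeVars, Set.mem_ofPred_eq, Set.mem_union, ihB, ihC]
    rw [← exists_or]
    simp only [← or_and_right]
    exact exists_upN_iff (S := B.freeVars ∪ C.freeVars)

theorem mem_freeVars_inst {k : ℕ} {B : Goal L} {ts : Fin k → L.Term ℕ} {x : ℕ} :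
    x ∈ (B.inst ts).freeVars ↔
      x + k ∈ B.freeVars ∨ ∃ i : Fin k, (i : ℕ) ∈ B.freeVars ∧ x ∈ (ts i).varFinset := by
  rw [inst, mem_freeVars_subst]
  constructor
  · rintro ⟨y, hy, hx⟩
    rcases lt_or_ge y k with hk | hk
    · rw [Subst.inst_of_lt _ hk] at hx
      exact Or.inr ⟨⟨y, hk⟩, hy, hx⟩
    · obtain ⟨z, rfl⟩ := Nat.exists_eq_add_of_le' hk
      rw [Subst.inst_add] at hx
      simp at hx
      exact Or.inl (hx ▸ hy)
  · rintro (h | ⟨i, hi, hx⟩)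
    · exact ⟨x + k, h, by rw [Subst.inst_add]; simp⟩
    · exact ⟨i, hi, by rw [Subst.inst_of_lt _ i.2]; exact hx⟩

theorem exN_succ (k : ℕ) (B : Goal L) : exN (k + 1) B = exN k (ex B) :=
  Function.iterate_succ_apply ex k B

theorem mem_freeVars_exN {k : ℕ} {B : Goal L} {x : ℕ} :
    x ∈ (exN k B).freeVars ↔ x + k ∈ B.freeVars := by
  induction k generalizing B with
  | zero => rfl
  | succ k ih => rw [exN_succ, ih]; rfl

theorem freeVars_finite (B : Goal L) : B.freeVars.Finite := by
  induction B with
  | eq s t =>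
    exact (s.varFinset ∪ t.varFinset).finite_toSet.subset fun x hx => by simpa [freeVars] using hx
  | call p ts =>
    exact (Finset.univ.biUnion fun i => (ts i).varFinset).finite_toSet.subset
      fun x hx => by simpa [freeVars] using hx
  | conj B C ihB ihC => exact ihB.union ihC
  | disj B C ihB ihC => exact ihB.union ihC
  | neg B ih => exact ih
  | ex B ih => exact ih.preimage (add_left_injective 1).injOn
  | ifThen k B C ihB ihC => exact (ihB.union ihC).preimage (add_left_injective k).injOn

end Goal

theorem stackVars_nil : stackVars ([] : List (Goal L)) = ∅ := by
  simp [stackVars]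

theorem stackVars_cons (B : Goal L) (α : List (Goal L)) :
    stackVars (B :: α) = B.freeVars ∪ stackVars α := by
  ext x
  simp [stackVars]

theorem stackVars_finite (α : List (Goal L)) : (stackVars α).Finite := by
  induction α with
  | nil => simp [stackVars_nil]
  | cons B α ih => rw [stackVars_cons]; exact B.freeVars_finite.union ih

theorem mem_stackVars_map_subst {α : List (Goal L)} {σ : Subst L} {x : ℕ} :
    x ∈ stackVars (α.map fun B => B.subst σ) ↔ ∃ y ∈ stackVars α, x ∈ (σ y).varFinset := by
  simp only [stackVars, List.mem_map, Set.mem_ofPred_eq]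
  constructor
  · rintro ⟨_, ⟨B, hB, rfl⟩, hx⟩
    obtain ⟨y, hy, hx⟩ := Goal.mem_freeVars_subst.1 hx
    exact ⟨y, ⟨B, hB, hy⟩, hx⟩
  · rintro ⟨y, ⟨B, hB, hy⟩, hx⟩
    exact ⟨_, ⟨B, hB, rfl⟩, Goal.mem_freeVars_subst.2 ⟨y, hy, hx⟩⟩

/-! ### Most general unifiers -/

/-- The sequence of equations `E` is solved by `τ`. -/
def Solves (τ : Subst L) (E : List (L.Term ℕ × L.Term ℕ)) : Prop :=
  ∀ e ∈ E, e.1.subst τ = e.2.subst τ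

/-- The substitution that replaces the variable `x` by `t`. -/
def bind (x : ℕ) (t : L.Term ℕ) : Subst L := fun y => if y = x then t else var y

/-- The number of symbols of a term. -/
def termSize : L.Term ℕ → ℕ
  | .var _ => 1
  | .func _ ts => 1 + ∑ i, termSize (ts i)

theorem termSize_pos (t : L.Term ℕ) : 0 < termSize t := by
  cases t <;> simp [termSize]

theorem termSize_le_subst {t : L.Term ℕ} {x : ℕ} (τ : Subst L) (hx : x ∈ t.varFinset) :
    termSize (τ x) ≤ termSize (t.subst τ) ∧
      (t ≠ var x → termSize (τ x) < termSize (t.subst τ)) := by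
  induction t with
  | var y => simp at hx; subst hx; simp
  | func f ts ih =>
    simp only [FirstOrder.Language.Term.varFinset, Finset.mem_biUnion] at hx
    obtain ⟨i, -, hi⟩ := hx
    have h1 := (ih i hi).1
    have h2 : termSize ((ts i).subst τ) ≤ ∑ j, termSize ((ts j).subst τ) :=
      Finset.single_le_sum (f := fun j => termSize ((ts j).subst τ)) (fun _ _ => Nat.zero_le _)
        (Finset.mem_univ i)
    simp only [FirstOrder.Language.Term.subst, termSize]
    exact ⟨by omega, fun _ => by omega⟩

/-- A variable that occurs properly in `t` cannot be unified with `t`. -/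
theorem occurs_check {t : L.Term ℕ} {x : ℕ} {τ : Subst L} (hx : x ∈ t.varFinset)
    (h : τ x = t.subst τ) : t = var x := by
  by_contra hne
  have := (termSize_le_subst τ hx).2 hne
  rw [h] at this
  exact lt_irrefl _ this

theorem bind_comp_of_eq {x : ℕ} {t : L.Term ℕ} {τ : Subst L} (h : τ x = t.subst τ) :
    (bind x t).comp τ = τ := by
  funext y
  by_cases hy : y = x
  · subst hy; simp [Subst.comp, bind, h]
  · simp [Subst.comp, bind, hy]

theorem subst_bind_of_notMem {x : ℕ} {s t : L.Term ℕ} (h : x ∉ s.varFinset) :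
    s.subst (bind x t) = s :=
  Subst.term_subst_eq_self fun y hy => by
    have : y ≠ x := fun he => h (he ▸ hy)
    simp [bind, this]

/-- A solved form of a system of equations: a solution `σ` with variables in `X` through which every
other solution factors. -/
def IsSolution (X : Set ℕ) (E : List (L.Term ℕ × L.Term ℕ)) (σ : Subst L) : Prop :=
  Solves σ E ∧ (∀ τ, Solves τ E → τ = σ.comp τ) ∧ σ.vars ⊆ X

theorem solves_map_bind {x : ℕ} {t : L.Term ℕ} {τ : Subst L} {E : List (L.Term ℕ × L.Term ℕ)} :
    Solves τ (E.map fun e => (e.1.subst (bind x t), e.2.subst (bind x t))) ↔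
      Solves ((bind x t).comp τ) E := by
  simp only [Solves, List.forall_mem_map, Subst.term_subst_subst]

theorem IsSolution.bind {X : Set ℕ} {x : ℕ} {t : L.Term ℕ} {σ : Subst L}
    {E : List (L.Term ℕ × L.Term ℕ)} (hx : x ∈ X) (ht : x ∉ t.varFinset)
    (htX : ↑t.varFinset ⊆ X)
    (h : IsSolution (X \ {x})
      (E.map fun e => (e.1.subst (bind x t), e.2.subst (bind x t))) σ) :
    IsSolution X ((var x, t) :: E) ((bind x t).comp σ) := by
  obtain ⟨h1, h2, h3⟩ := h
  refine ⟨?_, ?_, ?_⟩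
  · intro e he
    rcases List.mem_cons.1 he with rfl | he
    · simp only [FirstOrder.Language.Term.subst]
      rw [← Subst.term_subst_subst, subst_bind_of_notMem ht]
      simp [Subst.comp, FirmCut.bind]
    · exact solves_map_bind.1 h1 e he
  · intro τ hτ
    have hb : (FirmCut.bind x t).comp τ = τ :=
      bind_comp_of_eq (hτ _ List.mem_cons_self)
    have : τ = σ.comp τ := h2 τ (solves_map_bind.2 (by
      rw [hb]; exact fun e he => hτ e (List.mem_cons_of_mem _ he)))
    rw [Subst.comp_assoc, ← this, hb]
  · refine (Subst.vars_comp_subset _ _).trans (Set.union_subset ?_ (h3.trans Set.sdiff_subset))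
    have hd : ∀ y ∈ (FirmCut.bind x t).dom, y = x := by
      intro y hy
      by_contra hne
      exact hy (by simp [FirmCut.bind, hne])
    rintro y (hy | ⟨z, hz, hy⟩)
    · exact hd y hy ▸ hx
    · rw [hd z hz] at hy
      simp [FirmCut.bind] at hy
      exact htX hy

/-- Unification by elimination of variables and decomposition of compound terms.  The induction is on
the number of variables and, for a fixed set of variables, on the number of symbols. -/
theorem exists_isSolution (n : ℕ) : ∀ (X : Finset ℕ), X.card = n → ∀ (m : ℕ)
    (E : List (L.Term ℕ × L.Term ℕ)),
    (E.map fun e => termSize e.1 + termSize e.2).sum ≤ m →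
    (∀ e ∈ E, e.1.varFinset ⊆ X ∧ e.2.varFinset ⊆ X) → (∃ τ, Solves τ E) →
    ∃ σ : Subst L, IsSolution ↑X E σ := by
  induction n using Nat.strong_induction_on with
  | _ n ihn =>
  intro X hX m
  -- elimination of a variable `x` that does not occur in `t`
  have elim : ∀ (x : ℕ) (t : L.Term ℕ) (E : List (L.Term ℕ × L.Term ℕ)),
      x ∉ t.varFinset → x ∈ X → t.varFinset ⊆ X →
      (∀ e ∈ E, e.1.varFinset ⊆ X ∧ e.2.varFinset ⊆ X) → (∃ τ, Solves τ ((var x, t) :: E)) →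
      ∃ σ : Subst L, IsSolution ↑X ((var x, t) :: E) σ := by
    rintro x t E ht hx htX hE ⟨τ, hτ⟩
    have hsub : ∀ s : L.Term ℕ, s.varFinset ⊆ X → (s.subst (bind x t)).varFinset ⊆ X.erase x := by
      intro s hs y hy
      obtain ⟨z, hz, hyz⟩ := Subst.mem_varFinset_subst.1 hy
      by_cases hzx : z = x
      · simp [bind, hzx] at hyz
        exact Finset.mem_erase.2 ⟨fun h => ht (h ▸ hyz), htX hyz⟩
      · simp [bind, hzx] at hyz
        subst hyz
        exact Finset.mem_erase.2 ⟨hzx, hs hz⟩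
    obtain ⟨σ, hσ⟩ := ihn (X.erase x).card (by
        rw [← hX]; exact Finset.card_erase_lt_of_mem hx) (X.erase x) rfl _
      (E.map fun e => (e.1.subst (bind x t), e.2.subst (bind x t))) le_rfl
      (by
        intro e he
        obtain ⟨e, he', rfl⟩ := List.mem_map.1 he
        exact ⟨hsub _ (hE e he').1, hsub _ (hE e he').2⟩)
      ⟨τ, solves_map_bind.2 (by
        rw [bind_comp_of_eq (hτ _ List.mem_cons_self)]
        exact fun e he => hτ e (List.mem_cons_of_mem _ he))⟩
    rw [Finset.coe_erase] at hσ
    exact ⟨_, hσ.bind hx ht (by exact_mod_cast htX)⟩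
  induction m using Nat.strong_induction_on with
  | _ m ihm =>
  intro E hm hE ⟨τ, hτ⟩
  match E with
  | [] =>
    exact ⟨var, by simp [Solves], fun _ _ => rfl, by simp [Subst.vars, Subst.dom]⟩
  | (s, t) :: E =>
    have hst := hE _ List.mem_cons_self
    have hE' : ∀ e ∈ E, e.1.varFinset ⊆ X ∧ e.2.varFinset ⊆ X :=
      fun e he => hE e (List.mem_cons_of_mem _ he)
    have hτst : s.subst τ = t.subst τ := hτ _ List.mem_cons_self
    have hτE : Solves τ E := fun e he => hτ e (List.mem_cons_of_mem _ he)
    have hpos := termSize_pos s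
    simp only [List.map_cons, List.sum_cons] at hm
    have swap : ∀ σ : Subst L, IsSolution ↑X ((t, s) :: E) σ → IsSolution ↑X ((s, t) :: E) σ := by
      have hsw : ∀ σ : Subst L, Solves σ ((t, s) :: E) ↔ Solves σ ((s, t) :: E) := by
        intro σ
        simp only [Solves, List.forall_mem_cons, eq_comm]
      rintro σ ⟨h1, h2, h3⟩
      exact ⟨(hsw σ).1 h1, fun τ h => h2 τ ((hsw τ).2 h), h3⟩
    by_cases hs : ∃ x, s = var x
    · obtain ⟨x, rfl⟩ := hs
      by_cases hx : x ∈ t.varFinset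
      · obtain rfl := occurs_check hx hτst
        obtain ⟨σ, h1, h2, h3⟩ := ihm (m - 1) (by omega) E (by omega) hE' ⟨τ, hτE⟩
        refine ⟨σ, ?_, fun τ hτ => h2 τ fun e he => hτ e (List.mem_cons_of_mem _ he), h3⟩
        intro e he
        rcases List.mem_cons.1 he with rfl | he
        · rfl
        · exact h1 e he
      · exact elim x t E hx (hst.1 (by simp)) hst.2 hE' ⟨τ, hτ⟩
    by_cases ht : ∃ x, t = var x
    · obtain ⟨x, rfl⟩ := ht
      by_cases hx : x ∈ s.varFinset
      · exact absurd ⟨x, occurs_check hx hτst.symm⟩ hs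
      · obtain ⟨σ, hσ⟩ := elim x s E hx (hst.2 (by simp)) hst.1 hE'
          ⟨τ, by
            intro e he
            rcases List.mem_cons.1 he with rfl | he
            · exact hτst.symm
            · exact hτE e he⟩
        exact ⟨σ, swap σ hσ⟩
    match s, t with
    | .var x, _ => exact absurd ⟨x, rfl⟩ hs
    | _, .var x => exact absurd ⟨x, rfl⟩ ht
    | .func (l := l) f ss, .func (l := l') g ts =>
      simp only [FirstOrder.Language.Term.subst, FirstOrder.Language.Term.func.injEq] at hτst
      obtain ⟨rfl, hfg, hargs⟩ := hτst
      obtain rfl := eq_of_heq hfg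
      have hargs' : ∀ i, (ss i).subst τ = (ts i).subst τ := congrFun (eq_of_heq hargs)
      have hiff : ∀ υ : Subst L,
          Solves υ (List.ofFn (fun i => (ss i, ts i)) ++ E) ↔
            Solves υ ((func f ss, func f ts) :: E) := by
        intro υ
        simp only [Solves, List.mem_append, or_imp, forall_and, List.forall_mem_cons,
          List.forall_mem_ofFn_iff, FirstOrder.Language.Term.subst,
          FirstOrder.Language.Term.func.injEq, heq_eq_eq, true_and, funext_iff]
      obtain ⟨σ, h1, h2, h3⟩ := ihm (m - 1) (by omega)
        (List.ofFn (fun i => (ss i, ts i)) ++ E) (by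
          simp only [termSize] at hm
          simp only [List.map_append, List.sum_append, List.map_ofFn, List.sum_ofFn,
            Function.comp_def, Finset.sum_add_distrib]
          omega)
        (by
          intro e he
          rcases List.mem_append.1 he with he | he
          · obtain ⟨i, rfl⟩ := (List.mem_ofFn' _ _).1 he
            refine ⟨fun x hx => hst.1 ?_, fun x hx => hst.2 ?_⟩ <;>
            · simp only [FirstOrder.Language.Term.varFinset, Finset.mem_biUnion]
              exact ⟨i, Finset.mem_univ i, hx⟩
          · exact hE' e he)
        ⟨τ, (hiff τ).2 hτ⟩
      exact ⟨σ, (hiff σ).1 h1, fun υ hυ => h2 υ ((hiff υ).2 hυ), h3⟩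

theorem exists_isMGU {s t : L.Term ℕ} (h : Unifiable s t) : ∃ σ : Subst L, IsMGU s t σ := by
  obtain ⟨τ, hτ⟩ := h
  obtain ⟨σ, h1, h2, h3⟩ := exists_isSolution _ (s.varFinset ∪ t.varFinset) rfl _ [(s, t)] le_rfl
    (by simp [Finset.subset_union_left, Finset.subset_union_right])
    ⟨τ, by simpa [Solves] using hτ⟩
  refine ⟨σ, by simpa [Solves] using h1, fun τ hτ => ⟨τ, h2 τ (by simpa [Solves] using hτ)⟩,
    (h2 σ h1).symm, fun x hx => by simpa using h3 hx⟩

/-- Every unifier factors through a most general unifier by way of itself. -/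
theorem IsMGU.eq_comp {s t : L.Term ℕ} {σ τ : Subst L} (h : IsMGU s t σ)
    (hτ : s.subst τ = t.subst τ) : σ.comp τ = τ := by
  obtain ⟨δ, rfl⟩ := h.most_general τ hτ
  rw [← Subst.comp_assoc, h.idempotent]

/-! ### Existence and uniqueness of depth-first normal forms -/

namespace Goal

/-- `B ∧ C` with the disjunctions of `C` distributed over a single disjunct `B`. -/
def distribRight (B : Goal L) : Goal L → Goal L
  | disj C₁ C₂ => disj (distribRight B C₁) (distribRight B C₂)
  | C => conj B C

/-- The normal form of `B ∧ C`, for normal `B` and `C`. -/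
def nfConj : Goal L → Goal L → Goal L
  | disj B₁ B₂, C => disj (nfConj B₁ C) (nfConj B₂ C)
  | B, C => distribRight B C

/-- The normal form of `∃ x B`, for normal `B`. -/
def nfEx : Goal L → Goal L
  | disj B₁ B₂ => disj (nfEx B₁) (nfEx B₂)
  | B => ex B

/-- The normal form of `∃ x₁ … ∃ x_k B`, for normal `B`. -/
def nfExN (k : ℕ) (B : Goal L) : Goal L := nfEx^[k] B

/-- The normal form of `if[x₁, …, x_k](B, C)`, for normal `B` and `C`. -/
def nfIf (k : ℕ) : Goal L → Goal L → Goal L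
  | disj B₁ B₂, C => disj (nfIf k B₁ C) (nfConj (neg (nfExN k B₁)) (nfIf k B₂ C))
  | B, C => nfExN k (nfConj B C)

/-- The depth-first normal form of a formula, by structural recursion. -/
def nf : Goal L → Goal L
  | eq s t => eq s t
  | call p ts => call p ts
  | conj B C => nfConj B.nf C.nf
  | disj B C => disj B.nf C.nf
  | neg B => neg B.nf
  | ex B => nfEx B.nf
  | ifThen k B C => nfIf k B.nf C.nf

theorem nfExN_succ (k : ℕ) (B : Goal L) : nfExN (k + 1) B = nfExN k (nfEx B) :=
  Function.iterate_succ_apply nfEx k B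

end Goal

section NormalForm

open Goal

theorem not_negDisj_disj {B C : Goal L} : ¬ NegDisj (disj B C) := fun h => by cases h

theorem nfConj_of_negDisj {B C : Goal L} (h : NegDisj B) : nfConj B C = distribRight B C := by
  cases h <;> rfl

theorem distribRight_of_negDisj {B C : Goal L} (h : NegDisj C) : distribRight B C = conj B C := by
  cases h <;> rfl

theorem nfEx_of_negDisj {B : Goal L} (h : NegDisj B) : nfEx B = ex B := by
  cases h <;> rfl

theorem nfIf_of_negDisj {k : ℕ} {B C : Goal L} (h : NegDisj B) :
    nfIf k B C = nfExN k (nfConj B C) := by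
  cases h <;> rfl

theorem outerDisj_induction {motive : ∀ B : Goal L, OuterDisj B → Prop}
    (negDisj : ∀ B (h : NegDisj B), motive B (.negDisj h))
    (disj : ∀ B C (hB : OuterDisj B) (hC : OuterDisj C), motive B hB → motive C hC →
      motive (disj B C) (.disj hB hC))
    {B : Goal L} (h : OuterDisj B) : motive B h := by
  induction B with
  | disj B C ihB ihC =>
    cases h with
    | negDisj h => exact absurd h not_negDisj_disj
    | disj hB hC => exact disj B C hB hC (ihB hB) (ihC hC)
  | eq | call | conj | neg | ex | ifThen => cases h with
    | negDisj h => exact negDisj _ h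

theorem OuterDisj.distribRight {B C : Goal L} (hB : NegDisj B) (hC : OuterDisj C) :
    OuterDisj (distribRight B C) := by
  induction hC using outerDisj_induction with
  | negDisj C hC => rw [distribRight_of_negDisj hC]; exact .negDisj (.conj hB hC)
  | disj C₁ C₂ _ _ h₁ h₂ => exact .disj h₁ h₂

theorem OuterDisj.nfConj {B C : Goal L} (hB : OuterDisj B) (hC : OuterDisj C) :
    OuterDisj (nfConj B C) := by
  induction hB using outerDisj_induction with
  | negDisj B hB => rw [nfConj_of_negDisj hB]; exact .distribRight hB hC
  | disj B₁ B₂ _ _ h₁ h₂ => exact .disj h₁ h₂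

theorem OuterDisj.nfEx {B : Goal L} (hB : OuterDisj B) : OuterDisj (nfEx B) := by
  induction hB using outerDisj_induction with
  | negDisj B hB => rw [nfEx_of_negDisj hB]; exact .negDisj (.ex hB)
  | disj B₁ B₂ _ _ h₁ h₂ => exact .disj h₁ h₂

theorem OuterDisj.nfExN {B : Goal L} (k : ℕ) (hB : OuterDisj B) : OuterDisj (nfExN k B) := by
  induction k generalizing B with
  | zero => exact hB
  | succ k ih => rw [nfExN_succ]; exact ih hB.nfEx

theorem OuterDisj.nfIf {k : ℕ} {B C : Goal L} (hB : OuterDisj B) (hC : OuterDisj C) :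
    OuterDisj (nfIf k B C) := by
  induction hB using outerDisj_induction with
  | negDisj B hB =>
    rw [nfIf_of_negDisj hB]
    exact .nfExN k (.nfConj (.negDisj hB) hC)
  | disj B₁ B₂ h₁ _ ih₁ ih₂ =>
    exact .disj ih₁ (.nfConj (.negDisj (.neg (.nfExN k h₁))) ih₂)

theorem outerDisj_nf (B : Goal L) : OuterDisj B.nf := by
  induction B with
  | eq s t => exact .negDisj (.eq s t)
  | call p ts => exact .negDisj (.call p ts)
  | conj B C ihB ihC => exact ihB.nfConj ihC
  | disj B C ihB ihC => exact .disj ihB ihC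
  | neg B ih => exact .negDisj (.neg ih)
  | ex B ih => exact ih.nfEx
  | ifThen k B C ihB ihC => exact ihB.nfIf ihC

/-- Outer-disjunction formulas are irreducible. -/
theorem OuterDisj.not_rewrites {B B' : Goal L} (hB : OuterDisj B) : ¬ Rewrites B B' := by
  intro h
  induction h with
  | r1 B₁ B₂ C =>
    cases hB with | negDisj h => ?_
    cases h with | conj h1 h2 => exact not_negDisj_disj h1
  | r2 B C₁ C₂ =>
    cases hB with | negDisj h => ?_
    cases h with | conj h1 h2 => exact not_negDisj_disj h2
  | r3 B₁ B₂ =>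
    cases hB with | negDisj h => ?_
    cases h with | ex h1 => exact not_negDisj_disj h1
  | r4 | r5 =>
    cases hB with | negDisj h => ?_
    cases h
  | conj_left _ ih =>
    cases hB with | negDisj h => ?_
    cases h with | conj h1 h2 => exact ih (.negDisj h1)
  | conj_right _ ih =>
    cases hB with | negDisj h => ?_
    cases h with | conj h1 h2 => exact ih (.negDisj h2)
  | disj_left _ ih =>
    cases hB with
    | negDisj h => cases h
    | disj h1 h2 => exact ih h1
  | disj_right _ ih =>
    cases hB with
    | negDisj h => cases h
    | disj h1 h2 => exact ih h2
  | neg _ ih =>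
    cases hB with | negDisj h => ?_
    cases h with | neg h => exact ih h
  | ex _ ih =>
    cases hB with | negDisj h => ?_
    cases h with | ex h => exact ih (.negDisj h)
  | if_left | if_right =>
    cases hB with | negDisj h => ?_
    cases h

theorem nf_eq_self_and {B : Goal L} : (NegDisj B → B.nf = B) ∧ (OuterDisj B → B.nf = B) := by
  induction B with
  | eq | call => exact ⟨fun _ => rfl, fun _ => rfl⟩
  | conj B C ihB ihC =>
    have h : NegDisj (conj B C) → (conj B C).nf = conj B C := by
      intro h
      cases h with | conj h1 h2 => ?_
      rw [nf, ihB.1 h1, ihC.1 h2, nfConj_of_negDisj h1, distribRight_of_negDisj h2]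
    exact ⟨h, fun h' => by cases h' with | negDisj h' => exact h h'⟩
  | disj B C ihB ihC =>
    refine ⟨fun h => absurd h not_negDisj_disj, fun h => ?_⟩
    cases h with
    | negDisj h => cases h
    | disj h1 h2 => rw [nf, ihB.2 h1, ihC.2 h2]
  | neg B ih =>
    have h : NegDisj (neg B) → (neg B).nf = neg B := by
      intro h
      cases h with | neg h => rw [nf, ih.2 h]
    exact ⟨h, fun h' => by cases h' with | negDisj h' => exact h h'⟩
  | ex B ih =>
    have h : NegDisj (ex B) → (ex B).nf = ex B := by
      intro h
      cases h with | ex h => rw [nf, ih.1 h, nfEx_of_negDisj h]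
    exact ⟨h, fun h' => by cases h' with | negDisj h' => exact h h'⟩
  | ifThen => exact ⟨nofun, fun h => by cases h with | negDisj h => cases h⟩

theorem nf_exN (k : ℕ) (B : Goal L) : (exN k B).nf = nfExN k B.nf := by
  induction k generalizing B with
  | zero => rfl
  | succ k ih => rw [exN_succ, ih, nfExN_succ, nf]

/-- The rewrite rules preserve `Goal.nf`. -/
theorem Rewrites.nf_eq {B B' : Goal L} (h : Rewrites B B') : B.nf = B'.nf := by
  induction h with
  | r1 => rfl
  | r2 B C₁ C₂ h =>
    have hB := nf_eq_self_and.1 h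
    simp only [nf, hB, nfConj_of_negDisj h, distribRight]
  | r3 => rfl
  | r4 k B₁ B₂ C => simp only [nf, nfIf, nf_exN]
  | r5 k B C h =>
    have hB := nf_eq_self_and.1 h
    simp only [nf, nf_exN, hB, nfIf_of_negDisj h]
  | conj_left | conj_right | disj_left | disj_right | neg | ex | if_left | if_right =>
    simp_all [nf]

section Reach

local notation:50 B " ⇒* " C:51 => Relation.ReflTransGen Rewrites B C

theorem reach_conj {B B' C C' : Goal L} (hB : B ⇒* B') (hC : C ⇒* C') :
    conj B C ⇒* conj B' C' :=
  (hB.lift (fun X => conj X C) fun _ _ => .conj_left).trans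
    (hC.lift (fun X => conj B' X) fun _ _ => .conj_right)

theorem reach_disj {B B' C C' : Goal L} (hB : B ⇒* B') (hC : C ⇒* C') :
    disj B C ⇒* disj B' C' :=
  (hB.lift (fun X => disj X C) fun _ _ => .disj_left).trans
    (hC.lift (fun X => disj B' X) fun _ _ => .disj_right)

theorem reach_if {k : ℕ} {B B' C C' : Goal L} (hB : B ⇒* B') (hC : C ⇒* C') :
    ifThen k B C ⇒* ifThen k B' C' :=
  (hB.lift (fun X => ifThen k X C) fun _ _ => .if_left).trans
    (hC.lift (fun X => ifThen k B' X) fun _ _ => .if_right)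

theorem reach_neg {B B' : Goal L} (hB : B ⇒* B') : neg B ⇒* neg B' :=
  hB.lift _ fun _ _ => .neg

theorem reach_ex {B B' : Goal L} (hB : B ⇒* B') : ex B ⇒* ex B' :=
  hB.lift _ fun _ _ => .ex

theorem reach_distribRight {B C : Goal L} (hB : NegDisj B) : conj B C ⇒* distribRight B C := by
  induction C with
  | disj C₁ C₂ ih₁ ih₂ => exact .head (.r2 B C₁ C₂ hB) (reach_disj ih₁ ih₂)
  | _ => exact .refl

theorem reach_nfConj {B C : Goal L} (hB : OuterDisj B) : conj B C ⇒* nfConj B C := by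
  induction hB using outerDisj_induction with
  | negDisj B hB => rw [nfConj_of_negDisj hB]; exact reach_distribRight hB
  | disj B₁ B₂ _ _ h₁ h₂ => exact .head (.r1 B₁ B₂ C) (reach_disj h₁ h₂)

theorem reach_nfEx (B : Goal L) : ex B ⇒* nfEx B := by
  induction B with
  | disj B₁ B₂ ih₁ ih₂ => exact .head (.r3 B₁ B₂) (reach_disj ih₁ ih₂)
  | _ => exact .refl

theorem reach_exN {k : ℕ} {B B' : Goal L} (h : B ⇒* B') : exN k B ⇒* exN k B' := by
  induction k generalizing B B' with
  | zero => exact h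
  | succ k ih => rw [exN_succ, exN_succ]; exact ih (reach_ex h)

theorem reach_nfExN (k : ℕ) (B : Goal L) : exN k B ⇒* nfExN k B := by
  induction k generalizing B with
  | zero => exact .refl
  | succ k ih =>
    rw [exN_succ, nfExN_succ]
    exact (reach_exN (reach_nfEx B)).trans (ih _)

theorem reach_nfIf {k : ℕ} {B C : Goal L} (hB : OuterDisj B) : ifThen k B C ⇒* nfIf k B C := by
  induction hB using outerDisj_induction with
  | negDisj B hB =>
    rw [nfIf_of_negDisj hB]
    exact .head (.r5 k B C hB)
      ((reach_exN (reach_nfConj (.negDisj hB))).trans (reach_nfExN k _))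
  | disj B₁ B₂ h₁ _ ih₁ ih₂ =>
    refine .head (.r4 k B₁ B₂ C) (reach_disj ih₁ ?_)
    exact (reach_conj (reach_neg (reach_nfExN k B₁)) ih₂).trans
      (reach_nfConj (.negDisj (.neg (h₁.nfExN k))))

theorem reach_nf (B : Goal L) : B ⇒* B.nf := by
  induction B with
  | eq | call => exact .refl
  | conj B C ihB ihC => exact (reach_conj ihB ihC).trans (reach_nfConj (outerDisj_nf B))
  | disj B C ihB ihC => exact reach_disj ihB ihC
  | neg B ih => exact reach_neg ih
  | ex B ih => exact (reach_ex ih).trans (reach_nfEx _)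
  | ifThen k B C ihB ihC => exact (reach_if ihB ihC).trans (reach_nfIf (outerDisj_nf B))

end Reach

theorem isDFNF_nf (B : Goal L) : IsDFNF B B.nf :=
  ⟨reach_nf B, fun _ => (outerDisj_nf B).not_rewrites⟩

theorem IsDFNF.eq_nf {B D : Goal L} (h : IsDFNF B D) : D = B.nf := by
  -- an irreducible formula is its own normal form, as it rewrites to it
  have hD : D.nf = D := by
    rcases (reach_nf D).cases_head with h' | ⟨D', h', -⟩
    · exact h'.symm
    · exact absurd h' (h.2 D')
  rw [← hD]
  have h1 := h.1
  clear h hD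
  induction h1 with
  | refl => rfl
  | tail _ h ih => rw [← h.nf_eq, ih]

theorem existsUnique_isDFNF (B : Goal L) : ∃! D : Goal L, IsDFNF B D :=
  ⟨B.nf, isDFNF_nf B, fun _ h => h.eq_nf⟩

theorem dfnf_eq_nf (B : Goal L) : dfnf B = B.nf :=
  (Classical.epsilon_spec (p := IsDFNF B) ⟨B.nf, isDFNF_nf B⟩).eq_nf

theorem Rewrites.freeVars_subset {B B' : Goal L} (h : Rewrites B B') :
    B'.freeVars ⊆ B.freeVars := by
  induction h with
  | r1 B₁ B₂ C => intro x; simp only [freeVars, Set.mem_union]; tauto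
  | r2 B C₁ C₂ _ => intro x; simp only [freeVars, Set.mem_union]; tauto
  | r3 B₁ B₂ =>
    intro x; simp only [freeVars, Set.mem_union, Set.mem_ofPred_eq]; tauto
  | r4 k B₁ B₂ C =>
    intro x
    simp only [freeVars, Set.mem_union, Set.mem_ofPred_eq, mem_freeVars_exN]; tauto
  | r5 k B C _ =>
    intro x
    simp only [freeVars, Set.mem_union, Set.mem_ofPred_eq, mem_freeVars_exN]; tauto
  | conj_left _ ih => exact Set.union_subset_union_left _ ih
  | conj_right _ ih => exact Set.union_subset_union_right _ ih
  | disj_left _ ih => exact Set.union_subset_union_left _ ih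
  | disj_right _ ih => exact Set.union_subset_union_right _ ih
  | neg _ ih => exact ih
  | ex _ ih => exact fun x hx => ih hx
  | if_left _ ih => exact fun x hx => Set.union_subset_union_left _ ih hx
  | if_right _ ih => exact fun x hx => Set.union_subset_union_right _ ih hx

theorem freeVars_nf_subset (B : Goal L) : B.nf.freeVars ⊆ B.freeVars := by
  have h := reach_nf B
  generalize B.nf = D at h
  induction h with
  | refl => exact subset_rfl
  | tail _ h ih => exact h.freeVars_subset.trans ih

end NormalForm

/-! ### Truth functions of the disjuncts of a formula -/

namespace Truth

/-- Sequential conjunction. -/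
def and : Truth → Truth → Truth
  | T, b => b
  | U, _ => U
  | F, _ => F

/-- Sequential disjunction. -/
def or : Truth → Truth → Truth
  | T, _ => T
  | U, _ => U
  | F, b => b

/-- Negation. -/
def not : Truth → Truth
  | T => F
  | U => U
  | F => T

theorem and_assoc (a b c : Truth) : (a.and b).and c = a.and (b.and c) := by
  cases a <;> rfl

theorem or_assoc (a b c : Truth) : (a.or b).or c = a.or (b.or c) := by
  cases a <;> rfl

theorem not_or (a b : Truth) : (a.or b).not = a.not.and b.not := by
  cases a <;> rfl

@[simp] theorem and_T (a : Truth) : a.and T = a := by cases a <;> rfl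

@[simp] theorem T_and (a : Truth) : T.and a = a := rfl

@[simp] theorem U_and (a : Truth) : U.and a = U := rfl

@[simp] theorem F_and (a : Truth) : F.and a = F := rfl

@[simp] theorem T_or (a : Truth) : T.or a = T := rfl

@[simp] theorem U_or (a : Truth) : U.or a = U := rfl

@[simp] theorem F_or (a : Truth) : F.or a = a := rfl

@[simp] theorem or_F (a : Truth) : a.or F = a := by cases a <;> rfl

theorem and_eq_T {a b : Truth} : a.and b = T ↔ a = T ∧ b = T := by
  cases a <;> simp

theorem and_eq_F {a b : Truth} : a.and b = F ↔ a = F ∨ a = T ∧ b = F := by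
  cases a <;> simp

theorem and_eq_U {a b : Truth} : a.and b = U ↔ a = U ∨ a = T ∧ b = U := by
  cases a <;> simp

theorem eq_U_of_ne {a : Truth} (hT : a ≠ T) (hF : a ≠ F) : a = U := by
  cases a <;> simp_all

theorem maxT_eq_T {S : Set Truth} : maxT S = T ↔ T ∈ S := by
  unfold maxT; split_ifs <;> simp_all

theorem maxT_eq_F {S : Set Truth} : maxT S = F ↔ ∀ w ∈ S, w = F := by
  unfold maxT
  split_ifs with h1 h2
  · simp only [false_iff]
    exact fun h => by cases h _ h1
  · simp only [false_iff]
    exact fun h => by cases h _ h2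
  · simp only [true_iff]
    intro w hw
    cases w <;> tauto

end Truth

/-- The ground terms. -/
abbrev GTerm (L : FirstOrder.Language.{u, v}) : Type u := {t : L.Term ℕ // GroundTerm t}

/-- A ground substitution: an assignment of ground terms to all variables. -/
abbrev Env (L : FirstOrder.Language.{u, v}) : Type u := ℕ → GTerm L

namespace Env

/-- A ground substitution, as a substitution. -/
def toSubst (τ : Env L) : Subst L := fun x => (τ x).1

theorem groundTerm_subst (t : L.Term ℕ) (τ : Env L) : GroundTerm (t.subst τ.toSubst) := by
  refine Finset.eq_empty_of_forall_notMem fun x hx => ?_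
  obtain ⟨y, -, hy⟩ := Subst.mem_varFinset_subst.1 hx
  have := (τ y).2
  rw [GroundTerm] at this
  simp [toSubst, this] at hy

/-- The ground substitution `στ`: first `σ`, then `τ`. -/
def sub (σ : Subst L) (τ : Env L) : Env L := fun x => ⟨_, groundTerm_subst (σ x) τ⟩

/-- The ground substitution for use below one more binder, whose variable gets the value `t`. -/
def cons (t : GTerm L) (τ : Env L) : Env L
  | 0 => t
  | x + 1 => τ x

theorem toSubst_sub (σ : Subst L) (τ : Env L) : (sub σ τ).toSubst = σ.comp τ.toSubst := rfl

theorem sub_comp (σ δ : Subst L) (τ : Env L) : sub (σ.comp δ) τ = sub σ (sub δ τ) := by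
  funext x
  exact Subtype.ext (Subst.term_subst_subst (σ x) δ τ.toSubst)

theorem sub_apply_congr {σ σ' : Subst L} {τ τ' : Env L} {x x' : ℕ} (hσ : σ x = σ' x')
    (h : ∀ y ∈ (σ x).varFinset, τ y = τ' y) : sub σ τ x = sub σ' τ' x' := by
  refine Subtype.ext ?_
  change (σ x).subst _ = (σ' x').subst _
  rw [← hσ]
  exact Subst.term_subst_congr fun y hy => congrArg Subtype.val (h y hy)

theorem sub_eq_of_eq_var {σ : Subst L} (τ : Env L) {x y : ℕ} (h : σ x = var y) :
    sub σ τ x = τ y := by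
  refine Subtype.ext ?_
  change (σ x).subst _ = _
  rw [h]
  rfl

theorem subst_eq_subst_iff {s t : L.Term ℕ} {τ : Env L} {σ : Subst L} :
    s.subst (sub σ τ).toSubst = t.subst (sub σ τ).toSubst ↔
      (s.subst σ).subst τ.toSubst = (t.subst σ).subst τ.toSubst := by
  rw [toSubst_sub, Subst.term_subst_subst, Subst.term_subst_subst]

theorem sub_up_cons (σ : Subst L) (t : GTerm L) (τ : Env L) :
    sub σ.up (cons t τ) = cons t (sub σ τ) := by
  funext x
  refine Subtype.ext ?_
  cases x with
  | zero => rfl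
  | succ x =>
    change ((σ x).relabel Nat.succ).subst _ = (σ x).subst _
    rw [Subst.term_relabel_eq_subst, Subst.term_subst_subst]
    rfl

end Env

/-- A truth function: a truth value for each ground substitution. -/
abbrev Fn (L : FirstOrder.Language.{u, v}) : Type u := Env L → Truth

namespace Fn

open Classical in
/-- The truth function of an equation. -/
noncomputable def eq (s t : L.Term ℕ) : Fn L :=
  fun τ => if s.subst τ.toSubst = t.subst τ.toSubst then Truth.T else Truth.F

/-- Pointwise sequential conjunction. -/
def and (f g : Fn L) : Fn L := fun τ => (f τ).and (g τ)

/-- Pointwise negation. -/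
def not (f : Fn L) : Fn L := fun τ => (f τ).not

/-- Existential quantification over the variable `0`. -/
noncomputable def ex (f : Fn L) : Fn L := fun τ => Truth.maxT {w | ∃ t, w = f (Env.cons t τ)}

/-- Existential quantification over the variables `0, …, k - 1`. -/
noncomputable def exN (k : ℕ) (f : Fn L) : Fn L := ex^[k] f

/-- The truth function of `Bσ`, if `f` is the one of `B`. -/
def pull (σ : Subst L) (f : Fn L) : Fn L := fun τ => f (Env.sub σ τ)

/-- The sequential disjunction of a list of truth functions. -/
def disj : List (Fn L) → Fn L
  | [] => fun _ => Truth.F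
  | f :: fs => fun τ => (f τ).or (disj fs τ)

/-- The sequential conjunction of a list of truth functions. -/
def conj : List (Fn L) → Fn L
  | [] => fun _ => Truth.T
  | f :: fs => fun τ => (f τ).and (conj fs τ)

theorem eq_eq_T {s t : L.Term ℕ} {τ : Env L} :
    eq s t τ = Truth.T ↔ s.subst τ.toSubst = t.subst τ.toSubst := by
  unfold eq; split_ifs <;> simp_all

theorem eq_eq_F {s t : L.Term ℕ} {τ : Env L} :
    eq s t τ = Truth.F ↔ s.subst τ.toSubst ≠ t.subst τ.toSubst := by
  unfold eq; split_ifs <;> simp_all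

theorem eq_congr {s t s' t' : L.Term ℕ} {τ τ' : Env L}
    (h : s.subst τ.toSubst = t.subst τ.toSubst ↔ s'.subst τ'.toSubst = t'.subst τ'.toSubst) :
    eq s t τ = eq s' t' τ' := by
  unfold eq; split_ifs <;> simp_all

theorem ex_eq_T {f : Fn L} {τ : Env L} : ex f τ = Truth.T ↔ ∃ t, f (Env.cons t τ) = Truth.T := by
  rw [ex, Truth.maxT_eq_T]
  exact ⟨fun ⟨t, h⟩ => ⟨t, h.symm⟩, fun ⟨t, h⟩ => ⟨t, h.symm⟩⟩

theorem ex_eq_F {f : Fn L} {τ : Env L} : ex f τ = Truth.F ↔ ∀ t, f (Env.cons t τ) = Truth.F := by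
  rw [ex, Truth.maxT_eq_F]
  exact ⟨fun h t => h _ ⟨t, rfl⟩, fun h w ⟨t, ht⟩ => ht ▸ h t⟩

theorem exN_succ (k : ℕ) (f : Fn L) : exN (k + 1) f = exN k (ex f) :=
  Function.iterate_succ_apply ex k f

theorem exists_env_succ {k : ℕ} {τ : Env L} {p : Env L → Prop} :
    (∃ e : Env L, (∀ x, e (x + (k + 1)) = τ x) ∧ p e) ↔
      ∃ e : Env L, (∀ x, e (x + k) = τ x) ∧ ∃ t, p (Env.cons t e) := by
  constructor
  · rintro ⟨e, he, h⟩
    refine ⟨fun x => e (x + 1), he, e 0, ?_⟩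
    convert h using 1
    funext x
    cases x <;> rfl
  · rintro ⟨e, he, t, h⟩
    exact ⟨_, he, h⟩

theorem exN_eq_T {k : ℕ} {f : Fn L} {τ : Env L} :
    exN k f τ = Truth.T ↔ ∃ e : Env L, (∀ x, e (x + k) = τ x) ∧ f e = Truth.T := by
  induction k generalizing f with
  | zero =>
    refine ⟨fun h => ⟨τ, fun _ => rfl, h⟩, ?_⟩
    rintro ⟨e, he, h⟩
    obtain rfl : e = τ := funext he
    exact h
  | succ k ih =>
    rw [exN_succ, ih, exists_env_succ (p := fun e => f e = Truth.T)]
    simp only [ex_eq_T]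

theorem exN_eq_F {k : ℕ} {f : Fn L} {τ : Env L} :
    exN k f τ = Truth.F ↔ ∀ e : Env L, (∀ x, e (x + k) = τ x) → f e = Truth.F := by
  induction k generalizing f with
  | zero =>
    refine ⟨fun h e he => ?_, fun h => h τ fun _ => rfl⟩
    obtain rfl : e = τ := funext he
    exact h
  | succ k ih =>
    rw [exN_succ, ih, ← not_iff_not]
    push Not
    rw [exists_env_succ (p := fun e => f e ≠ Truth.F)]
    simp only [ne_eq, ex_eq_F, not_forall]

theorem pull_ex (σ : Subst L) (f : Fn L) : pull σ (ex f) = ex (pull σ.up f) := by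
  funext τ
  simp only [pull, ex, Env.sub_up_cons]

theorem pull_exN (k : ℕ) (σ : Subst L) (f : Fn L) :
    pull σ (exN k f) = exN k (pull (σ.upN k) f) := by
  induction k generalizing f with
  | zero => rfl
  | succ k ih => rw [exN_succ, ih, pull_ex, ← Subst.upN_succ, ← exN_succ]

theorem disj_append (fs gs : List (Fn L)) (τ : Env L) :
    disj (fs ++ gs) τ = (disj fs τ).or (disj gs τ) := by
  induction fs with
  | nil => rfl
  | cons f fs ih => simp only [List.cons_append, disj, ih, Truth.or_assoc]

theorem conj_map_pull (σ : Subst L) (fs : List (Fn L)) (τ : Env L) :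
    conj (fs.map (pull σ)) τ = conj fs (Env.sub σ τ) := by
  induction fs with
  | nil => rfl
  | cons f fs ih => simp only [List.map_cons, conj, ih, pull]

theorem disj_eq_F {fs : List (Fn L)} {τ : Env L} (h : ∀ f ∈ fs, f τ = Truth.F) :
    disj fs τ = Truth.F := by
  induction fs with
  | nil => rfl
  | cons f fs ih =>
    rw [List.forall_mem_cons] at h
    simp only [disj, h.1, Truth.F_or, ih h.2]

theorem dependsOn_ex {f : Fn L} {S : Set ℕ} (h : DependsOn f S) :
    DependsOn (ex f) {x | x + 1 ∈ S} := by
  intro τ τ' hτ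
  have : ∀ t, f (Env.cons t τ) = f (Env.cons t τ') := fun t => h fun x hx => by
    cases x with
    | zero => rfl
    | succ x => exact hτ x hx
  simp only [ex, this]

theorem dependsOn_exN {f : Fn L} {S : Set ℕ} (k : ℕ) (h : DependsOn f S) :
    DependsOn (exN k f) {x | x + k ∈ S} := by
  induction k generalizing f S with
  | zero => exact h
  | succ k ih =>
    rw [exN_succ]
    exact ih (dependsOn_ex h)

theorem dependsOn_and {f g : Fn L} {S : Set ℕ} (hf : DependsOn f S) (hg : DependsOn g S) :
    DependsOn (and f g) S := fun _ _ h => by simp only [and, hf h, hg h]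

theorem dependsOn_not {f : Fn L} {S : Set ℕ} (hf : DependsOn f S) :
    DependsOn (not f) S := fun _ _ h => by simp only [not, hf h]

theorem dependsOn_conj {fs : List (Fn L)} {S : Set ℕ} (h : ∀ f ∈ fs, DependsOn f S) :
    DependsOn (conj fs) S := by
  induction fs with
  | nil => exact fun _ _ _ => rfl
  | cons f fs ih =>
    rw [List.forall_mem_cons] at h
    exact dependsOn_and h.1 (ih h.2)

theorem dependsOn_disj {fs : List (Fn L)} {S : Set ℕ} (h : ∀ f ∈ fs, DependsOn f S) :
    DependsOn (disj fs) S := by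
  induction fs with
  | nil => exact fun _ _ _ => rfl
  | cons f fs ih =>
    rw [List.forall_mem_cons] at h
    intro τ τ' hτ
    simp only [disj, h.1 hτ, ih h.2 hτ]

end Fn

/-- The disjuncts of `B ∧ C`, from those of `B` and `C`. -/
def semConj (bs cs : List (Fn L)) : List (Fn L) :=
  bs.flatMap fun b => cs.map fun c => Fn.and b c

/-- The disjuncts of `if[x₁, …, x_k](B, C)`, from those of `B` and `C`. -/
noncomputable def semIf (k : ℕ) : List (Fn L) → List (Fn L) → List (Fn L)
  | [], _ => []
  | b :: bs, cs => (cs.map fun c => Fn.exN k (Fn.and b c)) ++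
      (semIf k bs cs).map fun d => Fn.and (Fn.not (Fn.exN k b)) d

/-- The truth functions of the disjuncts, from left to right, of the depth-first normal form of a
formula. -/
noncomputable def sem : Goal L → List (Fn L)
  | .eq s t => [Fn.eq s t]
  | .call _ _ => [fun _ => Truth.U]
  | .conj B C => semConj (sem B) (sem C)
  | .disj B C => sem B ++ sem C
  | .neg B => [Fn.not (Fn.disj (sem B))]
  | .ex B => (sem B).map Fn.ex
  | .ifThen k B C => semIf k (sem B) (sem C)

theorem semConj_append (bs bs' cs : List (Fn L)) :
    semConj (bs ++ bs') cs = semConj bs cs ++ semConj bs' cs := List.flatMap_append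

theorem semConj_singleton (b : Fn L) (cs : List (Fn L)) :
    semConj [b] cs = cs.map fun c => Fn.and b c := by simp [semConj]

theorem sem_exN (k : ℕ) (B : Goal L) : sem (Goal.exN k B) = (sem B).map (Fn.exN k) := by
  induction k generalizing B with
  | zero => exact (List.map_id _).symm
  | succ k ih =>
    rw [Goal.exN_succ, ih, sem, List.map_map]
    exact List.map_congr_left fun f _ => (Fn.exN_succ k f).symm

theorem map_pull_semConj (σ : Subst L) (bs cs : List (Fn L)) :
    (semConj bs cs).map (Fn.pull σ) = semConj (bs.map (Fn.pull σ)) (cs.map (Fn.pull σ)) := by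
  simp only [semConj, List.map_flatMap, List.flatMap_map, List.map_map]
  rfl

theorem map_pull_semIf (k : ℕ) (σ : Subst L) (bs cs : List (Fn L)) :
    (semIf k bs cs).map (Fn.pull σ) =
      semIf k (bs.map (Fn.pull (σ.upN k))) (cs.map (Fn.pull (σ.upN k))) := by
  induction bs with
  | nil => rfl
  | cons b bs ih =>
    simp only [semIf, List.map_append, List.map_map, List.map_cons, ← ih]
    congr 1
    · exact List.map_congr_left fun c _ => Fn.pull_exN k σ _
    · refine List.map_congr_left fun d _ => ?_
      simp only [Function.comp, ← Fn.pull_exN]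
      rfl

theorem disj_map_pull (σ : Subst L) (fs : List (Fn L)) :
    Fn.disj (fs.map (Fn.pull σ)) = Fn.pull σ (Fn.disj fs) := by
  induction fs with
  | nil => rfl
  | cons f fs ih => simp only [List.map_cons, Fn.disj, ih]; rfl

theorem sem_subst (B : Goal L) : ∀ σ : Subst L, sem (B.subst σ) = (sem B).map (Fn.pull σ) := by
  induction B with
  | eq s t =>
    intro σ
    simp only [Goal.subst, sem, List.map_cons, List.map_nil]
    congr 1
    funext τ
    exact Fn.eq_congr Env.subst_eq_subst_iff.symm
  | call => intro σ; rfl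
  | conj B C ihB ihC => intro σ; simp only [Goal.subst, sem, ihB, ihC, map_pull_semConj]
  | disj B C ihB ihC => intro σ; simp only [Goal.subst, sem, ihB, ihC, List.map_append]
  | neg B ih =>
    intro σ
    simp only [Goal.subst, sem, ih, disj_map_pull]
    rfl
  | ex B ih =>
    intro σ
    simp only [Goal.subst, sem, ih, List.map_map]
    exact List.map_congr_left fun f _ => (Fn.pull_ex σ f).symm
  | ifThen k B C ihB ihC => intro σ; simp only [Goal.subst, sem, ihB, ihC, map_pull_semIf]

theorem forall_mem_semConj {bs cs : List (Fn L)} {p : Fn L → Prop}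
    (h : ∀ b ∈ bs, ∀ c ∈ cs, p (Fn.and b c)) : ∀ f ∈ semConj bs cs, p f := by
  intro f hf
  simp only [semConj, List.mem_flatMap, List.mem_map] at hf
  obtain ⟨b, hb, c, hc, rfl⟩ := hf
  exact h b hb c hc

theorem dependsOn_semIf {k : ℕ} {bs cs : List (Fn L)} {S : Set ℕ}
    (hb : ∀ b ∈ bs, DependsOn b S) (hc : ∀ c ∈ cs, DependsOn c S) :
    ∀ f ∈ semIf k bs cs, DependsOn f {x | x + k ∈ S} := by
  induction bs with
  | nil => simp [semIf]
  | cons b bs ih =>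
    rw [List.forall_mem_cons] at hb
    intro f hf
    simp only [semIf, List.mem_append, List.mem_map] at hf
    rcases hf with ⟨c, hc', rfl⟩ | ⟨d, hd, rfl⟩
    · exact Fn.dependsOn_exN k (Fn.dependsOn_and hb.1 (hc c hc'))
    · exact Fn.dependsOn_and (Fn.dependsOn_not (Fn.dependsOn_exN k hb.1)) (ih hb.2 d hd)

theorem dependsOn_sem (B : Goal L) : ∀ f ∈ sem B, DependsOn f B.freeVars := by
  induction B with
  | eq s t =>
    intro f hf τ τ' h
    obtain rfl := List.mem_singleton.1 hf
    have h1 : s.subst (Env.toSubst τ) = s.subst (Env.toSubst τ') :=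
      Subst.term_subst_congr fun x hx => congrArg Subtype.val (h x (Or.inl hx))
    have h2 : t.subst (Env.toSubst τ) = t.subst (Env.toSubst τ') :=
      Subst.term_subst_congr fun x hx => congrArg Subtype.val (h x (Or.inr hx))
    exact Fn.eq_congr (by rw [h1, h2])
  | call =>
    intro f hf
    obtain rfl := List.mem_singleton.1 hf
    exact fun _ _ _ => rfl
  | conj B C ihB ihC =>
    exact forall_mem_semConj fun b hb c hc => Fn.dependsOn_and
      ((ihB b hb).mono Set.subset_union_left) ((ihC c hc).mono Set.subset_union_right)
  | disj B C ihB ihC =>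
    intro f hf
    rcases List.mem_append.1 hf with hf | hf
    · exact (ihB f hf).mono Set.subset_union_left
    · exact (ihC f hf).mono Set.subset_union_right
  | neg B ih =>
    intro f hf
    obtain rfl := List.mem_singleton.1 hf
    exact Fn.dependsOn_not (Fn.dependsOn_disj ih)
  | ex B ih =>
    intro f hf
    obtain ⟨g, hg, rfl⟩ := List.mem_map.1 hf
    exact Fn.dependsOn_ex (ih g hg)
  | ifThen k B C ihB ihC =>
    exact dependsOn_semIf (fun b hb => (ihB b hb).mono Set.subset_union_left)
      fun c hc => (ihC c hc).mono Set.subset_union_right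

theorem sem_ne_nil (B : Goal L) : sem B ≠ [] := by
  induction B with
  | eq | call | neg => simp [sem]
  | conj B C ihB ihC =>
    obtain ⟨b, bs, hb⟩ := List.exists_cons_of_ne_nil ihB
    obtain ⟨c, cs, hc⟩ := List.exists_cons_of_ne_nil ihC
    simp [sem, semConj, hb, hc]
  | disj B C ihB ihC => simp [sem, ihB]
  | ex B ih => simpa [sem] using ih
  | ifThen k B C ihB ihC =>
    obtain ⟨b, bs, hb⟩ := List.exists_cons_of_ne_nil ihB
    obtain ⟨c, cs, hc⟩ := List.exists_cons_of_ne_nil ihC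
    simp [sem, semIf, hb, hc]

theorem semIf_append (k : ℕ) (bs bs' cs : List (Fn L)) :
    semIf k (bs ++ bs') cs = semIf k bs cs ++
      (semIf k bs' cs).map fun d => Fn.and (Fn.not (Fn.disj (bs.map (Fn.exN k)))) d := by
  induction bs with
  | nil => exact (List.map_id _).symm
  | cons b bs ih =>
    simp only [List.cons_append, semIf, ih, List.map_append, List.map_map, List.append_assoc]
    congr 2
    refine List.map_congr_left fun d _ => funext fun τ => ?_
    simp only [Function.comp, Fn.and, Fn.not, Fn.disj, List.map_cons, Truth.not_or,
      Truth.and_assoc]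

theorem exists_sem_eq_singleton {B : Goal L} (h : NegDisj B) : ∃ f, sem B = [f] := by
  induction B with
  | eq | call | neg => exact ⟨_, rfl⟩
  | conj B C ihB ihC =>
    cases h with | conj h1 h2 => ?_
    obtain ⟨b, hb⟩ := ihB h1
    obtain ⟨c, hc⟩ := ihC h2
    exact ⟨_, by rw [sem, hb, hc]; rfl⟩
  | ex B ih =>
    cases h with | ex h => ?_
    obtain ⟨b, hb⟩ := ih h
    exact ⟨_, by rw [sem, hb]; rfl⟩
  | disj | ifThen => cases h

/-- The rewrite rules do not change the truth functions of the disjuncts. -/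
theorem Rewrites.sem_eq {B B' : Goal L} (h : Rewrites B B') : sem B = sem B' := by
  induction h with
  | r1 B₁ B₂ C => simp only [sem, semConj_append]
  | r2 B C₁ C₂ h =>
    obtain ⟨b, hb⟩ := exists_sem_eq_singleton h
    simp only [sem, hb, semConj_singleton, List.map_append]
  | r3 B₁ B₂ => simp only [sem, List.map_append]
  | r4 k B₁ B₂ C => simp only [sem, semIf_append, semConj_singleton, sem_exN]
  | r5 k B C h =>
    obtain ⟨b, hb⟩ := exists_sem_eq_singleton h
    simp only [sem, sem_exN, hb, semConj_singleton, semIf, List.map_map, List.map_nil,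
      List.append_nil]
    rfl
  | conj_left | conj_right | disj_left | disj_right | neg | ex | if_left | if_right =>
    simp_all [sem]

theorem sem_nf (B : Goal L) : sem B.nf = sem B := by
  have h := reach_nf B
  generalize B.nf = D at h
  induction h with
  | refl => rfl
  | tail _ h ih => rw [← h.sem_eq, ih]

theorem subst_up_inst1 (B : Goal L) (t : GTerm L) (τ : Env L) :
    (B.subst τ.toSubst.up).inst1 t.1 = B.subst (Env.cons t τ).toSubst := by
  rw [Goal.inst1, Goal.inst, Goal.subst_subst]
  congr 1
  funext x
  cases x with
  | zero => rfl
  | succ x =>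
    simp only [Subst.comp, Subst.up, Subst.term_relabel_eq_subst, Subst.term_subst_subst]
    exact Subst.term_subst_eq_self fun y _ => Subst.inst_add (k := 1) y fun _ => t.1

/-- The valuation of the ground instances of a formula in normal form is given by the truth functions
of its disjuncts. -/
theorem val_subst {B : Goal L} :
    (NegDisj B → ∃ f, sem B = [f] ∧ ∀ τ : Env L, val (B.subst τ.toSubst) = f τ) ∧
    (OuterDisj B → ∀ τ : Env L, val (B.subst τ.toSubst) = Fn.disj (sem B) τ) := by
  -- for a single disjunct, the second claim is a case of the first
  have key : ∀ {B : Goal L},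
      (NegDisj B → ∃ f, sem B = [f] ∧ ∀ τ : Env L, val (B.subst τ.toSubst) = f τ) →
      NegDisj B → ∀ τ : Env L, val (B.subst τ.toSubst) = Fn.disj (sem B) τ := by
    intro B h hB τ
    obtain ⟨f, hf, hv⟩ := h hB
    simp [hv, hf, Fn.disj]
  induction B with
  | eq s t =>
    have h : NegDisj (Goal.eq s t) → ∃ f, sem (Goal.eq s t) = [f] ∧
        ∀ τ : Env L, val ((Goal.eq s t).subst τ.toSubst) = f τ :=
      fun _ => ⟨_, rfl, fun τ => by rw [Goal.subst, val]; rfl⟩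
    exact ⟨h, fun h' => key h (.eq s t)⟩
  | call p ts =>
    have h : NegDisj (Goal.call p ts) → ∃ f, sem (Goal.call p ts) = [f] ∧
        ∀ τ : Env L, val ((Goal.call p ts).subst τ.toSubst) = f τ :=
      fun _ => ⟨_, rfl, fun τ => by rw [Goal.subst, val]⟩
    exact ⟨h, fun h' => key h (.call p ts)⟩
  | conj B C ihB ihC =>
    have h : NegDisj (Goal.conj B C) → ∃ f, sem (Goal.conj B C) = [f] ∧
        ∀ τ : Env L, val ((Goal.conj B C).subst τ.toSubst) = f τ := by
      intro h
      cases h with | conj h1 h2 => ?_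
      obtain ⟨b, hb, hvb⟩ := ihB.1 h1
      obtain ⟨c, hc, hvc⟩ := ihC.1 h2
      refine ⟨Fn.and b c, by rw [sem, hb, hc]; rfl, fun τ => ?_⟩
      rw [Goal.subst, val, hvb, hvc, Fn.and]
      cases b τ <;> rfl
    exact ⟨h, fun h' => by cases h' with | negDisj h' => exact key h h'⟩
  | disj B C ihB ihC =>
    refine ⟨fun h => absurd h not_negDisj_disj, fun h τ => ?_⟩
    cases h with
    | negDisj h => exact absurd h not_negDisj_disj
    | disj h1 h2 =>
      rw [Goal.subst, val, ihB.2 h1, ihC.2 h2, sem, Fn.disj_append]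
      cases Fn.disj (sem B) τ <;> rfl
  | neg B ih =>
    have h : NegDisj (Goal.neg B) → ∃ f, sem (Goal.neg B) = [f] ∧
        ∀ τ : Env L, val ((Goal.neg B).subst τ.toSubst) = f τ := by
      intro h
      cases h with | neg h => ?_
      refine ⟨_, rfl, fun τ => ?_⟩
      rw [Goal.subst, val, ih.2 h, Fn.not]
      cases Fn.disj (sem B) τ <;> rfl
    exact ⟨h, fun h' => by cases h' with | negDisj h' => exact key h h'⟩
  | ex B ih =>
    have h : NegDisj (Goal.ex B) → ∃ f, sem (Goal.ex B) = [f] ∧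
        ∀ τ : Env L, val ((Goal.ex B).subst τ.toSubst) = f τ := by
      intro h
      cases h with | ex h => ?_
      obtain ⟨b, hb, hvb⟩ := ih.1 h
      refine ⟨Fn.ex b, by rw [sem, hb]; rfl, fun τ => ?_⟩
      rw [Goal.subst, val, Fn.ex]
      congr 1
      ext w
      constructor
      · rintro ⟨t, ht, rfl⟩
        exact ⟨⟨t, ht⟩, by rw [← hvb, ← subst_up_inst1]⟩
      · rintro ⟨t, rfl⟩
        exact ⟨t.1, t.2, by rw [← hvb, ← subst_up_inst1]⟩
    exact ⟨h, fun h' => by cases h' with | negDisj h' => exact key h h'⟩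
  | ifThen => exact ⟨nofun, fun h => by cases h with | negDisj h => cases h⟩

/-- The valuation of the depth-first normal form of a ground goal is the sequential disjunction of
the truth functions of its disjuncts. -/
theorem val_dfnf {G : Goal L} (hG : G.Ground) (τ : Env L) :
    val (dfnf G) = Fn.disj (sem G) τ := by
  have hD : G.nf.Ground := Set.subset_eq_empty (freeVars_nf_subset G) hG
  rw [dfnf_eq_nf, ← hD.subst_eq τ.toSubst, val_subst.2 (outerDisj_nf G), sem_nf]

/-! ### Unfoldings of bounded depth -/

theorem Expands.subst {P : Program L} (hP : Completed P) {n : ℕ} {p : L.Relations n}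
    {ts : Fin n → L.Term ℕ} {B : Goal L} (h : Expands P p ts B) (σ : Subst L) :
    Expands P p (fun i => (ts i).subst σ) (B.subst σ) := by
  obtain ⟨xs, B, hmem, rfl⟩ := h
  refine ⟨xs, B, hmem, ?_⟩
  obtain ⟨n', p', xs', B', heq, hinj, hfv⟩ := hP.1 _ hmem
  simp only [simpleClause, Clause.mk.injEq, Sigma.mk.injEq, List.cons.injEq,
    BodyElt.goal.injEq, and_true] at heq
  obtain ⟨⟨rfl, -⟩, hxs, rfl⟩ := heq
  obtain rfl : xs = xs' := by
    funext i
    simpa using congrFun (eq_of_heq hxs) i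
  rw [Goal.subst_subst]
  refine Goal.subst_congr fun x hx => ?_
  obtain ⟨i, rfl⟩ := hfv hx
  simp only [Subst.comp, Subst.assign_apply hinj]

theorem Expands.of_args {P : Program L} {n : ℕ} {p : L.Relations n}
    {ts us : Fin n → L.Term ℕ} {B : Goal L} (h : Expands P p ts B) : ∃ B', Expands P p us B' := by
  obtain ⟨xs, B, hmem, -⟩ := h
  exact ⟨_, xs, B, hmem, rfl⟩

theorem Expands.unique {P : Program L} (hP : Completed P) {n : ℕ} {p : L.Relations n}
    {ts : Fin n → L.Term ℕ} {B B' : Goal L} (h : Expands P p ts B) (h' : Expands P p ts B') :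
    B = B' := by
  obtain ⟨xs, B, hmem, rfl⟩ := h
  obtain ⟨xs', B', hmem', rfl⟩ := h'
  have heq : simpleClause p xs B = simpleClause p xs' B' := by
    by_contra hne
    have : Std.Symm fun c d : Clause L => c.pred ≠ d.pred := ⟨fun _ _ h => Ne.symm h⟩
    exact hP.2.forall hmem hmem' hne rfl
  simp only [simpleClause, Clause.mk.injEq, List.cons.injEq,
    BodyElt.goal.injEq, and_true, true_and] at heq
  obtain ⟨hxs, rfl⟩ := heq
  obtain rfl : xs = xs' := by
    funext i
    simpa using congrFun (eq_of_heq hxs) i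
  rfl

theorem Expands.freeVars_subset {P : Program L} (hP : Completed P) {n : ℕ} {p : L.Relations n}
    {ts : Fin n → L.Term ℕ} {B : Goal L} (h : Expands P p ts B) :
    B.freeVars ⊆ (Goal.call p ts).freeVars := by
  obtain ⟨xs, B, hmem, rfl⟩ := h
  obtain ⟨n', p', xs', B', heq, hinj, hfv⟩ := hP.1 _ hmem
  simp only [simpleClause, Clause.mk.injEq, Sigma.mk.injEq, List.cons.injEq,
    BodyElt.goal.injEq, and_true] at heq
  obtain ⟨⟨rfl, -⟩, hxs, rfl⟩ := heq
  obtain rfl : xs = xs' := by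
    funext i
    simpa using congrFun (eq_of_heq hxs) i
  intro x hx
  obtain ⟨y, hy, hxy⟩ := Goal.mem_freeVars_subst.1 hx
  obtain ⟨i, rfl⟩ := hfv hy
  rw [Subst.assign_apply hinj] at hxy
  exact ⟨i, hxy⟩

/-- `Unf P N m G G'`: the formula `G'` is obtained from `G` by `m` replacements of calls, and each
call that is left in `G'` arose by at least `N` nested replacements or cannot be replaced. -/
inductive Unf (P : Program L) : ℕ → ℕ → Goal L → Goal L → Prop
  | eq {N : ℕ} (s t : L.Term ℕ) : Unf P N 0 (Goal.eq s t) (Goal.eq s t)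
  | keep {N n : ℕ} {p : L.Relations n} {ts : Fin n → L.Term ℕ} :
      (N = 0 ∨ ∀ B, ¬ Expands P p ts B) → Unf P N 0 (Goal.call p ts) (Goal.call p ts)
  | expand {N N' m n : ℕ} {p : L.Relations n} {ts : Fin n → L.Term ℕ} {B B' : Goal L} :
      Expands P p ts B → N' ≤ N + 1 → Unf P N m B B' → Unf P N' (m + 1) (Goal.call p ts) B'
  | conj {N m m' : ℕ} {B B' C C' : Goal L} :
      Unf P N m B B' → Unf P N m' C C' → Unf P N (m + m') (Goal.conj B C) (Goal.conj B' C')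
  | disj {N m m' : ℕ} {B B' C C' : Goal L} :
      Unf P N m B B' → Unf P N m' C C' → Unf P N (m + m') (Goal.disj B C) (Goal.disj B' C')
  | neg {N m : ℕ} {B B' : Goal L} : Unf P N m B B' → Unf P N m (Goal.neg B) (Goal.neg B')
  | ex {N m : ℕ} {B B' : Goal L} : Unf P N m B B' → Unf P N m (Goal.ex B) (Goal.ex B')
  | ifThen {N m m' k : ℕ} {B B' C C' : Goal L} :
      Unf P N m B B' → Unf P N m' C C' →
      Unf P N (m + m') (Goal.ifThen k B C) (Goal.ifThen k B' C')

namespace Unf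

variable {P : Program L} {N m : ℕ} {G G' : Goal L}

theorem mono {N' : ℕ} (h : Unf P N m G G') (hN : N' ≤ N) : Unf P N' m G G' := by
  induction h generalizing N' with
  | eq s t => exact .eq s t
  | keep h => exact .keep (h.imp_left fun h => by omega)
  | expand hB hN' h ih => exact .expand hB (hN.trans hN') h
  | conj _ _ ih ih' => exact .conj (ih hN) (ih' hN)
  | disj _ _ ih ih' => exact .disj (ih hN) (ih' hN)
  | neg _ ih => exact .neg (ih hN)
  | ex _ ih => exact .ex (ih hN)
  | ifThen _ _ ih ih' => exact .ifThen (ih hN) (ih' hN)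

theorem subst (hP : Completed P) (h : Unf P N m G G') (σ : Subst L) :
    Unf P N m (G.subst σ) (G'.subst σ) := by
  induction h generalizing σ with
  | eq s t => exact .eq _ _
  | keep h =>
    refine .keep (h.imp_right fun h B hB => ?_)
    obtain ⟨B', hB'⟩ := hB.of_args
    exact h B' hB'
  | expand hB hN' h ih => exact .expand (hB.subst hP σ) hN' (ih σ)
  | conj _ _ ih ih' => exact .conj (ih σ) (ih' σ)
  | disj _ _ ih ih' => exact .disj (ih σ) (ih' σ)
  | neg _ ih => exact .neg (ih σ)
  | ex _ ih => exact .ex (ih _)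
  | ifThen _ _ ih ih' => exact .ifThen (ih _) (ih' _)

theorem freeVars_subset (hP : Completed P) (h : Unf P N m G G') : G'.freeVars ⊆ G.freeVars := by
  induction h with
  | eq s t => exact subset_rfl
  | keep h => exact subset_rfl
  | expand hB hN' h ih => exact ih.trans (hB.freeVars_subset hP)
  | conj _ _ ih ih' => exact Set.union_subset_union ih ih'
  | disj _ _ ih ih' => exact Set.union_subset_union ih ih'
  | neg _ ih => exact ih
  | ex _ ih => exact fun x hx => ih hx
  | ifThen _ _ ih ih' => exact fun x hx => Set.union_subset_union ih ih' hx

theorem exN_closed (hP : Completed P) {k : ℕ} (h : Unf P N m G G')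
    (hG : (Goal.exN k G).freeVars = ∅) : (Goal.exN k G').freeVars = ∅ := by
  refine Set.subset_eq_empty (fun x hx => ?_) hG
  exact Goal.mem_freeVars_exN.2 (h.freeVars_subset hP (Goal.mem_freeVars_exN.1 hx))

theorem refl (P : Program L) (G : Goal L) : Unf P 0 0 G G := by
  induction G with
  | eq s t => exact .eq s t
  | call p ts => exact .keep (.inl rfl)
  | conj B C ihB ihC => exact .conj ihB ihC
  | disj B C ihB ihC => exact .disj ihB ihC
  | neg B ih => exact .neg ih
  | ex B ih => exact .ex ih
  | ifThen k B C ihB ihC => exact .ifThen ihB ihC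

/-- A goal has unfoldings of any given depth. -/
theorem exists_of_depth (P : Program L) (N : ℕ) (G : Goal L) : ∃ m G', Unf P N m G G' := by
  induction N generalizing G with
  | zero => exact ⟨0, G, refl P G⟩
  | succ N ihN =>
    induction G with
    | eq s t => exact ⟨0, _, .eq s t⟩
    | call p ts =>
      by_cases h : ∃ B, Expands P p ts B
      · obtain ⟨B, hB⟩ := h
        obtain ⟨m, B', h⟩ := ihN B
        exact ⟨m + 1, B', .expand hB le_rfl h⟩
      · exact ⟨0, _, .keep (.inr fun B hB => h ⟨B, hB⟩)⟩
    | conj B C ihB ihC =>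
      obtain ⟨m, B', hB⟩ := ihB
      obtain ⟨m', C', hC⟩ := ihC
      exact ⟨_, _, .conj hB hC⟩
    | disj B C ihB ihC =>
      obtain ⟨m, B', hB⟩ := ihB
      obtain ⟨m', C', hC⟩ := ihC
      exact ⟨_, _, .disj hB hC⟩
    | neg B ih =>
      obtain ⟨m, B', hB⟩ := ih
      exact ⟨_, _, .neg hB⟩
    | ex B ih =>
      obtain ⟨m, B', hB⟩ := ih
      exact ⟨_, _, .ex hB⟩
    | ifThen k B C ihB ihC =>
      obtain ⟨m, B', hB⟩ := ihB
      obtain ⟨m', C', hC⟩ := ihC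
      exact ⟨_, _, .ifThen hB hC⟩

theorem unfolding (h : Unf P N m G G') : Unfolding P G G' := by
  induction h with
  | eq s t => exact .refl
  | keep h => exact .refl
  | expand hB _ _ ih => exact .head (.call hB) ih
  | @conj _ _ _ B B' C C' _ _ ih ih' =>
    exact (ih.lift (fun X => Goal.conj X C) fun _ _ => .conj_left).trans
      (ih'.lift (fun X => Goal.conj B' X) fun _ _ => .conj_right)
  | @disj _ _ _ B B' C C' _ _ ih ih' =>
    exact (ih.lift (fun X => Goal.disj X C) fun _ _ => .disj_left).trans
      (ih'.lift (fun X => Goal.disj B' X) fun _ _ => .disj_right)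
  | neg _ ih => exact ih.lift _ fun _ _ => .neg
  | ex _ ih => exact ih.lift _ fun _ _ => .ex
  | @ifThen _ _ _ k B B' C C' _ _ ih ih' =>
    exact (ih.lift (fun X => Goal.ifThen k X C) fun _ _ => .if_left).trans
      (ih'.lift (fun X => Goal.ifThen k B' X) fun _ _ => .if_right)

theorem of_unfold1 {G₁ : Goal L} (h₁ : Unfold1 P G G₁) (h : Unf P 0 m G₁ G') :
    ∃ m', Unf P 0 m' G G' := by
  induction h₁ generalizing m G' with
  | call hB => exact ⟨_, .expand hB (Nat.zero_le _) h⟩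
  | conj_left _ ih =>
    cases h with | conj h h' => ?_
    obtain ⟨m', h⟩ := ih h
    exact ⟨_, .conj h h'⟩
  | conj_right _ ih =>
    cases h with | conj h' h => ?_
    obtain ⟨m', h⟩ := ih h
    exact ⟨_, .conj h' h⟩
  | disj_left _ ih =>
    cases h with | disj h h' => ?_
    obtain ⟨m', h⟩ := ih h
    exact ⟨_, .disj h h'⟩
  | disj_right _ ih =>
    cases h with | disj h' h => ?_
    obtain ⟨m', h⟩ := ih h
    exact ⟨_, .disj h' h⟩
  | neg _ ih =>
    cases h with | neg h => ?_
    obtain ⟨m', h⟩ := ih h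
    exact ⟨_, .neg h⟩
  | ex _ ih =>
    cases h with | ex h => ?_
    obtain ⟨m', h⟩ := ih h
    exact ⟨_, .ex h⟩
  | if_left _ ih =>
    cases h with | ifThen h h' => ?_
    obtain ⟨m', h⟩ := ih h
    exact ⟨_, .ifThen h h'⟩
  | if_right _ ih =>
    cases h with | ifThen h' h => ?_
    obtain ⟨m', h⟩ := ih h
    exact ⟨_, .ifThen h' h⟩

theorem of_unfolding (h : Unfolding P G G') : ∃ m, Unf P 0 m G G' := by
  induction h using Relation.ReflTransGen.head_induction_on with
  | refl => exact ⟨0, refl P _⟩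
  | head h₁ _ ih =>
    obtain ⟨m, h⟩ := ih
    exact h.of_unfold1 h₁

end Unf

/-- The relation `Unf`, for goal stacks. -/
inductive StackUnf (P : Program L) (N : ℕ) : ℕ → List (Goal L) → List (Goal L) → Prop
  | nil : StackUnf P N 0 [] []
  | cons {m m' : ℕ} {B B' : Goal L} {α α' : List (Goal L)} :
      Unf P N m B B' → StackUnf P N m' α α' → StackUnf P N (m + m') (B :: α) (B' :: α')

namespace StackUnf

variable {P : Program L} {N m : ℕ} {α α' : List (Goal L)}

theorem mono {N' : ℕ} (h : StackUnf P N m α α') (hN : N' ≤ N) : StackUnf P N' m α α' := by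
  induction h with
  | nil => exact .nil
  | cons h _ ih => exact .cons (h.mono hN) ih

theorem subst (hP : Completed P) (h : StackUnf P N m α α') (σ : Subst L) :
    StackUnf P N m (α.map fun B => B.subst σ) (α'.map fun B => B.subst σ) := by
  induction h with
  | nil => exact .nil
  | cons h _ ih => exact .cons (h.subst hP σ) ih

theorem stackVars_subset (hP : Completed P) (h : StackUnf P N m α α') :
    stackVars α' ⊆ stackVars α := by
  induction h with
  | nil => exact subset_rfl
  | cons h _ ih =>
    rw [stackVars_cons, stackVars_cons]
    exact Set.union_subset_union (h.freeVars_subset hP) ih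

theorem singleton {G G' : Goal L} (h : Unf P N m G G') : StackUnf P N m [G] [G'] := .cons h .nil

end StackUnf

/-! ### Truth functions of goal stacks -/

/-- All lists that consist of an element of `bs` followed by an element of `as`, with the choice
from `bs` varying most slowly. -/
def cross (bs : List (Fn L)) (as : List (List (Fn L))) : List (List (Fn L)) :=
  bs.flatMap fun b => as.map fun a => b :: a

/-- The truth functions of the disjuncts of a goal stack, read as a conjunction.  Each disjunct is
given by a list that has one conjunct for each formula in the stack. -/
noncomputable def stackSem : List (Goal L) → List (List (Fn L))
  | [] => [[]]
  | B :: α => cross (sem B) (stackSem α)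

theorem cross_append (bs bs' : List (Fn L)) (as : List (List (Fn L))) :
    cross (bs ++ bs') as = cross bs as ++ cross bs' as := List.flatMap_append

theorem cross_cons (b : Fn L) (bs : List (Fn L)) (as : List (List (Fn L))) :
    cross (b :: bs) as = (as.map fun a => b :: a) ++ cross bs as := List.flatMap_cons

theorem cross_singleton (b : Fn L) (as : List (List (Fn L))) :
    cross [b] as = as.map fun a => b :: a := by simp [cross]

theorem mem_cross {bs : List (Fn L)} {as : List (List (Fn L))} {l : List (Fn L)} :
    l ∈ cross bs as ↔ ∃ b ∈ bs, ∃ a ∈ as, b :: a = l := by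
  simp [cross]

theorem cross_map {ι : Type*} (f : ι → Fn L) (is : List ι) (as : List (List (Fn L))) :
    cross (is.map f) as =
      (is.flatMap fun i => as.map fun a => (i, a)).map fun p => f p.1 :: p.2 := by
  simp [cross, List.flatMap_map, List.map_flatMap, Function.comp_def]

theorem stackSem_singleton (B : Goal L) : stackSem [B] = (sem B).map fun b => [b] := by
  simp only [stackSem, cross, List.map_cons, List.map_nil]
  induction sem B with
  | nil => rfl
  | cons b bs ih => rw [List.flatMap_cons, ih]; rfl

theorem stackSem_ne_nil (α : List (Goal L)) : stackSem α ≠ [] := by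
  induction α with
  | nil => simp [stackSem]
  | cons B α ih =>
    obtain ⟨b, bs, hb⟩ := List.exists_cons_of_ne_nil (sem_ne_nil B)
    simp [stackSem, hb, cross_cons, ih]

theorem stackSem_map_subst (σ : Subst L) (α : List (Goal L)) :
    stackSem (α.map fun B => B.subst σ) = (stackSem α).map (List.map (Fn.pull σ)) := by
  induction α with
  | nil => rfl
  | cons B α ih =>
    simp only [List.map_cons, stackSem, ih, sem_subst, cross, List.map_flatMap, List.flatMap_map,
      List.map_map]
    rfl

theorem dependsOn_stackSem {α : List (Goal L)} :
    ∀ l ∈ stackSem α, ∀ f ∈ l, DependsOn f (stackVars α) := by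
  induction α with
  | nil => simp [stackSem]
  | cons B α ih =>
    intro l hl f hf
    obtain ⟨b, hb, a, ha, rfl⟩ := mem_cross.1 hl
    rw [stackVars_cons]
    rcases List.mem_cons.1 hf with rfl | hf
    · exact (dependsOn_sem B _ hb).mono Set.subset_union_left
    · exact (ih a ha f hf).mono Set.subset_union_right

/-! ### Failing, successful and stuck stacks -/

/-- The ways in which the evaluation of an unfolded goal stack may end without floundering.  It is
stuck if it arrives at a call. -/
inductive Verdict (L : FirstOrder.Language.{u, v}) : Type u
  | fail : Verdict L
  | success (δ : Subst L) : Verdict L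
  | stuck : Verdict L

/-- The verdict after the computation step with substitution `σ`, given the verdict on the rest. -/
def Verdict.after (σ : Subst L) : Verdict L → Verdict L
  | .fail => .fail
  | .success δ => .success (σ.comp δ)
  | .stuck => .stuck

/-- The truth value that corresponds to a verdict. -/
def Verdict.truth : Verdict L → Truth
  | .fail => .F
  | .success _ => .T
  | .stuck => .U

/-- On the variables in `K`, the ground substitution `τ` is an instance of `δ`. -/
def Factors (K : Set ℕ) (δ : Subst L) (τ : Env L) : Prop :=
  ∃ τ' : Env L, ∀ x ∈ K, τ x = Env.sub δ τ' x

theorem factors_sub (K : Set ℕ) (δ : Subst L) (τ : Env L) : Factors K δ (Env.sub δ τ) :=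
  ⟨τ, fun _ _ => rfl⟩

/-- The verdict on a single disjunct, given by its conjuncts `l`.

It fails if it is false everywhere.  It succeeds with the answer `δ` if it is defined everywhere, and
the ground substitutions of the variables in `K` which extend to one that makes it true are the
instances of `δ`; the variables outside `K` are not used in the rest of the computation, so that
nothing can be said about them.  It is stuck at the conjunct `u` if, among the ground substitutions
that make the conjuncts before `u` true, there is one at which `u` is undefined and none at which `u`
is true. -/
def Status (K : Set ℕ) (l : List (Fn L)) : Verdict L → Prop
  | .fail => ∀ τ, Fn.conj l τ = Truth.F
  | .success δ => (∀ τ, Fn.conj l τ ≠ Truth.U) ∧ (∀ τ, Fn.conj l τ = Truth.T → Factors K δ τ) ∧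
      ∀ τ, Factors K δ τ → ∃ τ₁ : Env L, (∀ x ∈ K, τ₁ x = τ x) ∧ Fn.conj l τ₁ = Truth.T
  | .stuck => ∃ (g : List (Fn L)) (u : Fn L) (h : List (Fn L)), l = g ++ u :: h ∧
      (∃ τ, Fn.conj g τ = Truth.T ∧ u τ = Truth.U) ∧
      ∀ τ, Fn.conj g τ = Truth.T → u τ ≠ Truth.T

/-- The verdict on a sequence of disjuncts is the one on the first disjunct that does not fail. -/
def Matches (K : Set ℕ) (ls : List (List (Fn L))) (o : Verdict L) : Prop :=
  (o = .fail ∧ ∀ l ∈ ls, Status K l .fail) ∨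
  (o ≠ .fail ∧ ∃ pre l post, ls = pre ++ l :: post ∧ (∀ l' ∈ pre, Status K l' .fail) ∧
    Status K l o)

section Matches

variable {K K' : Set ℕ} {o : Verdict L}

theorem matches_fail_iff {ls : List (List (Fn L))} :
    Matches K ls .fail ↔ ∀ l ∈ ls, Status K l .fail := by
  simp [Matches]

theorem matches_iff_of_ne {ls : List (List (Fn L))} (ho : o ≠ .fail) :
    Matches K ls o ↔ ∃ pre l post, ls = pre ++ l :: post ∧ (∀ l' ∈ pre, Status K l' .fail) ∧
      Status K l o := by
  simp [Matches, ho]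

theorem Matches.append_left {ls : List (List (Fn L))} (h : Matches K ls o) (ho : o ≠ .fail)
    (ls' : List (List (Fn L))) : Matches K (ls ++ ls') o := by
  rw [matches_iff_of_ne ho] at h ⊢
  obtain ⟨pre, l, post, rfl, h1, h2⟩ := h
  exact ⟨pre, l, post ++ ls', by simp, h1, h2⟩

theorem Matches.append_right {ls ls' : List (List (Fn L))} (h : Matches K ls' o)
    (hls : ∀ l ∈ ls, Status K l .fail) : Matches K (ls ++ ls') o := by
  rcases h with ⟨rfl, h⟩ | ⟨ho, pre, l, post, rfl, h1, h2⟩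
  · rw [matches_fail_iff]
    intro l hl
    rcases List.mem_append.1 hl with hl | hl
    · exact hls l hl
    · exact h l hl
  · rw [matches_iff_of_ne ho]
    refine ⟨ls ++ pre, l, post, by simp, ?_, h2⟩
    intro l hl
    rcases List.mem_append.1 hl with hl | hl
    · exact hls l hl
    · exact h1 l hl

/-- A passage from one stack to another that respects the verdicts on the individual disjuncts
respects the verdict on the stack. -/
theorem Matches.map {ι : Type*} {is : List ι} {F F' : ι → List (Fn L)} {f : Verdict L → Verdict L}
    (h : Matches K (is.map F) o) (hf : ∀ o, f o = .fail ↔ o = .fail)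
    (hF : ∀ i ∈ is, ∀ o, Status K (F i) o → Status K' (F' i) (f o)) :
    Matches K' (is.map F') (f o) := by
  have hfail : f .fail = .fail := (hf _).2 rfl
  rcases h with ⟨rfl, h⟩ | ⟨ho, pre, l, post, heq, h1, h2⟩
  · rw [hfail, matches_fail_iff]
    intro l hl
    obtain ⟨i, hi, rfl⟩ := List.mem_map.1 hl
    exact hfail ▸ hF i hi _ (h _ (List.mem_map_of_mem hi))
  · rw [matches_iff_of_ne fun h => ho ((hf o).1 h)]
    obtain ⟨is₁, is₂, rfl, rfl, heq₂⟩ := List.map_eq_append_iff.1 heq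
    obtain ⟨i, is₃, rfl, rfl, rfl⟩ := List.map_eq_cons_iff.1 heq₂
    refine ⟨is₁.map F', F' i, is₃.map F', by simp, ?_, hF i (by simp) _ h2⟩
    intro l hl
    obtain ⟨j, hj, rfl⟩ := List.mem_map.1 hl
    exact hfail ▸ hF j (by simp [hj]) _ (h1 _ (List.mem_map_of_mem hj))

theorem Matches.map' {ι : Type*} {is : List ι} {F F' : ι → List (Fn L)}
    (h : Matches K (is.map F) o) (hF : ∀ i ∈ is, ∀ o, Status K (F i) o → Status K' (F' i) o) :
    Matches K' (is.map F') o :=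
  h.map (f := id) (fun _ => Iff.rfl) hF

theorem status_fail_cons {b : Fn L} {a : List (Fn L)} (h : ∀ τ, b τ = Truth.F) :
    Status K (b :: a) .fail := fun τ => by simp [Fn.conj, h]

theorem matches_fail_of_sem {G : Goal L} {α : List (Goal L)} (h : ∀ b ∈ sem G, ∀ τ, b τ = Truth.F) :
    Matches K (stackSem (G :: α)) .fail := by
  rw [matches_fail_iff]
  intro l hl
  obtain ⟨b, hb, a, -, rfl⟩ := mem_cross.1 hl
  exact status_fail_cons (h b hb)

theorem matches_stuck_of_sem {G : Goal L} {α : List (Goal L)} {pre post : List (Fn L)} {b : Fn L}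
    (hG : sem G = pre ++ b :: post) (hpre : ∀ b ∈ pre, ∀ τ, b τ = Truth.F)
    (hU : ∃ τ, b τ = Truth.U) (hT : ∀ τ, b τ ≠ Truth.T) :
    Matches K (stackSem (G :: α)) .stuck := by
  obtain ⟨a, as, ha⟩ := List.exists_cons_of_ne_nil (stackSem_ne_nil α)
  rw [stackSem, hG, cross_append, cross_cons, ha]
  refine Matches.append_right ?_ ?_
  · refine Matches.append_left ?_ (by simp) _
    rw [matches_iff_of_ne (by simp)]
    obtain ⟨τ, hτ⟩ := hU
    exact ⟨[], _, _, rfl, by simp, [], b, a, rfl, ⟨τ, rfl, hτ⟩, fun τ _ => hT τ⟩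
  · intro l hl
    obtain ⟨b, hb, a, -, rfl⟩ := mem_cross.1 hl
    exact status_fail_cons (hpre b hb)

/-- For a ground goal, the verdict gives the value of the sequential disjunction. -/
theorem Matches.disj_sem_eq [Nonempty (GTerm L)] {G : Goal L} (hG : G.freeVars = ∅)
    (h : Matches K (stackSem [G]) o) (τ : Env L) : Fn.disj (sem G) τ = o.truth := by
  have hconst : ∀ f ∈ sem G, ∀ τ τ', f τ = f τ' := fun f hf =>
    ((dependsOn_sem G f hf).mono hG.subset).empty
  rw [stackSem_singleton] at h
  rcases h with ⟨rfl, h⟩ | ⟨ho, pre, l, post, heq, h1, h2⟩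
  · refine Fn.disj_eq_F fun f hf => ?_
    simpa [Status, Fn.conj] using h _ (List.mem_map_of_mem hf) τ
  · obtain ⟨pre, bs, hsem, rfl, heq₂⟩ := List.map_eq_append_iff.1 heq
    obtain ⟨f, post, rfl, rfl, rfl⟩ := List.map_eq_cons_iff.1 heq₂
    have hpre : Fn.disj pre τ = Truth.F := Fn.disj_eq_F fun f hf => by
      simpa [Status, Fn.conj] using h1 _ (List.mem_map_of_mem hf) τ
    have hf : f ∈ sem G := by simp [hsem]
    rw [hsem, Fn.disj_append, hpre, Truth.F_or, Fn.disj]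
    cases o with
    | fail => exact absurd rfl ho
    | success δ =>
      obtain ⟨τ₁, -, h⟩ := h2.2.2 _ (factors_sub K δ τ)
      have : f τ = Truth.T := by
        rw [hconst f hf τ τ₁]
        simpa [Fn.conj] using h
      simp only [this]; rfl
    | stuck =>
      obtain ⟨g, u, h, heq, ⟨τ₁, -, hu⟩, -⟩ := h2
      obtain ⟨rfl, rfl, rfl⟩ : g = [] ∧ f = u ∧ h = [] := by
        cases g <;> simp_all
      have : f τ = Truth.U := by rw [hconst f hf τ τ₁, hu]
      simp only [this]; rfl

/-! ### Verdicts and the connectives -/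

theorem Status.and {b c : Fn L} {a : List (Fn L)} (h : Status K (b :: c :: a) o) :
    Status K (Fn.and b c :: a) o := by
  have hconj : ∀ l, Fn.conj (Fn.and b c :: l) = Fn.conj (b :: c :: l) := fun l => by
    funext τ
    simp only [Fn.conj, Fn.and, Truth.and_assoc]
  cases o with
  | fail | success δ => simpa only [Status, hconj] using h
  | stuck =>
    obtain ⟨g, u, h, heq, ⟨τ, hg, hu⟩, hT⟩ := h
    match g, heq with
    | [], heq =>
      obtain ⟨rfl, rfl⟩ : b = u ∧ c :: a = h := by simpa using heq
      refine ⟨[], _, a, rfl, ⟨τ, rfl, by simp [Fn.and, hu]⟩, fun τ _ h => hT τ rfl ?_⟩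
      exact (Truth.and_eq_T.1 h).1
    | [_], heq =>
      obtain ⟨rfl, rfl, rfl⟩ : b = _ ∧ c = u ∧ a = h := by simpa using heq
      simp only [Fn.conj, Truth.and_T] at hg hT
      refine ⟨[], _, a, rfl, ⟨τ, rfl, by simp [Fn.and, hg, hu]⟩, fun τ _ h => ?_⟩
      exact hT τ (Truth.and_eq_T.1 h).1 (Truth.and_eq_T.1 h).2
    | _ :: _ :: g, heq =>
      obtain ⟨rfl, rfl, rfl⟩ : b = _ ∧ c = _ ∧ a = g ++ u :: h := by simpa using heq
      exact ⟨Fn.and b c :: g, u, h, rfl, ⟨τ, by rw [hconj]; exact hg, hu⟩,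
        fun τ h => hT τ (by rw [← hconj]; exact h)⟩

theorem Matches.conj {B C : Goal L} {α : List (Goal L)} (h : Matches K (stackSem (B :: C :: α)) o) :
    Matches K (stackSem (Goal.conj B C :: α)) o := by
  let is := (sem B).flatMap fun b => (sem C).flatMap fun c => (stackSem α).map fun a => (b, c, a)
  have h1 : stackSem (B :: C :: α) = is.map fun p => p.1 :: p.2.1 :: p.2.2 := by
    simp [is, stackSem, cross, List.map_flatMap, Function.comp_def]
  have h2 : stackSem (Goal.conj B C :: α) = is.map fun p => Fn.and p.1 p.2.1 :: p.2.2 := by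
    simp [is, stackSem, sem, semConj, cross, List.map_flatMap, List.flatMap_assoc,
      List.flatMap_map, Function.comp_def]
  rw [h1] at h
  rw [h2]
  exact h.map' fun _ _ _ => Status.and

theorem stackSem_disj (B C : Goal L) (α : List (Goal L)) :
    stackSem (Goal.disj B C :: α) = stackSem (B :: α) ++ stackSem (C :: α) :=
  cross_append _ _ _

/-- A conjunct `g` that is true exactly on the instances of `δ` acts like the substitution `δ` on
the conjuncts after it. -/
theorem Status.guard {Q : Set ℕ} {g : Fn L} {l : List (Fn L)} {δ : Subst L} (hKQ : K ⊆ Q)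
    (hT : ∀ τ, g τ = Truth.T → Factors Q δ τ) (hδ : ∀ τ, g (Env.sub δ τ) = Truth.T)
    (hU : ∀ τ, g τ ≠ Truth.U) (hl : ∀ f ∈ l, DependsOn f Q)
    (hK : ∀ x ∈ K, ↑(δ x).varFinset ⊆ K') (h : Status K' (l.map (Fn.pull δ)) o) :
    Status K (g :: l) (o.after δ) := by
  have hT' : ∀ τ, g τ = Truth.T → ∃ τ' : Env L, (∀ x ∈ Q, τ x = Env.sub δ τ' x) ∧
      ∀ f : Fn L, DependsOn f Q → f τ = f (Env.sub δ τ') := by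
    intro τ hτ
    obtain ⟨τ', h⟩ := hT τ hτ
    exact ⟨τ', h, fun f hf => hf h⟩
  have hconj := Fn.dependsOn_conj hl
  cases o with
  | fail =>
    intro τ
    rw [Fn.conj, Truth.and_eq_F]
    by_cases hg : g τ = Truth.T
    · obtain ⟨τ', -, h'⟩ := hT' τ hg
      refine Or.inr ⟨hg, ?_⟩
      rw [h' _ hconj, ← Fn.conj_map_pull]
      exact h τ'
    · have := hU τ
      left
      cases hgτ : g τ <;> simp_all
  | success δ₂ =>
    obtain ⟨h1, h2, h3⟩ := h
    refine ⟨fun τ hτ => ?_, fun τ hτ => ?_, fun τ ⟨τ₂, hτ⟩ => ?_⟩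
    · rcases Truth.and_eq_U.1 hτ with h | ⟨hg, h⟩
      · exact hU τ h
      · obtain ⟨τ', -, h'⟩ := hT' τ hg
        rw [h' _ hconj, ← Fn.conj_map_pull] at h
        exact h1 τ' h
    · obtain ⟨hg, h⟩ := Truth.and_eq_T.1 hτ
      obtain ⟨τ', hτ', h'⟩ := hT' τ hg
      rw [h' _ hconj, ← Fn.conj_map_pull] at h
      obtain ⟨τ₂, h⟩ := h2 τ' h
      refine ⟨τ₂, fun x hx => ?_⟩
      rw [hτ' x (hKQ hx), Env.sub_comp]
      exact Env.sub_apply_congr rfl fun y hy => h y (hK x hx hy)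
    · obtain ⟨τ₁, hτ₁, h⟩ := h3 _ (factors_sub K' δ₂ τ₂)
      rw [Fn.conj_map_pull] at h
      refine ⟨Env.sub δ τ₁, fun x hx => ?_, Truth.and_eq_T.2 ⟨hδ τ₁, h⟩⟩
      rw [hτ x hx, Env.sub_comp]
      exact Env.sub_apply_congr rfl fun y hy => hτ₁ y (hK x hx hy)
  | stuck =>
    obtain ⟨g₁, u, h, heq, ⟨τ, hg, hu⟩, hne⟩ := h
    obtain ⟨l₁, l₂, rfl, rfl, heq₂⟩ := List.map_eq_append_iff.1 heq
    obtain ⟨u, l₃, rfl, rfl, rfl⟩ := List.map_eq_cons_iff.1 heq₂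
    rw [Fn.conj_map_pull] at hg
    refine ⟨g :: l₁, u, l₃, rfl, ⟨Env.sub δ τ, Truth.and_eq_T.2 ⟨hδ τ, hg⟩, hu⟩, ?_⟩
    intro τ hτ hu
    obtain ⟨hg, h⟩ := Truth.and_eq_T.1 hτ
    obtain ⟨τ', -, h'⟩ := hT' τ hg
    rw [h' _ (Fn.dependsOn_conj fun f hf => hl f (by simp [hf])), ← Fn.conj_map_pull] at h
    rw [h' u (hl u (by simp))] at hu
    exact hne τ' h hu

theorem Verdict.after_eq_fail (δ : Subst L) (o : Verdict L) : o.after δ = .fail ↔ o = .fail := by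
  cases o <;> simp [Verdict.after]

theorem Verdict.after_var (o : Verdict L) : o.after var = o := by
  cases o <;> rfl

theorem sub_eq_self_of_isMGU {s t : L.Term ℕ} {σ : Subst L} (h : IsMGU s t σ) {τ : Env L}
    (hτ : s.subst τ.toSubst = t.subst τ.toSubst) : Env.sub σ τ = τ := by
  funext x
  exact Subtype.ext (congrFun (h.eq_comp hτ) x)

theorem Matches.eq {s t : L.Term ℕ} {σ : Subst L} {α : List (Goal L)} (hσ : IsMGU s t σ)
    (hK : ∀ x ∈ K, ↑(σ x).varFinset ⊆ K')
    (h : Matches K' (stackSem (α.map fun B => B.subst σ)) o) :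
    Matches K (stackSem (Goal.eq s t :: α)) (o.after σ) := by
  rw [stackSem_map_subst] at h
  rw [stackSem, sem, cross_singleton]
  refine h.map (Verdict.after_eq_fail σ) fun l _ o h => ?_
  refine h.guard (Set.subset_univ K) (fun τ hτ => ⟨τ, fun x _ => ?_⟩) (fun τ => ?_) (fun τ => ?_)
    (fun f _ => dependsOn_univ f) hK
  · rw [sub_eq_self_of_isMGU hσ (Fn.eq_eq_T.1 hτ)]
  · rw [Fn.eq_eq_T, Env.subst_eq_subst_iff, hσ.unifies]
  · rw [Fn.eq]; split_ifs <;> simp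

theorem matches_eq_of_not_unifiable {s t : L.Term ℕ} {α : List (Goal L)} (h : ¬ Unifiable s t) :
    Matches K (stackSem (Goal.eq s t :: α)) .fail :=
  matches_fail_of_sem fun b hb τ => by
    obtain rfl := List.mem_singleton.1 hb
    exact Fn.eq_eq_F.2 fun h' => h ⟨_, h'⟩

theorem matches_call {n : ℕ} {p : L.Relations n} {ts : Fin n → L.Term ℕ} {α : List (Goal L)}
    [Nonempty (GTerm L)] : Matches K (stackSem (Goal.call p ts :: α)) .stuck :=
  matches_stuck_of_sem (pre := []) rfl (by simp) ⟨Classical.arbitrary _, rfl⟩ (by simp)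

theorem Matches.neg_of_fail [Nonempty (GTerm L)] {B : Goal L} {α : List (Goal L)}
    (hB : B.freeVars = ∅) (h : Matches K' (stackSem [B]) .fail)
    (hα : Matches K (stackSem α) o) : Matches K (stackSem (Goal.neg B :: α)) o := by
  have hT : ∀ τ, Fn.not (Fn.disj (sem B)) τ = Truth.T := fun τ => by
    rw [Fn.not, h.disj_sem_eq hB]; rfl
  rw [stackSem, sem, cross_singleton]
  rw [← List.map_id (stackSem α)] at hα
  refine hα.map' fun l _ o h => ?_
  rw [← o.after_var]
  refine Status.guard (K' := K) (Set.subset_univ K) (fun τ _ => ⟨τ, fun x _ => rfl⟩)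
    (fun τ => hT _) (fun τ => by simp [hT]) (fun f _ => dependsOn_univ f)
    (fun x hx y hy => by simp at hy; exact hy ▸ hx) ?_
  have : (Fn.pull var : Fn L → Fn L) = id := rfl
  rwa [this, List.map_id]

theorem Matches.neg_of_success [Nonempty (GTerm L)] {B : Goal L} {α : List (Goal L)}
    {δ : Subst L} (hB : B.freeVars = ∅) (h : Matches K' (stackSem [B]) (.success δ)) :
    Matches K (stackSem (Goal.neg B :: α)) .fail :=
  matches_fail_of_sem fun b hb τ => by
    obtain rfl := List.mem_singleton.1 hb
    rw [Fn.not, h.disj_sem_eq hB]; rfl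

theorem Matches.neg_of_stuck [Nonempty (GTerm L)] {B : Goal L} {α : List (Goal L)}
    (hB : B.freeVars = ∅) (h : Matches K' (stackSem [B]) .stuck) :
    Matches K (stackSem (Goal.neg B :: α)) .stuck := by
  have hU : ∀ τ, Fn.not (Fn.disj (sem B)) τ = Truth.U := fun τ => by
    rw [Fn.not, h.disj_sem_eq hB]; rfl
  exact matches_stuck_of_sem (pre := []) rfl (by simp) ⟨Classical.arbitrary _, hU _⟩
    (fun τ => by simp [hU])

/-! ### Verdicts and quantifiers -/

section Quantifiers

variable {k : ℕ} {xs : Fin k → ℕ} {f : Fn L} {S : Set ℕ}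

/-- Existential quantification is the choice of values for fresh variables `xs`. -/
theorem exists_env_iff (hxs : Function.Injective xs) (hf : DependsOn f S)
    (hS : ∀ i, xs i + k ∉ S) {p : Truth → Prop} {τ : Env L} :
    (∃ e : Env L, (∀ x, e (x + k) = τ x) ∧ p (f e)) ↔
      ∃ τ' : Env L, (∀ x, x ∉ Set.range xs → τ' x = τ x) ∧
        p (Fn.pull (Subst.inst fun i => var (xs i)) f τ') := by
  classical
  constructor
  · rintro ⟨e, he, hp⟩
    refine ⟨fun x => if h : ∃ i, xs i = x then e h.choose else τ x,
      fun x hx => dif_neg hx, ?_⟩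
    convert hp using 1
    refine hf fun x hx => ?_
    rcases lt_or_ge x k with hk | hk
    · have h : ∃ i, xs i = xs ⟨x, hk⟩ := ⟨_, rfl⟩
      rw [Env.sub_eq_of_eq_var (y := xs ⟨x, hk⟩) _ (Subst.inst_of_lt _ hk), dif_pos h,
        hxs h.choose_spec]
    · obtain ⟨y, rfl⟩ := Nat.exists_eq_add_of_le' hk
      rw [Env.sub_eq_of_eq_var (y := y) _ (Subst.inst_add _ _), he,
        dif_neg fun ⟨i, hi⟩ => hS i (hi ▸ hx)]
  · rintro ⟨τ', hτ', hp⟩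
    refine ⟨fun x => if h : x < k then τ' (xs ⟨x, h⟩) else τ (x - k), fun x => by simp, ?_⟩
    convert hp using 1
    refine hf fun x hx => ?_
    rcases lt_or_ge x k with hk | hk
    · rw [Env.sub_eq_of_eq_var (y := xs ⟨x, hk⟩) _ (Subst.inst_of_lt _ hk), dif_pos hk]
    · obtain ⟨y, rfl⟩ := Nat.exists_eq_add_of_le' hk
      rw [Env.sub_eq_of_eq_var (y := y) _ (Subst.inst_add _ _), hτ' y fun ⟨i, hi⟩ => hS i (hi ▸ hx)]
      simp

theorem exN_eq_T_iff (hxs : Function.Injective xs) (hf : DependsOn f S)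
    (hS : ∀ i, xs i + k ∉ S) {τ : Env L} :
    Fn.exN k f τ = Truth.T ↔ ∃ τ' : Env L, (∀ x, x ∉ Set.range xs → τ' x = τ x) ∧
      Fn.pull (Subst.inst fun i => var (xs i)) f τ' = Truth.T := by
  rw [Fn.exN_eq_T]
  exact exists_env_iff hxs hf hS (p := fun w => w = Truth.T)

theorem exN_ne_F_iff (hxs : Function.Injective xs) (hf : DependsOn f S)
    (hS : ∀ i, xs i + k ∉ S) {τ : Env L} :
    Fn.exN k f τ ≠ Truth.F ↔ ∃ τ' : Env L, (∀ x, x ∉ Set.range xs → τ' x = τ x) ∧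
      Fn.pull (Subst.inst fun i => var (xs i)) f τ' ≠ Truth.F := by
  rw [← exists_env_iff hxs hf hS (p := fun w => w ≠ Truth.F), ne_eq, Fn.exN_eq_F]
  push Not
  rfl

/-- The verdict on an existential formula is the one on its instance with fresh variables `xs`. -/
theorem Status.exN {a : List (Fn L)} {A : Set ℕ} (hxs : Function.Injective xs)
    (hf : DependsOn f S) (hS : ∀ i, xs i + k ∉ S) (ha : ∀ g ∈ a, DependsOn g A)
    (hA : ∀ i, xs i ∉ A) (hK : ∀ i, xs i ∉ K)
    (h : Status K (Fn.pull (Subst.inst fun i => var (xs i)) f :: a) o) :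
    Status K (Fn.exN k f :: a) o := by
  have hT := fun τ => exN_eq_T_iff hxs hf hS (τ := τ)
  have hF := fun τ => exN_ne_F_iff hxs hf hS (τ := τ)
  generalize Fn.pull (Subst.inst fun i => var (xs i)) f = f' at *
  -- the conjuncts after `f` do not depend on the values of `xs`
  have hdep : ∀ g : Fn L, DependsOn g A → ∀ τ τ' : Env L,
      (∀ x, x ∉ Set.range xs → τ' x = τ x) → g τ' = g τ := fun g hg τ τ' h =>
    hg fun x hx => h x fun ⟨i, hi⟩ => hA i (hi ▸ hx)
  have hconj := Fn.dependsOn_conj ha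
  have hU : (∀ τ, f' τ ≠ Truth.U) → ∀ τ, Fn.exN k f τ ≠ Truth.U := by
    intro hf' τ hτ
    obtain ⟨τ', h1, h2⟩ := (hF τ).1 (by simp [hτ])
    have : Fn.exN k f τ = Truth.T := (hT τ).2 ⟨τ', h1, by
      have := hf' τ'
      cases h : f' τ' <;> simp_all⟩
    simp [hτ] at this
  cases o with
  | fail =>
    intro τ
    have hU' := hU (fun τ' hτ' => by
      have := h τ'
      simp [Fn.conj, hτ'] at this) τ
    rw [Fn.conj, Truth.and_eq_F]
    by_cases hτ : Fn.exN k f τ = Truth.T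
    · obtain ⟨τ', h1, h2⟩ := (hT τ).1 hτ
      refine Or.inr ⟨hτ, ?_⟩
      have := h τ'
      simp only [Fn.conj, h2, Truth.T_and] at this
      rw [← hdep _ hconj τ τ' h1, this]
    · left
      cases h : Fn.exN k f τ <;> simp_all
  | success δ =>
    obtain ⟨h1, h2, h3⟩ := h
    refine ⟨fun τ hτ => ?_, fun τ hτ => ?_, fun τ hτ => ?_⟩
    · have hU' := hU (fun τ' hτ' => h1 τ' (by simp [Fn.conj, hτ'])) τ
      rcases Truth.and_eq_U.1 hτ with h | ⟨h, h'⟩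
      · exact hU' h
      · obtain ⟨τ', h4, h5⟩ := (hT τ).1 h
        refine h1 τ' (Truth.and_eq_U.2 (Or.inr ⟨h5, ?_⟩))
        rw [hdep _ hconj τ τ' h4, h']
    · obtain ⟨h, h'⟩ := Truth.and_eq_T.1 hτ
      obtain ⟨τ', h4, h5⟩ := (hT τ).1 h
      obtain ⟨τ₂, h6⟩ := h2 τ' (Truth.and_eq_T.2 ⟨h5, by rw [hdep _ hconj τ τ' h4, h']⟩)
      refine ⟨τ₂, fun x hx => ?_⟩
      rw [← h6 x hx, h4 x fun ⟨i, hi⟩ => hK i (hi ▸ hx)]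
    · obtain ⟨τ₁, h4, h5⟩ := h3 τ hτ
      obtain ⟨h5, h6⟩ := Truth.and_eq_T.1 h5
      exact ⟨τ₁, h4, Truth.and_eq_T.2 ⟨(hT τ₁).2 ⟨τ₁, fun _ _ => rfl, h5⟩, h6⟩⟩
  | stuck =>
    obtain ⟨g, u, h, heq, ⟨τ, hg, hu⟩, hne⟩ := h
    cases g with
    | nil =>
      obtain ⟨rfl, rfl⟩ : f' = u ∧ a = h := by simpa using heq
      have hne' : ∀ τ, Fn.exN k f τ ≠ Truth.T := fun τ hτ => by
        obtain ⟨τ', -, h'⟩ := (hT τ).1 hτ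
        exact hne τ' rfl h'
      refine ⟨[], _, a, rfl, ⟨τ, rfl, Truth.eq_U_of_ne (hne' τ) ?_⟩, fun τ _ => hne' τ⟩
      exact (hF τ).2 ⟨τ, fun _ _ => rfl, by simp [hu]⟩
    | cons g₁ g =>
      obtain ⟨rfl, rfl⟩ : f' = g₁ ∧ a = g ++ u :: h := by simpa using heq
      obtain ⟨hg₁, hg⟩ := Truth.and_eq_T.1 hg
      refine ⟨Fn.exN k f :: g, u, h, rfl,
        ⟨τ, Truth.and_eq_T.2 ⟨(hT τ).2 ⟨τ, fun _ _ => rfl, hg₁⟩, hg⟩, hu⟩, ?_⟩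
      intro τ hτ hu
      obtain ⟨h1, h2⟩ := Truth.and_eq_T.1 hτ
      obtain ⟨τ', h3, h4⟩ := (hT τ).1 h1
      refine hne τ' (Truth.and_eq_T.2 ⟨h4, ?_⟩) ?_
      · rw [hdep _ (Fn.dependsOn_conj fun f hf => ha f (by simp [hf])) τ τ' h3, h2]
      · rw [hdep u (ha u (by simp)) τ τ' h3, hu]

end Quantifiers

theorem Matches.ex {B : Goal L} {α : List (Goal L)} {x : ℕ} (hxB : x ∉ (Goal.ex B).freeVars)
    (hxα : x ∉ stackVars α) (hxK : x ∉ K) (h : Matches K (stackSem (B.inst1 (var x) :: α)) o) :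
    Matches K (stackSem (Goal.ex B :: α)) o := by
  rw [stackSem, Goal.inst1, Goal.inst, sem_subst, cross_map] at h
  rw [stackSem, sem, cross_map]
  refine h.map' fun ⟨b, a⟩ hba o h => ?_
  simp only [List.mem_flatMap, List.mem_map, Prod.mk.injEq] at hba
  obtain ⟨b, hb, a, ha, rfl, rfl⟩ := hba
  exact Status.exN (k := 1) (xs := fun _ => x) (Function.injective_of_subsingleton _)
    (dependsOn_sem B b hb) (fun _ => hxB) (dependsOn_stackSem a ha) (fun _ => hxα) (fun _ => hxK) h

/-! ### Verdicts and conditionals -/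

section Conditional

variable {k : ℕ} {xs : Fin k → ℕ} {B C : Goal L} {α : List (Goal L)}

theorem semIf_eq_F {bs cs : List (Fn L)} (h : ∀ b ∈ bs, ∀ τ, Fn.exN k b τ = Truth.F) :
    ∀ f ∈ semIf k bs cs, ∀ τ, f τ = Truth.F := by
  induction bs with
  | nil => simp [semIf]
  | cons b bs ih =>
    rw [List.forall_mem_cons] at h
    intro f hf τ
    simp only [semIf, List.mem_append, List.mem_map] at hf
    rcases hf with ⟨c, -, rfl⟩ | ⟨d, hd, rfl⟩
    · rw [Fn.exN_eq_F]
      intro e he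
      simp [Fn.and, Fn.exN_eq_F.1 (h.1 τ) e he]
    · simp [Fn.and, Fn.not, h.1 τ, ih h.2 d hd τ, Truth.not]

theorem semIf_skip {pre bs cs : List (Fn L)} (h : ∀ b ∈ pre, ∀ τ, Fn.exN k b τ = Truth.F) :
    semIf k (pre ++ bs) cs = semIf k pre cs ++ semIf k bs cs := by
  rw [semIf_append]
  congr 1
  convert List.map_id _ using 2
  funext d τ
  have : Fn.disj (pre.map (Fn.exN k)) τ = Truth.F := Fn.disj_eq_F fun f hf => by
    obtain ⟨b, hb, rfl⟩ := List.mem_map.1 hf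
    exact h b hb τ
  simp [Fn.and, Fn.not, this, Truth.not]

variable (hxs : Function.Injective xs) (hB : (Goal.exN k B).freeVars = ∅)

include hB in
theorem not_mem_freeVars_of_exN (x : ℕ) : x + k ∉ B.freeVars := fun h => by
  have := Goal.mem_freeVars_exN.2 h
  simp [hB] at this

include hxs hB in
theorem exN_eq_F_of_status {b : Fn L} (hb : b ∈ sem B)
    (h : Status K' [Fn.pull (Subst.inst fun i => var (xs i)) b] .fail) (τ : Env L) :
    Fn.exN k b τ = Truth.F := by
  by_contra hne
  obtain ⟨τ', -, h'⟩ := (exN_ne_F_iff hxs (dependsOn_sem B b hb)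
    fun i => not_mem_freeVars_of_exN hB _).1 hne
  exact h' (by simpa [Fn.conj] using h τ')

include hxs hB in
theorem Matches.ifThen_of_fail
    (h : Matches K' (stackSem [B.inst fun i => var (xs i)]) .fail) :
    Matches K (stackSem (Goal.ifThen k B C :: α)) .fail := by
  rw [stackSem_singleton, Goal.inst, sem_subst, matches_fail_iff] at h
  refine matches_fail_of_sem (semIf_eq_F fun b hb τ => ?_)
  exact exN_eq_F_of_status hxs hB hb (h _ (List.mem_map_of_mem (List.mem_map_of_mem hb))) τ

include hxs hB in
/-- The first disjunct of a condition that does not fail. -/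
theorem Matches.exists_of_inst {o : Verdict L} (ho : o ≠ .fail)
    (h : Matches K' (stackSem [B.inst fun i => var (xs i)]) o) :
    ∃ pre b post, sem B = pre ++ b :: post ∧ (∀ b ∈ pre, ∀ τ, Fn.exN k b τ = Truth.F) ∧
      Status K' [Fn.pull (Subst.inst fun i => var (xs i)) b] o := by
  rw [stackSem_singleton, Goal.inst, sem_subst, List.map_map, matches_iff_of_ne ho] at h
  obtain ⟨pre, l, post, heq, h1, h2⟩ := h
  obtain ⟨pre, bs, hsem, rfl, heq₂⟩ := List.map_eq_append_iff.1 heq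
  obtain ⟨b, post, rfl, rfl, rfl⟩ := List.map_eq_cons_iff.1 heq₂
  refine ⟨pre, b, post, hsem, fun b hb τ => ?_, h2⟩
  exact exN_eq_F_of_status hxs hB (by simp [hsem, hb]) (h1 _ (List.mem_map_of_mem hb)) τ

include hxs hB in
theorem Matches.ifThen_of_stuck
    (h : Matches K' (stackSem [B.inst fun i => var (xs i)]) .stuck) :
    Matches K (stackSem (Goal.ifThen k B C :: α)) .stuck := by
  obtain ⟨pre, b, post, hsem, hpre, g, u, t, heq, ⟨τ, -, hu⟩, hne⟩ :=
    h.exists_of_inst hxs hB (by simp)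
  obtain ⟨c, cs, hc⟩ := List.exists_cons_of_ne_nil (sem_ne_nil C)
  obtain ⟨rfl, rfl, rfl⟩ : g = [] ∧ Fn.pull (Subst.inst fun i => var (xs i)) b = u ∧ t = [] := by
    cases g <;> simp_all
  have hG : sem (Goal.ifThen k B C) = semIf k pre (sem C) ++ Fn.exN k (Fn.and b c) ::
      ((cs.map fun c => Fn.exN k (Fn.and b c)) ++
        (semIf k post (sem C)).map fun d => Fn.and (Fn.not (Fn.exN k b)) d) := by
    rw [sem, hsem, semIf_skip hpre, semIf, hc]
    simp
  have hT : ∀ τ, Fn.exN k b τ ≠ Truth.T := fun τ hτ => by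
    obtain ⟨τ', -, h'⟩ := (exN_eq_T_iff hxs (dependsOn_sem B b (by simp [hsem]))
      fun i => not_mem_freeVars_of_exN hB _).1 hτ
    exact hne τ' rfl h'
  have hT' : ∀ τ, Fn.exN k (Fn.and b c) τ ≠ Truth.T := fun τ hτ => by
    obtain ⟨e, he, h'⟩ := Fn.exN_eq_T.1 hτ
    exact hT τ (Fn.exN_eq_T.2 ⟨e, he, (Truth.and_eq_T.1 h').1⟩)
  refine matches_stuck_of_sem hG (semIf_eq_F hpre) ⟨τ, Truth.eq_U_of_ne (hT' τ) fun hF => ?_⟩ hT'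
  have := Fn.exN_eq_F.1 hF (Env.sub (Subst.inst fun i => var (xs i)) τ) fun x =>
    Env.sub_eq_of_eq_var τ (Subst.inst_add _ _)
  rw [Fn.and, show b (Env.sub (Subst.inst fun i => var (xs i)) τ) = Truth.U from hu] at this
  simp at this

include hxs hB in
/-- The verdict on a conditional whose condition succeeds with the answer `δ`.  Up to the first
disjunct `b` of the condition that does not fail, all disjuncts of the conditional fail.  Those for
`b` are `∃ xs (b ∧ c)`, where `b` acts like `δ` on `c` and the rest of the stack.  The disjuncts after
them fail as well, since they contain `¬ ∃ xs b`. -/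
theorem Matches.ifThen_of_success [Nonempty (GTerm L)] {Q : Set ℕ} {δ : Subst L}
    (hx : ∀ i, xs i ∉ K) (hxC : ∀ i, xs i ∉ (Goal.ifThen k B C).freeVars)
    (hxα : ∀ i, xs i ∉ stackVars α)
    (hQ : K ∪ (Goal.ifThen k B C).freeVars ∪ stackVars α ∪ Set.range xs ⊆ Q)
    (hK : ∀ x ∈ K, ↑(δ x).varFinset ⊆ K') (hα : α.map (fun B => B.subst δ) = α)
    (h : Matches Q (stackSem [B.inst fun i => var (xs i)]) (.success δ))
    (hC : Matches K' (stackSem ((C.inst fun i => var (xs i)).subst δ :: α)) o) :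
    Matches K (stackSem (Goal.ifThen k B C :: α)) (o.after δ) := by
  obtain ⟨pre, b, post, hsem, hpre, h1, h2, h3⟩ := h.exists_of_inst hxs hB (by simp)
  have hb : b ∈ sem B := by simp [hsem]
  simp only [Fn.conj, Truth.and_T] at h1 h2 h3
  have hQ' : ∀ x, x ∈ K ∨ x ∈ (Goal.ifThen k B C).freeVars ∨ x ∈ stackVars α ∨ x ∈ Set.range xs →
      x ∈ Q := fun x hx => hQ (by simp only [Set.mem_union]; tauto)
  have hdb : DependsOn (Fn.pull (Subst.inst fun i => var (xs i)) b) Q := by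
    have := dependsOn_sem (B.subst (Subst.inst fun i => var (xs i))) _
      (by rw [sem_subst]; exact List.mem_map_of_mem hb)
    refine this.mono fun x hx => hQ' x ?_
    rcases Goal.mem_freeVars_inst.1 hx with hx | ⟨i, -, hx⟩
    · exact absurd hx (not_mem_freeVars_of_exN hB x)
    · simp at hx
      exact Or.inr (Or.inr (Or.inr ⟨i, hx.symm⟩))
  have hδ : ∀ τ, Fn.pull (Subst.inst fun i => var (xs i)) b (Env.sub δ τ) = Truth.T := fun τ => by
    obtain ⟨τ₁, h4, h5⟩ := h3 _ (factors_sub Q δ τ)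
    rw [← hdb h4, h5]
  -- the condition has been met, so the branches for its other disjuncts fail
  have hT : ∀ τ, Fn.exN k b τ = Truth.T := fun τ => by
    have hconst := ((Fn.dependsOn_exN k (dependsOn_sem B b hb)).mono
      (Set.subset_empty_iff.2 (Set.eq_empty_of_forall_notMem
        (not_mem_freeVars_of_exN hB)))).empty
    rw [hconst τ (Env.sub δ τ), exN_eq_T_iff hxs (dependsOn_sem B b hb)
      fun i => not_mem_freeVars_of_exN hB _]
    exact ⟨_, fun _ _ => rfl, hδ τ⟩
  have hcδ : stackSem ((C.inst fun i => var (xs i)).subst δ :: α) =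
      ((sem C).flatMap fun c => (stackSem α).map fun a => (c, a)).map fun p =>
        (Fn.pull (Subst.inst fun i => var (xs i)) p.1 :: p.2).map (Fn.pull δ) := by
    conv_lhs => rw [stackSem, sem_subst, Goal.inst, sem_subst, ← hα, stackSem_map_subst]
    simp [cross, List.map_flatMap, List.flatMap_map, Function.comp_def]
  rw [hcδ] at hC
  rw [stackSem, sem, hsem, semIf_skip hpre, semIf, cross_append, cross_append, cross_map]
  refine Matches.append_right ?_ fun l hl => ?_
  · have hmain := hC.map (K' := K) (F' := fun p => Fn.exN k (Fn.and b p.1) :: p.2)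
      (Verdict.after_eq_fail δ) ?_
    · have hrest : ∀ l ∈ cross ((semIf k post (sem C)).map fun d =>
          Fn.and (Fn.not (Fn.exN k b)) d) (stackSem α), Status K l .fail := by
        intro l hl
        obtain ⟨f, hf, a, -, rfl⟩ := mem_cross.1 hl
        obtain ⟨d, -, rfl⟩ := List.mem_map.1 hf
        exact status_fail_cons fun τ => by simp [Fn.and, Fn.not, hT, Truth.not]
      by_cases ho : o.after δ = .fail
      · rw [ho] at hmain ⊢
        exact (matches_fail_iff.2 hrest).append_right (matches_fail_iff.1 hmain)
      · exact hmain.append_left ho _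
    · rintro ⟨c, a⟩ hca o hs
      simp only [List.mem_flatMap, List.mem_map, Prod.mk.injEq] at hca
      obtain ⟨c, hc, a, ha, rfl, rfl⟩ := hca
      have hda := dependsOn_stackSem a ha
      have hdc : DependsOn (Fn.pull (Subst.inst fun i => var (xs i)) c) Q := by
        have := dependsOn_sem (C.subst (Subst.inst fun i => var (xs i))) _
          (by rw [sem_subst]; exact List.mem_map_of_mem hc)
        refine this.mono fun x hx => hQ' x ?_
        rcases Goal.mem_freeVars_inst.1 hx with hx | ⟨i, -, hx⟩
        · exact Or.inr (Or.inl (Or.inr hx))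
        · simp at hx
          exact Or.inr (Or.inr (Or.inr ⟨i, hx.symm⟩))
      have hg := hs.guard (K := K) (fun x hx => hQ' x (Or.inl hx)) h2 hδ h1 (by
        rw [List.forall_mem_cons]
        exact ⟨hdc, fun f hf => (hda f hf).mono fun x hx => hQ' x (by tauto)⟩) hK
      exact Status.exN hxs (Fn.dependsOn_and ((dependsOn_sem B b hb).mono Set.subset_union_left)
        ((dependsOn_sem C c hc).mono Set.subset_union_right)) hxC hda hxα hx hg.and
  · obtain ⟨f, hf, a, -, rfl⟩ := mem_cross.1 hl
    exact status_fail_cons (semIf_eq_F hpre f hf)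

end Conditional

end Matches

/-! ### Answers of computations -/

/-- The substitution `θ` fixes the variables of the goal stack, as it does after it has been applied
to the stack. -/
def Apart (θ : Subst L) (α : List (Goal L)) : Prop := ∀ x ∈ stackVars α, θ x = var x

/-- The computation of `α` under `θ` and `V` leads to the substitution `θ'` by way of the answer `δ`,
which leaves alone those variables in use that do not occur in `α`. -/
structure Answer (V : Set ℕ) (θ : Subst L) (α : List (Goal L)) (θ' δ : Subst L) : Prop where
  eq_comp : θ' = θ.comp δ
  idem : δ.comp δ = δ
  finite : δ.vars.Finite
  avoid : ∀ x ∈ V ∪ θ.vars, x ∉ stackVars α → x ∉ δ.vars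

namespace Answer

variable {V : Set ℕ} {θ θ₁ θ₂ σ δ : Subst L} {α β : List (Goal L)}

theorem nil (V : Set ℕ) (θ : Subst L) (α : List (Goal L)) : Answer V θ α θ var := by
  have : Subst.vars (var : Subst L) = ∅ := by simp [Subst.vars, Subst.dom]
  exact ⟨(Subst.comp_var θ).symm, rfl, by simp [this], by simp [this]⟩

theorem mono (h : Answer V θ β θ₁ δ)
    (hβ : ∀ x ∈ V ∪ θ.vars, x ∈ stackVars β → x ∈ stackVars α) : Answer V θ α θ₁ δ :=
  { h with avoid := fun x hx hα => h.avoid x hx fun hx' => hα (hβ x hx hx') }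

theorem mono_subset (h : Answer V θ β θ₁ δ) (hβ : stackVars β ⊆ stackVars α) :
    Answer V θ α θ₁ δ :=
  h.mono fun _ _ hx => hβ hx

theorem vars_finite (h : Answer V θ α θ₁ δ) (hθ : θ.vars.Finite) : θ₁.vars.Finite := by
  rw [h.eq_comp]
  exact (hθ.union h.finite).subset (Subst.vars_comp_subset θ δ)

/-- Variables in use stay in use. -/
theorem varFinset_subset (h : Answer V θ α θ₁ δ) (hdom : ∀ x ∈ δ.dom, θ x = var x) :
    ∀ x ∈ V ∪ θ.vars, ↑(δ x).varFinset ⊆ V ∪ θ₁.vars := by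
  intro x hx z hz
  have hz' : z ∈ δ.vars → z ∈ V ∪ θ₁.vars := fun hz' =>
    Or.inr (h.eq_comp ▸ Subst.vars_subset_comp_of_dom hdom hz')
  by_cases hzδ : z ∈ δ.vars
  · exact hz' hzδ
  · obtain rfl := Subst.eq_of_mem_varFinset hzδ hz
    rcases hx with hx | hx
    · exact Or.inl hx
    · exact Or.inr (h.eq_comp ▸ Subst.mem_vars_comp_of_left hx hzδ)

/-- Composition of a computation step with the rest of the computation. -/
theorem comp (h₁ : Answer V θ α θ₁ σ) (hdom : ∀ x ∈ σ.dom, θ x = var x)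
    (hβ : ∀ x ∈ stackVars β, x ∈ V ∪ θ.vars → x ∈ stackVars α ∨ x ∈ σ.vars)
    (hap : Apart θ₁ β) (h₂ : Answer V θ₁ β θ₂ δ) : Answer V θ α θ₂ (σ.comp δ) where
  eq_comp := by rw [h₂.eq_comp, h₁.eq_comp, Subst.comp_assoc]
  idem := by
    refine Subst.idem_of_forall fun y z hz => ?_
    obtain ⟨w, hw, hz⟩ := Subst.mem_varFinset_subst.1 hz
    have hw' := Subst.notMem_dom_of_idem h₁.idem hw
    have hz' := Subst.notMem_dom_of_idem h₂.idem hz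
    have hσz : σ z = var z := by
      by_contra hne
      have hθ₁ : θ₁ z ≠ var z := by
        rw [h₁.eq_comp]
        simpa [Subst.comp, hdom z hne] using hne
      have hzδ : z ∉ δ.vars := h₂.avoid z (Or.inr (Or.inl hθ₁)) fun hz => hθ₁ (hap z hz)
      obtain rfl := Subst.eq_of_mem_varFinset hzδ hz
      exact hne hw'
    simp [Subst.comp, hσz, hz']
  finite := (h₁.finite.union h₂.finite).subset (Subst.vars_comp_subset σ δ)
  avoid := by
    intro x hx hxα hxv
    have hσ := h₁.avoid x hx hxα
    refine (Subst.vars_comp_subset σ δ hxv).elim hσ (h₂.avoid x ?_ ?_)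
    · rcases hx with hx | hx
      · exact Or.inl hx
      · exact Or.inr (h₁.eq_comp ▸ Subst.mem_vars_comp_of_left hx hσ)
    · exact fun hxβ => (hβ x hxβ hx).elim hxα hσ

end Answer

section Steps

variable {V : Set ℕ} {θ θ₁ σ δ : Subst L} {α : List (Goal L)}

theorem Apart.mono {β : List (Goal L)} (h : Apart θ α) (hβ : stackVars β ⊆ stackVars α) :
    Apart θ β := fun x hx => h x (hβ hx)

theorem apart_singleton_of_closed {B : Goal L} (hB : B.freeVars = ∅) : Apart θ [B] := by
  intro x hx
  simp [stackVars, hB] at hx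

theorem stackVars_conj (B C : Goal L) (α : List (Goal L)) :
    stackVars (Goal.conj B C :: α) = stackVars (B :: C :: α) := by
  simp [stackVars_cons, Goal.freeVars, Set.union_assoc]

theorem stackVars_subset_cons (B : Goal L) (α : List (Goal L)) :
    stackVars α ⊆ stackVars (B :: α) := by
  rw [stackVars_cons]; exact Set.subset_union_right

theorem stackVars_disj_left (B C : Goal L) (α : List (Goal L)) :
    stackVars (B :: α) ⊆ stackVars (Goal.disj B C :: α) := by
  rw [stackVars_cons, stackVars_cons]
  exact Set.union_subset_union_left _ Set.subset_union_left

theorem stackVars_disj_right (B C : Goal L) (α : List (Goal L)) :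
    stackVars (C :: α) ⊆ stackVars (Goal.disj B C :: α) := by
  rw [stackVars_cons, stackVars_cons]
  exact Set.union_subset_union_left _ Set.subset_union_right

theorem stackVars_expands {P : Program L} (hP : Completed P) {n : ℕ} {p : L.Relations n}
    {ts : Fin n → L.Term ℕ} {B : Goal L} (h : Expands P p ts B) :
    stackVars (B :: α) ⊆ stackVars (Goal.call p ts :: α) := by
  rw [stackVars_cons, stackVars_cons]
  exact Set.union_subset_union_left _ (h.freeVars_subset hP)

theorem stackVars_ex {B : Goal L} {x y : ℕ} (h : y ∈ stackVars (B.inst1 (var x) :: α))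
    (hy : y ≠ x) : y ∈ stackVars (Goal.ex B :: α) := by
  rw [stackVars_cons] at h ⊢
  refine h.imp_left fun h => ?_
  rcases Goal.mem_freeVars_inst.1 h with h | ⟨_, -, h⟩
  · exact h
  · simp at h; exact absurd h hy

theorem apart_ex {B : Goal L} {x : ℕ} (h : Apart θ (Goal.ex B :: α)) (hx : x ∉ θ.vars) :
    Apart θ (B.inst1 (var x) :: α) := by
  intro y hy
  by_cases hyx : y = x
  · exact hyx ▸ Subst.eq_var_of_notMem_vars hx
  · exact h y (stackVars_ex hy hyx)

section Eq

variable {s t : L.Term ℕ} (hσ : IsMGU s t σ)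

include hσ

theorem mem_stackVars_of_mem_vars {x : ℕ} (hx : x ∈ σ.vars) :
    x ∈ stackVars (Goal.eq s t :: α) := by
  rw [stackVars_cons]
  exact Or.inl (hσ.relevant x hx)

theorem stackVars_map_mgu_subset :
    stackVars (α.map fun B => B.subst σ) ⊆ stackVars (Goal.eq s t :: α) := by
  intro x hx
  obtain ⟨y, hy, hx⟩ := mem_stackVars_map_subst.1 hx
  rcases Subst.mem_vars_of_mem_varFinset hx with rfl | hx
  · exact stackVars_subset_cons _ _ hy
  · exact mem_stackVars_of_mem_vars hσ hx

theorem apart_eq (h : Apart θ (Goal.eq s t :: α)) :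
    Apart (θ.comp σ) (α.map fun B => B.subst σ) := by
  intro x hx
  have hθ := h x (stackVars_map_mgu_subset hσ hx)
  obtain ⟨y, -, hx⟩ := mem_stackVars_map_subst.1 hx
  simpa [Subst.comp, hθ] using Subst.notMem_dom_of_idem hσ.idempotent hx

theorem answer_eq : Answer V θ (Goal.eq s t :: α) (θ.comp σ) σ where
  eq_comp := rfl
  idem := hσ.idempotent
  finite := by
    refine (s.varFinset ∪ t.varFinset).finite_toSet.subset fun x hx => ?_
    simpa using hσ.relevant x hx
  avoid := fun _ _ hx hx' => hx (mem_stackVars_of_mem_vars hσ hx')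

theorem dom_eq (h : Apart θ (Goal.eq s t :: α)) : ∀ x ∈ σ.dom, θ x = var x :=
  fun x hx => h x (mem_stackVars_of_mem_vars hσ (Or.inl hx))

end Eq

section Cond

variable {k : ℕ} {B C : Goal L} {xs : Fin k → ℕ}

theorem stackVars_condition (hB : (Goal.exN k B).freeVars = ∅) :
    stackVars [B.inst fun i => (var (xs i) : L.Term ℕ)] ⊆ Set.range xs := by
  intro x hx
  rw [stackVars_cons, stackVars_nil, Set.union_empty] at hx
  rcases Goal.mem_freeVars_inst.1 hx with hx | ⟨i, -, hx⟩
  · exact absurd hx (not_mem_freeVars_of_exN hB x)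
  · simp at hx
    exact ⟨i, hx.symm⟩

theorem apart_condition (hB : (Goal.exN k B).freeVars = ∅)
    (hxs : ∀ i, xs i ∉ V ∪ θ.vars ∪ stackVars (Goal.ifThen k B C :: α)) :
    Apart θ [B.inst fun i => var (xs i)] := by
  intro x hx
  obtain ⟨i, rfl⟩ := stackVars_condition hB hx
  exact Subst.eq_var_of_notMem_vars fun h => hxs i (Or.inl (Or.inr h))

variable (hap : Apart θ (Goal.ifThen k B C :: α)) (hB : (Goal.exN k B).freeVars = ∅)
  (hxs : ∀ i, xs i ∉ V ∪ θ.vars ∪ stackVars (Goal.ifThen k B C :: α))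
  (h : Answer (V ∪ stackVars (Goal.ifThen k B C :: α) ∪ Set.range xs) θ
    [B.inst fun i => var (xs i)] θ₁ δ)

include hB h in
/-- The answer for a condition only concerns its own variables and new ones. -/
theorem notMem_vars_of_condition {x : ℕ}
    (hx : x ∈ V ∪ θ.vars ∪ stackVars (Goal.ifThen k B C :: α)) (hxs : x ∉ Set.range xs) :
    x ∉ δ.vars := by
  refine h.avoid x ?_ fun hx => hxs (stackVars_condition hB hx)
  simp only [Set.mem_union] at hx ⊢
  tauto

include hB hxs h in
theorem answer_condition : Answer V θ (Goal.ifThen k B C :: α) θ₁ δ :=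
  { h with
    avoid := fun _ hx _ => notMem_vars_of_condition hB h (Or.inl hx) fun ⟨i, hi⟩ =>
      hxs i (Or.inl (hi ▸ hx)) }

include hB hxs h in
theorem eq_var_of_mem_condition_vars {x : ℕ} (hx : x ∈ δ.vars) : θ x = var x := by
  refine Subst.eq_var_of_notMem_vars fun hθ => ?_
  refine notMem_vars_of_condition hB h (Or.inl (Or.inr hθ)) (fun ⟨i, hi⟩ => ?_) hx
  exact hxs i (Or.inl (Or.inr (hi ▸ hθ)))

include hap hB hxs h in
theorem condition_fixes {x : ℕ} (hx : x ∈ stackVars (Goal.ifThen k B C :: α)) :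
    θ x = var x ∧ δ x = var x :=
  ⟨hap x hx, Subst.eq_var_of_notMem_vars (notMem_vars_of_condition hB h (Or.inr hx)
    fun ⟨i, hi⟩ => hxs i (Or.inr (hi ▸ hx)))⟩

include hap hB hxs h in
theorem subst_consequence {C' : Goal L} (hC : C'.freeVars ⊆ C.freeVars) :
    (C'.inst fun i => var (xs i)).subst θ₁ = (C'.inst fun i => var (xs i)).subst δ := by
  refine Goal.subst_congr fun x hx => ?_
  rw [h.eq_comp]
  rcases Goal.mem_freeVars_inst.1 hx with hx | ⟨i, -, hx⟩
  · have hx' : x ∈ stackVars (Goal.ifThen k B C :: α) := by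
      rw [stackVars_cons]
      exact Or.inl (Or.inr (hC hx))
    simp [Subst.comp, (condition_fixes hap hB hxs h hx').1]
  · simp at hx
    have : xs i ∉ θ.vars := fun h => hxs i (Or.inl (Or.inr h))
    simp [Subst.comp, hx, Subst.eq_var_of_notMem_vars this]

include hap hB hxs h in
theorem map_subst_condition {β : List (Goal L)} (hβ : stackVars β ⊆ stackVars α) :
    β.map (fun B => B.subst δ) = β := by
  refine (List.map_congr_left fun D hD => ?_).trans (List.map_id β)
  exact Goal.subst_eq_self fun x hx => (condition_fixes hap hB hxs h
    (stackVars_subset_cons _ _ (hβ ⟨D, hD, hx⟩))).2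

include hap hB hxs h in
theorem mem_stackVars_consequence {x : ℕ}
    (hx : x ∈ stackVars ((C.inst fun i => var (xs i)).subst θ₁ :: α)) :
    x ∈ stackVars (Goal.ifThen k B C :: α) ∨ x ∈ Set.range xs ∧ δ x = var x ∨ x ∈ δ.vars := by
  rw [stackVars_cons] at hx
  rcases hx with hx | hx
  · rw [subst_consequence hap hB hxs h subset_rfl] at hx
    obtain ⟨y, hy, hx'⟩ := Goal.mem_freeVars_subst.1 hx
    rcases Subst.mem_vars_of_mem_varFinset hx' with rfl | hx'
    · by_cases hx' : x ∈ δ.vars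
      · exact Or.inr (Or.inr hx')
      rcases Goal.mem_freeVars_inst.1 hy with hy | ⟨i, -, hy⟩
      · refine Or.inl ?_
        rw [stackVars_cons]
        exact Or.inl (Or.inr hy)
      · simp at hy
        exact Or.inr (Or.inl ⟨⟨i, hy.symm⟩, Subst.eq_var_of_notMem_vars hx'⟩)
    · exact Or.inr (Or.inr hx')
  · exact Or.inl (stackVars_subset_cons _ _ hx)

include hap hB hxs h in
theorem apart_consequence : Apart θ₁ ((C.inst fun i => var (xs i)).subst θ₁ :: α) := by
  intro x hx
  have key : θ x = var x ∧ δ x = var x := by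
    rcases mem_stackVars_consequence hap hB hxs h hx with hx' | ⟨⟨i, rfl⟩, hx'⟩ | hx'
    · exact condition_fixes hap hB hxs h hx'
    · exact ⟨Subst.eq_var_of_notMem_vars fun h => hxs i (Or.inl (Or.inr h)), hx'⟩
    · refine ⟨eq_var_of_mem_condition_vars hB hxs h hx', ?_⟩
      rw [stackVars_cons] at hx
      rcases hx with hx | hx
      · rw [subst_consequence hap hB hxs h subset_rfl] at hx
        obtain ⟨y, -, hx⟩ := Goal.mem_freeVars_subst.1 hx
        exact Subst.notMem_dom_of_idem h.idem hx
      · exact (condition_fixes hap hB hxs h (stackVars_subset_cons _ _ hx)).2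
  simp [h.eq_comp, Subst.comp, key.1, key.2]

include hap hB hxs h in
theorem answer_ifThen {θ₂ δ₂ : Subst L}
    (h₂ : Answer V θ₁ ((C.inst fun i => var (xs i)).subst θ₁ :: α) θ₂ δ₂) :
    Answer V θ (Goal.ifThen k B C :: α) θ₂ (δ.comp δ₂) := by
  refine (answer_condition hB hxs h).comp
    (fun x hx => eq_var_of_mem_condition_vars hB hxs h (Or.inl hx)) (fun x hx hxV => ?_)
    (apart_consequence hap hB hxs h) h₂
  rcases mem_stackVars_consequence hap hB hxs h hx with hx | ⟨⟨i, rfl⟩, -⟩ | hx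
  · exact Or.inl hx
  · exact absurd (Or.inl hxV) (hxs i)
  · exact Or.inr hx

include hap hB hxs h in
/-- The verdict on a conditional whose condition succeeds.  The formulas `B'`, `C'` and `β` stand for
unfoldings of `B`, `C` and `α`. -/
theorem matches_ifThen [Nonempty (GTerm L)] {B' C' : Goal L} {β : List (Goal L)} {o : Verdict L}
    (hinj : Function.Injective xs) (hB' : B'.freeVars ⊆ B.freeVars)
    (hC' : C'.freeVars ⊆ C.freeVars) (hβ : stackVars β ⊆ stackVars α)
    (h₁ : Matches (V ∪ stackVars (Goal.ifThen k B C :: α) ∪ Set.range xs ∪ θ.vars)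
      (stackSem [B'.inst fun i => var (xs i)]) (.success δ))
    (h₂ : Matches (V ∪ θ₁.vars) (stackSem ((C'.inst fun i => var (xs i)).subst θ₁ :: β)) o) :
    Matches (V ∪ θ.vars) (stackSem (Goal.ifThen k B' C' :: β)) (o.after δ) := by
  have hif : (Goal.ifThen k B' C').freeVars ⊆ stackVars (Goal.ifThen k B C :: α) := by
    rw [stackVars_cons]
    exact fun x hx => Or.inl (Set.union_subset_union hB' hC' hx)
  have hβ' : stackVars β ⊆ stackVars (Goal.ifThen k B C :: α) :=
    hβ.trans (stackVars_subset_cons _ _)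
  have hclosed : (Goal.exN k B').freeVars = ∅ := by
    refine Set.eq_empty_of_forall_notMem fun x hx => ?_
    exact not_mem_freeVars_of_exN hB x (hB' (Goal.mem_freeVars_exN.1 hx))
  rw [subst_consequence hap hB hxs h hC'] at h₂
  refine Matches.ifThen_of_success hinj hclosed (fun i hi => hxs i (Or.inl hi))
    (fun i hi => hxs i (Or.inr (hif hi))) (fun i hi => hxs i (Or.inr (hβ' hi))) ?_
    ((answer_condition hB hxs h).varFinset_subset
      fun x hx => eq_var_of_mem_condition_vars hB hxs h (Or.inl hx))
    (map_subst_condition hap hB hxs h hβ) h₁ h₂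
  intro x hx
  have h3 : x ∈ (Goal.ifThen k B' C').freeVars → _ := fun hx => hif hx
  have h4 : x ∈ stackVars β → _ := fun hx => hβ' hx
  simp only [Set.mem_union] at hx ⊢
  tauto

end Cond

end Steps

/-! ### Computations and their verdicts -/

/-- The result `ρ` of the computation of `α` goes with a verdict of which `p` holds.  There is no
claim about floundering computations, and no computation has the result `diverge`. -/
def Holds (V : Set ℕ) (θ : Subst L) (α : List (Goal L)) (p : Verdict L → Prop) :
    Result L → Prop
  | .success θ' => ∃ δ, Answer V θ α θ' δ ∧ p (.success δ)
  | .fail => p .fail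
  | .flounder => True
  | .diverge => False

section Holds

variable {V : Set ℕ} {θ θ₁ σ : Subst L} {α β : List (Goal L)} {p q : Verdict L → Prop}
  {ρ : Result L}

theorem Holds.after (h : Holds V θ₁ β p ρ)
    (hans : ∀ θ' δ, Answer V θ₁ β θ' δ → Answer V θ α θ' (σ.comp δ))
    (hp : ∀ o, p o → q (o.after σ)) : Holds V θ α q ρ := by
  cases ρ with
  | success θ' =>
    obtain ⟨δ, h1, h2⟩ := h
    exact ⟨_, hans _ _ h1, hp _ h2⟩
  | fail => exact hp _ h
  | flounder => trivial
  | diverge => exact h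

theorem Holds.mono (h : Holds V θ β p ρ)
    (hans : ∀ θ' δ, Answer V θ β θ' δ → Answer V θ α θ' δ)
    (hp : ∀ o, p o → q o) : Holds V θ α q ρ :=
  h.after (σ := var) hans fun o ho => by rw [o.after_var]; exact hp o ho

theorem matches_nil (K : Set ℕ) : Matches K (stackSem ([] : List (Goal L))) (.success var) := by
  rw [matches_iff_of_ne (by simp)]
  exact ⟨[], [], [], rfl, by simp, fun τ => by simp [Fn.conj], fun τ _ => ⟨τ, fun _ _ => rfl⟩,
    fun τ _ => ⟨τ, fun _ _ => rfl, rfl⟩⟩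

end Holds

/-- All unfoldings of `α` in which the remaining calls are sufficiently deep have the verdict `o`. -/
def Eventually (P : Program L) (K : Set ℕ) (α : List (Goal L)) (o : Verdict L) : Prop :=
  ∃ N, ∀ m α', StackUnf P N m α α' → Matches K (stackSem α') o

theorem Eventually.of_cons {P : Program L} {K K' : Set ℕ} {α β : List (Goal L)} {G : Goal L}
    {o o' : Verdict L} (h : Eventually P K β o)
    (hG : ∀ N, (∀ m β', StackUnf P N m β β' → Matches K (stackSem β') o) →
      ∀ m m' G' α', Unf P N m G G' → StackUnf P N m' α α' →
        Matches K' (stackSem (G' :: α')) o') :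
    Eventually P K' (G :: α) o' := by
  obtain ⟨N, h⟩ := h
  refine ⟨N, fun m α' hα => ?_⟩
  cases hα with | cons h1 h2 => exact hG N h _ _ _ _ h1 h2

/-- Soundness: the verdict of a computation is the one of all sufficiently deep unfoldings. -/
theorem Eval.sound [Nonempty (GTerm L)] {P : Program L} (hP : Completed P) {V : Set ℕ}
    {θ : Subst L} {α : List (Goal L)} {ρ : Result L} (h : Eval P V θ α ρ) (hap : Apart θ α) :
    Holds V θ α (Eventually P (V ∪ θ.vars) α) ρ := by
  induction h with
  | @unif_succ V θ σ s t α ρ hσ _ ih =>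
    refine (ih (apart_eq hσ hap)).after (σ := σ) (fun θ' δ h => ?_) fun o h => ?_
    · exact (answer_eq hσ).comp (dom_eq hσ hap)
        (fun x hx _ => Or.inl (stackVars_map_mgu_subset hσ hx)) (apart_eq hσ hap) h
    · refine h.of_cons fun N h m m' G' α' h1 h2 => ?_
      cases h1
      exact Matches.eq hσ ((answer_eq (α := α) hσ).varFinset_subset (dom_eq hσ hap))
        (h _ _ (h2.subst hP σ))
  | unif_fail hst =>
    refine ⟨0, fun m α' h => ?_⟩
    cases h with | cons h1 h2 => ?_
    cases h1
    exact matches_eq_of_not_unifiable hst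
  | success =>
    refine ⟨var, .nil _ _ _, 0, fun m α' h => ?_⟩
    cases h
    exact matches_nil _
  | conj _ ih =>
    refine (ih (hap.mono (stackVars_conj _ _ _).superset)).mono
      (fun θ' δ h => h.mono_subset (stackVars_conj _ _ _).superset) fun o h => ?_
    refine h.of_cons fun N h m m' G' α' h1 h2 => ?_
    cases h1 with | conj hB hC => exact (h _ _ (.cons hB (.cons hC h2))).conj
  | @disj_nofail V θ B C α ρ _ hρ ih =>
    have ih := ih (hap.mono (stackVars_disj_left _ _ _))
    cases ρ with
    | success θ' =>
      obtain ⟨δ, h1, h2⟩ := ih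
      refine ⟨δ, h1.mono_subset (stackVars_disj_left _ _ _), ?_⟩
      refine h2.of_cons fun N h m m' G' α' h1 h2 => ?_
      cases h1 with | disj hB hC => ?_
      rw [stackSem_disj]
      exact (h _ _ (.cons hB h2)).append_left (by simp) _
    | fail => exact absurd rfl hρ
    | flounder => trivial
    | diverge => exact ih
  | disj_fail _ _ ihB ihC =>
    obtain ⟨NB, ihB⟩ := ihB (hap.mono (stackVars_disj_left _ _ _))
    refine (ihC (hap.mono (stackVars_disj_right _ _ _))).mono
      (fun θ' δ h => h.mono_subset (stackVars_disj_right _ _ _)) fun o h => ?_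
    obtain ⟨NC, h⟩ := h
    refine ⟨max NB NC, fun m α' hα => ?_⟩
    cases hα with | cons h1 h2 => ?_
    cases h1 with | disj hB hC => ?_
    rw [stackSem_disj]
    exact (h _ _ (.cons (hC.mono (le_max_right _ _)) (h2.mono (le_max_right _ _)))).append_right
      (matches_fail_iff.1
        (ihB _ _ (.cons (hB.mono (le_max_left _ _)) (h2.mono (le_max_left _ _)))))
  | @ex V θ B α ρ x hx _ ih =>
    have hx' : x ∉ V ∪ θ.vars ∧ x ∉ stackVars (Goal.ex B :: α) := not_or.1 hx
    refine (ih (apart_ex hap fun h => hx'.1 (Or.inr h))).mono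
      (fun θ' δ h => h.mono fun y hy hyx => ?_) fun o h => ?_
    · exact stackVars_ex hyx fun he => hx'.1 (he ▸ hy)
    · refine h.of_cons fun N h m m' G' α' h1 h2 => ?_
      cases h1 with | ex hB => ?_
      refine Matches.ex (x := x) (fun h => hx'.2 ?_) (fun h => hx'.2 ?_) hx'.1
        (h _ _ (.cons (hB.subst hP _) h2))
      · rw [stackVars_cons]
        exact Or.inl (hB.freeVars_subset hP h)
      · exact stackVars_subset_cons _ _ (h2.stackVars_subset hP h)
  | not_succ hB _ ih =>
    obtain ⟨δ, -, h⟩ := ih (apart_singleton_of_closed hB)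
    refine h.of_cons fun N h m m' G' α' h1 h2 => ?_
    cases h1 with | neg h1 => ?_
    exact (h _ _ (.singleton h1)).neg_of_success
      (Set.subset_eq_empty (h1.freeVars_subset hP) hB)
  | not_fail hB _ _ ihB ih =>
    obtain ⟨NB, hfail⟩ := ihB (apart_singleton_of_closed hB)
    refine (ih (hap.mono (stackVars_subset_cons _ _))).mono
      (fun θ' δ h => h.mono_subset (stackVars_subset_cons _ _)) fun o ⟨N, h⟩ => ?_
    refine ⟨max NB N, fun m α' hα => ?_⟩
    cases hα with | cons h1 h2 => ?_
    cases h1 with | neg h1 => ?_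
    exact (hfail _ _ (.singleton (h1.mono (le_max_left _ _)))).neg_of_fail
      (Set.subset_eq_empty (h1.freeVars_subset hP) hB) (h _ _ (h2.mono (le_max_right _ _)))
  | not_flounder => trivial
  | not_sub hB hρ _ ih =>
    rcases hρ with rfl | rfl
    · trivial
    · exact ih (apart_singleton_of_closed hB)
  | @if_succ V θ θ₁ k B C α ρ xs hB hinj hxs _ _ ihB ihC =>
    obtain ⟨δ, hans, NB, hcond⟩ := ihB (apart_condition hB hxs)
    refine (ihC (apart_consequence hap hB hxs hans)).after (σ := δ)
      (fun θ' δ₂ h₂ => answer_ifThen hap hB hxs hans h₂) fun o ⟨N, h⟩ => ?_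
    refine ⟨max NB N, fun m α' hα => ?_⟩
    cases hα with | cons h1 h2 => ?_
    cases h1 with | ifThen h1 h1' => ?_
    exact matches_ifThen hap hB hxs hans hinj (h1.freeVars_subset hP) (h1'.freeVars_subset hP)
      (h2.stackVars_subset hP)
      (hcond _ _ (.singleton ((h1.mono (le_max_left _ _)).subst hP _)))
      (h _ _ (.cons (((h1'.mono (le_max_right _ _)).subst hP _).subst hP _)
        (h2.mono (le_max_right _ _))))
  | if_fail hB hinj hxs _ ih =>
    refine (ih (apart_condition hB hxs)).of_cons fun N h m m' G' α' h1 h2 => ?_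
    cases h1 with | ifThen h1 h1' => ?_
    refine Matches.ifThen_of_fail hinj ?_ (h _ _ (.singleton (h1.subst hP _)))
    exact h1.exN_closed hP hB
  | if_flounder => trivial
  | if_sub hB _ hxs hρ _ ih =>
    rcases hρ with rfl | rfl
    · trivial
    · exact ih (apart_condition hB hxs)
  | @pred V θ n p ts B α ρ hB _ ih =>
    refine (ih (hap.mono (stackVars_expands hP hB))).mono
      (fun θ' δ h => h.mono_subset (stackVars_expands hP hB)) fun o ⟨N, h⟩ => ?_
    refine ⟨N + 1, fun m α' hα => ?_⟩
    cases hα with | cons h1 h2 => ?_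
    cases h1 with
    | keep h1 => exact absurd hB (h1.resolve_left (by omega) B)
    | expand hB' hN h1 =>
      obtain rfl := hB.unique hP hB'
      exact h _ _ (.cons (h1.mono (by omega)) (h2.mono (by omega)))

/-! ### Computations that follow an unfolding -/

/-- The number of connectives and atoms of a goal stack. -/
def stackSize (α : List (Goal L)) : ℕ := (α.map Goal.size).sum

theorem stackSize_cons (B : Goal L) (α : List (Goal L)) :
    stackSize (B :: α) = B.size + stackSize α := by simp [stackSize]

theorem stackSize_nil : stackSize ([] : List (Goal L)) = 0 := rfl

theorem stackSize_map_subst (σ : Subst L) (α : List (Goal L)) :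
    stackSize (α.map fun B => B.subst σ) = stackSize α := by
  simp [stackSize, Function.comp_def, Goal.size_subst]

theorem Goal.size_pos (B : Goal L) : 0 < B.size := by
  cases B <;> simp [Goal.size]

/-- The computation of `α` can follow the unfolding `α'` of `α`: unless `α'` is stuck, there is a
computation that flounders or has the verdict of `α'`.  The finiteness conditions leave variables for
the renaming of bound variables. -/
def Follows (P : Program L) (α α' : List (Goal L)) : Prop :=
  ∀ (V : Set ℕ) (θ : Subst L), V.Finite → θ.vars.Finite → Apart θ α →
    (∃ ρ, Eval P V θ α ρ ∧ Holds V θ α (Matches (V ∪ θ.vars) (stackSem α')) ρ) ∨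
      Matches (V ∪ θ.vars) (stackSem α') .stuck

namespace Follows

variable {P : Program L}

theorem nil (P : Program L) : Follows P ([] : List (Goal L)) [] := fun _ _ _ _ _ =>
  Or.inl ⟨_, .success, var, .nil _ _ _, matches_nil _⟩

theorem eq {s t : L.Term ℕ} {α α' : List (Goal L)}
    (ih : ∀ σ : Subst L, Follows P (α.map fun B => B.subst σ) (α'.map fun B => B.subst σ)) :
    Follows P (Goal.eq s t :: α) (Goal.eq s t :: α') := by
  intro V θ hV hθ hap
  by_cases hst : Unifiable s t
  · obtain ⟨σ, hσ⟩ := exists_isMGU hst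
    have hans := answer_eq (V := V) (θ := θ) (α := α) hσ
    have hK := hans.varFinset_subset (dom_eq hσ hap)
    rcases ih σ V (θ.comp σ) hV (hans.vars_finite hθ) (apart_eq hσ hap) with ⟨ρ, h1, h2⟩ | h
    · exact Or.inl ⟨ρ, .unif_succ hσ h1, h2.after (σ := σ)
        (fun θ' δ h => hans.comp (dom_eq hσ hap)
          (fun x hx _ => Or.inl (stackVars_map_mgu_subset hσ hx)) (apart_eq hσ hap) h)
        fun o h => h.eq hσ hK⟩
    · exact Or.inr (h.eq hσ hK)
  · exact Or.inl ⟨_, .unif_fail hst, matches_eq_of_not_unifiable hst⟩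

theorem call (hP : Completed P) {n : ℕ} {p : L.Relations n} {ts : Fin n → L.Term ℕ} {B B' : Goal L}
    {α α' : List (Goal L)} (hB : Expands P p ts B) (ih : Follows P (B :: α) (B' :: α')) :
    Follows P (Goal.call p ts :: α) (B' :: α') := by
  intro V θ hV hθ hap
  refine (ih V θ hV hθ (hap.mono (stackVars_expands hP hB))).imp_left ?_
  rintro ⟨ρ, h1, h2⟩
  exact ⟨ρ, .pred hB h1, h2.mono (fun θ' δ h => h.mono_subset (stackVars_expands hP hB))
    fun o h => h⟩

theorem conj {B B' C C' : Goal L} {α α' : List (Goal L)}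
    (ih : Follows P (B :: C :: α) (B' :: C' :: α')) :
    Follows P (Goal.conj B C :: α) (Goal.conj B' C' :: α') := by
  intro V θ hV hθ hap
  have hs := (stackVars_conj B C α).superset
  rcases ih V θ hV hθ (hap.mono hs) with ⟨ρ, h1, h2⟩ | h
  · exact Or.inl ⟨ρ, .conj h1, h2.mono (fun θ' δ h => h.mono_subset hs) fun o h => h.conj⟩
  · exact Or.inr h.conj

theorem disj {B B' C C' : Goal L} {α α' : List (Goal L)}
    (ihB : Follows P (B :: α) (B' :: α')) (ihC : Follows P (C :: α) (C' :: α')) :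
    Follows P (Goal.disj B C :: α) (Goal.disj B' C' :: α') := by
  intro V θ hV hθ hap
  have hsB := stackVars_disj_left B C α
  have hsC := stackVars_disj_right B C α
  unfold Holds
  rw [stackSem_disj]
  rcases ihB V θ hV hθ (hap.mono hsB) with ⟨ρ, h1, h2⟩ | h
  · cases ρ with
    | success θ' =>
      obtain ⟨δ, h2, h3⟩ := h2
      exact Or.inl ⟨_, .disj_nofail h1 (by simp), δ, h2.mono_subset hsB,
        h3.append_left (by simp) _⟩
    | fail =>
      have h2 := matches_fail_iff.1 h2
      rcases ihC V θ hV hθ (hap.mono hsC) with ⟨ρ, h3, h4⟩ | h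
      · exact Or.inl ⟨ρ, .disj_fail h1 h3, h4.mono (fun θ' δ h => h.mono_subset hsC)
          fun o h => h.append_right h2⟩
      · exact Or.inr (h.append_right h2)
    | flounder => exact Or.inl ⟨_, .disj_nofail h1 (by simp), trivial⟩
    | diverge => exact h2.elim
  · exact Or.inr (h.append_left (by simp) _)

theorem ex {B B' : Goal L} {α α' : List (Goal L)}
    (hB : B'.freeVars ⊆ B.freeVars) (hα : stackVars α' ⊆ stackVars α)
    (ih : ∀ x, Follows P (B.inst1 (var x) :: α) (B'.inst1 (var x) :: α')) :
    Follows P (Goal.ex B :: α) (Goal.ex B' :: α') := by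
  intro V θ hV hθ hap
  obtain ⟨x, hx⟩ := ((hV.union hθ).union (stackVars_finite (Goal.ex B :: α))).exists_notMem
  have hx' : x ∉ V ∪ θ.vars ∧ x ∉ stackVars (Goal.ex B :: α) := not_or.1 hx
  have hxB : x ∉ (Goal.ex B').freeVars := fun h => hx'.2 (by
    rw [stackVars_cons]
    exact Or.inl (hB h))
  have hxα : x ∉ stackVars α' := fun h => hx'.2 (stackVars_subset_cons _ _ (hα h))
  rcases ih x V θ hV hθ (apart_ex hap fun h => hx'.1 (Or.inr h)) with ⟨ρ, h1, h2⟩ | h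
  · refine Or.inl ⟨ρ, .ex hx h1, h2.mono (fun θ' δ h => h.mono fun y hy hyx => ?_)
      fun o h => Matches.ex hxB hxα hx'.1 h⟩
    exact stackVars_ex hyx fun he => hx'.1 (he ▸ hy)
  · exact Or.inr (Matches.ex hxB hxα hx'.1 h)

theorem neg [Nonempty (GTerm L)] {B B' : Goal L} {α α' : List (Goal L)}
    (hB : B'.freeVars ⊆ B.freeVars) (ihB : Follows P [B] [B']) (ih : Follows P α α') :
    Follows P (Goal.neg B :: α) (Goal.neg B' :: α') := by
  intro V θ hV hθ hap
  by_cases hclosed : B.freeVars = ∅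
  · have hclosed' : B'.freeVars = ∅ := Set.subset_eq_empty hB hclosed
    rcases ihB V θ hV hθ (apart_singleton_of_closed hclosed) with ⟨ρ, h1, h2⟩ | h
    · cases ρ with
      | success θ' =>
        obtain ⟨δ, -, h3⟩ := h2
        exact Or.inl ⟨_, .not_succ hclosed h1, h3.neg_of_success hclosed'⟩
      | fail =>
        rcases ih V θ hV hθ (hap.mono (stackVars_subset_cons _ _)) with ⟨ρ, h3, h4⟩ | h
        · exact Or.inl ⟨ρ, .not_fail hclosed h1 h3,
            h4.mono (fun θ' δ h => h.mono_subset (stackVars_subset_cons _ _))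
              fun o h => Matches.neg_of_fail hclosed' h2 h⟩
        · exact Or.inr (Matches.neg_of_fail hclosed' h2 h)
      | flounder => exact Or.inl ⟨_, .not_sub hclosed (.inl rfl) h1, trivial⟩
      | diverge => exact h2.elim
    · exact Or.inr (h.neg_of_stuck hclosed')
  · exact Or.inl ⟨_, .not_flounder hclosed, trivial⟩

theorem ifThen [Nonempty (GTerm L)] {k : ℕ} {B B' C C' : Goal L} {α α' : List (Goal L)}
    (hB : B'.freeVars ⊆ B.freeVars) (hC : C'.freeVars ⊆ C.freeVars)
    (hα : stackVars α' ⊆ stackVars α)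
    (ihB : ∀ σ : Subst L, Follows P [B.subst σ] [B'.subst σ])
    (ihC : ∀ σ : Subst L, Follows P (C.subst σ :: α) (C'.subst σ :: α')) :
    Follows P (Goal.ifThen k B C :: α) (Goal.ifThen k B' C' :: α') := by
  intro V θ hV hθ hap
  by_cases hclosed : (Goal.exN k B).freeVars = ∅
  · have hclosed' : (Goal.exN k B').freeVars = ∅ :=
      Set.eq_empty_of_forall_notMem fun x hx =>
        not_mem_freeVars_of_exN hclosed x (hB (Goal.mem_freeVars_exN.1 hx))
    have hfin := (hV.union hθ).union (stackVars_finite (Goal.ifThen k B C :: α))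
    obtain ⟨xs, hinj, hxs⟩ : ∃ xs : Fin k → ℕ, Function.Injective xs ∧
        ∀ i, xs i ∉ V ∪ θ.vars ∪ stackVars (Goal.ifThen k B C :: α) := by
      have := hfin.infinite_compl.to_subtype
      let e := Infinite.natEmbedding ↥(V ∪ θ.vars ∪ stackVars (Goal.ifThen k B C :: α))ᶜ
      exact ⟨fun i => (e i).1, fun i j h => Fin.ext (e.injective (Subtype.ext h)),
        fun i => (e i).2⟩
    have hVc : (V ∪ stackVars (Goal.ifThen k B C :: α) ∪ Set.range xs).Finite :=
      (hV.union (stackVars_finite _)).union (Set.finite_range xs)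
    rcases ihB _ _ θ hVc hθ (apart_condition hclosed hxs) with ⟨ρ, h1, h2⟩ | h
    · cases ρ with
      | success θ₁ =>
        obtain ⟨δ, hans, hcond⟩ := h2
        have hap₁ := apart_consequence hap hclosed hxs hans
        have hmatch : ∀ o, Matches (V ∪ θ₁.vars)
            (stackSem ((C'.inst fun i => var (xs i)).subst θ₁ :: α')) o → _ := fun o h =>
          matches_ifThen hap hclosed hxs hans hinj hB hC hα hcond h
        have ih := ihC ((Subst.inst fun i => var (xs i)).comp θ₁) V θ₁ hV (hans.vars_finite hθ)
        rw [← Goal.subst_subst, ← Goal.subst_subst] at ih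
        rcases ih hap₁ with ⟨ρ, h3, h4⟩ | h
        · exact Or.inl ⟨ρ, .if_succ hclosed hinj hxs h1 h3, h4.after (σ := δ)
            (fun θ' δ₂ h₂ => answer_ifThen hap hclosed hxs hans h₂) hmatch⟩
        · exact Or.inr (hmatch _ h)
      | fail =>
        exact Or.inl ⟨_, .if_fail hclosed hinj hxs h1, Matches.ifThen_of_fail hinj hclosed' h2⟩
      | flounder => exact Or.inl ⟨_, .if_sub hclosed hinj hxs (.inl rfl) h1, trivial⟩
      | diverge => exact h2.elim
    · exact Or.inr (Matches.ifThen_of_stuck hinj hclosed' h)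
  · exact Or.inl ⟨_, .if_flounder hclosed, trivial⟩

end Follows

/-- Completeness: a computation can follow each unfolding of its goal stack.  The induction is on the
size of the unfolding and, for unfoldings of the same size, on the number of replacements of calls
that lead to it, as the evaluation of a call uses up such a replacement. -/
theorem follows_of_stackUnf [Nonempty (GTerm L)] {P : Program L} (hP : Completed P) (s : ℕ) :
    ∀ (m : ℕ) (α α' : List (Goal L)), stackSize α' ≤ s → StackUnf P 0 m α α' →
      Follows P α α' := by
  induction s using Nat.strong_induction_on with
  | _ s ihs =>
  intro m
  induction m using Nat.strong_induction_on with
  | _ m ihm =>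
  intro α α' hs h
  -- the stacks that arise from steps other than the evaluation of a call are smaller
  have ih : ∀ {m : ℕ} {β β' : List (Goal L)}, StackUnf P 0 m β β' → stackSize β' < s →
      Follows P β β' := fun h hlt => ihs _ hlt _ _ _ le_rfl h
  cases h with
  | nil => exact .nil P
  | @cons m₁ m₂ G G' α α' h₁ h₂ =>
    have hα := h₂.stackVars_subset hP
    rw [stackSize_cons] at hs
    cases h₁ with
    | eq s t =>
      refine .eq fun σ => ih (h₂.subst hP σ) ?_
      rw [stackSize_map_subst]
      simp only [Goal.size] at hs
      omega
    | keep => exact fun V θ _ _ _ => Or.inr matches_call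
    | expand hB _ h₁ =>
      exact .call hP hB (ihm _ (by omega) _ _ (by rwa [stackSize_cons])
        (.cons (h₁.mono (Nat.zero_le _)) h₂))
    | conj hB hC =>
      refine .conj (ih (.cons hB (.cons hC h₂)) ?_)
      simp only [Goal.size, stackSize_cons] at hs ⊢
      omega
    | @disj _ _ _ _ B' _ C' hB hC =>
      have h1 := B'.size_pos
      have h2 := C'.size_pos
      simp only [Goal.size] at hs
      refine .disj (ih (.cons hB h₂) ?_) (ih (.cons hC h₂) ?_) <;>
      · rw [stackSize_cons]
        omega
    | neg hB =>
      simp only [Goal.size] at hs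
      refine .neg (hB.freeVars_subset hP) (ih (.singleton hB) ?_) (ih h₂ ?_)
      · rw [stackSize_cons, stackSize_nil]
        omega
      · omega
    | ex hB =>
      refine .ex (hB.freeVars_subset hP) hα fun x => ih (.cons (hB.subst hP _) h₂) ?_
      simp only [Goal.size, stackSize_cons, Goal.size_inst1] at hs ⊢
      omega
    | @ifThen _ _ _ k _ B' _ C' hB hC =>
      have h1 := B'.size_pos
      have h2 := C'.size_pos
      simp only [Goal.size] at hs
      refine .ifThen (hB.freeVars_subset hP) (hC.freeVars_subset hP) hα
        (fun σ => ih (.singleton (hB.subst hP σ)) ?_)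
        fun σ => ih (.cons (hC.subst hP σ) h₂) ?_ <;>
      · simp only [stackSize_cons, stackSize_nil, Goal.size_subst]
        omega

/-! ### The denotation of a program -/

section Denotation

variable {P : Program L} {G : Goal L}

theorem apart_ground (hG : G.Ground) (θ : Subst L) : Apart θ [G] := apart_singleton_of_closed hG

theorem Unf.ground (hP : Completed P) {N m : ℕ} {G' : Goal L} (h : Unf P N m G G')
    (hG : G.Ground) : G'.Ground := Set.subset_eq_empty (h.freeVars_subset hP) hG

theorem Eventually.val_dfnf [Nonempty (GTerm L)] (hP : Completed P) (hG : G.Ground) {V : Set ℕ}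
    {o : Verdict L} (h : Eventually P V [G] o) :
    ∃ N, ∀ m G', Unf P N m G G' → val (dfnf G') = o.truth := by
  obtain ⟨N, h⟩ := h
  refine ⟨N, fun m G' hU => ?_⟩
  have hG' := hU.ground hP hG
  have τ : Env L := fun _ => Classical.arbitrary _
  rw [FirmCut.val_dfnf hG' τ]
  exact (h _ _ (.singleton hU)).disj_sem_eq hG' τ

/-- The sufficiently deep unfoldings of a goal that succeeds have true normal forms. -/
theorem Succeeds.val_dfnf [Nonempty (GTerm L)] (hP : Completed P) (hG : G.Ground)
    (h : Succeeds P G) : ∃ N, ∀ m G', Unf P N m G G' → val (dfnf G') = Truth.T := by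
  obtain ⟨θ, h⟩ := h
  obtain ⟨δ, -, h⟩ := Eval.sound hP h (apart_ground hG _)
  exact h.val_dfnf hP hG

/-- The sufficiently deep unfoldings of a goal that fails have false normal forms. -/
theorem Fails.val_dfnf [Nonempty (GTerm L)] (hP : Completed P) (hG : G.Ground)
    (h : Fails P G) : ∃ N, ∀ m G', Unf P N m G G' → val (dfnf G') = Truth.F := by
  have h := Eval.sound hP h (apart_ground hG _)
  exact Eventually.val_dfnf hP hG h

theorem exists_unf_max {N N' : ℕ} : ∃ m G', Unf P N m G G' ∧ Unf P N' m G G' := by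
  obtain ⟨m, G', h⟩ := Unf.exists_of_depth P (max N N') G
  exact ⟨m, G', h.mono (le_max_left _ _), h.mono (le_max_right _ _)⟩

theorem not_succeeds_and_fails [Nonempty (GTerm L)] (hP : Completed P) (hG : G.Ground) :
    ¬ (Succeeds P G ∧ Fails P G) := by
  rintro ⟨h1, h2⟩
  obtain ⟨N, h1⟩ := h1.val_dfnf hP hG
  obtain ⟨N', h2⟩ := h2.val_dfnf hP hG
  obtain ⟨m, G', h3, h4⟩ := exists_unf_max (P := P) (G := G) (N := N) (N' := N')
  have := (h1 m G' h3).symm.trans (h2 m G' h4)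
  cases this

/-- The value of an unfolding is undefined or agrees with the outcome of the computation. -/
theorem val_unfolding [Nonempty (GTerm L)] (hP : Completed P) (hG : G.Ground)
    (hfl : ¬ Flounders P G) {G' : Goal L} (h : Unfolding P G G') :
    (val (dfnf G') = Truth.T ∧ Succeeds P G) ∨ (val (dfnf G') = Truth.F ∧ Fails P G) ∨
      val (dfnf G') = Truth.U := by
  obtain ⟨m, hU⟩ := Unf.of_unfolding h
  have hG' := hU.ground hP hG
  have τ : Env L := fun _ => Classical.arbitrary _
  rw [val_dfnf hG' τ]
  have hvars : Subst.vars (var : Subst L) = ∅ := by simp [Subst.vars, Subst.dom]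
  rcases follows_of_stackUnf hP _ m _ _ le_rfl (.singleton hU) ∅ var Set.finite_empty
    (by rw [hvars]; exact Set.finite_empty) (apart_ground hG _) with ⟨ρ, h1, h2⟩ | h
  · cases ρ with
    | success θ =>
      obtain ⟨δ, -, h2⟩ := h2
      exact Or.inl ⟨h2.disj_sem_eq hG' τ, θ, h1⟩
    | fail => exact Or.inr (Or.inl ⟨Matches.disj_sem_eq hG' h2 τ, h1⟩)
    | flounder => exact absurd h1 hfl
    | diverge => exact h2.elim
  · exact Or.inr (Or.inr (h.disj_sem_eq hG' τ))

theorem denotation_eq_outcome [Nonempty (GTerm L)] (hP : Completed P) (hG : G.Ground)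
    (hfl : ¬ Flounders P G) : denotation P G = some (outcome P G) := by
  have hnot := not_succeeds_and_fails hP hG
  have hval := fun G' h => val_unfolding hP hG hfl (G' := G') h
  have hne : {w | ∃ G', Unfolding P G G' ∧ w = val (dfnf G')}.Nonempty :=
    ⟨_, G, Relation.ReflTransGen.refl, rfl⟩
  rw [denotation, Truth.maxK_eq_some_iff hne]
  unfold outcome
  split_ifs with hS hF
  · obtain ⟨N, hN⟩ := hS.val_dfnf hP hG
    obtain ⟨m, G', hU⟩ := Unf.exists_of_depth P N G
    refine ⟨⟨G', hU.unfolding, (hN m G' hU).symm⟩, ?_⟩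
    rintro b ⟨G'', hG'', rfl⟩
    rcases hval G'' hG'' with ⟨h1, -⟩ | ⟨-, h1⟩ | h1
    · exact Or.inl h1
    · exact absurd ⟨hS, h1⟩ hnot
    · exact Or.inr h1
  · obtain ⟨N, hN⟩ := hF.val_dfnf hP hG
    obtain ⟨m, G', hU⟩ := Unf.exists_of_depth P N G
    refine ⟨⟨G', hU.unfolding, (hN m G' hU).symm⟩, ?_⟩
    rintro b ⟨G'', hG'', rfl⟩
    rcases hval G'' hG'' with ⟨-, h1⟩ | ⟨h1, -⟩ | h1
    · exact absurd h1 hS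
    · exact Or.inl h1
    · exact Or.inr h1
  · have hU : ∀ G', Unfolding P G G' → val (dfnf G') = Truth.U := fun G' h => by
      rcases hval G' h with ⟨-, h1⟩ | ⟨-, h1⟩ | h1
      · exact absurd h1 hS
      · exact absurd h1 hF
      · exact h1
    refine ⟨⟨G, Relation.ReflTransGen.refl, (hU G Relation.ReflTransGen.refl).symm⟩, ?_⟩
    rintro b ⟨G'', hG'', rfl⟩
    exact Or.inl (hU G'' hG'')

end Denotation

end FirmCut

theorem mainTheorem2 {L : FirstOrder.Language}
    (h01 : ∃ zero one : L.Term ℕ,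
      FirmCut.GroundTerm zero ∧ FirmCut.GroundTerm one ∧ zero ≠ one)
    (P : FirmCut.Program L) (hP : FirmCut.Completed P)
    (G : FirmCut.Goal L) (hG : G.Ground) (hfl : ¬ FirmCut.Flounders P G) :
    -- depth-first normal forms exist and are unique
    (∀ H : FirmCut.Goal L, ∃! D : FirmCut.Goal L, FirmCut.IsDFNF H D) ∧
    -- the valuation is only applied to ground outer-disjunction formulas
    (∀ G' : FirmCut.Goal L, FirmCut.Unfolding P G G' →
      (FirmCut.dfnf G').Ground ∧ FirmCut.OuterDisj (FirmCut.dfnf G')) ∧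
    -- the outcome is well-defined
    ¬ (FirmCut.Succeeds P G ∧ FirmCut.Fails P G) ∧
    -- the maximum that defines the denotation exists and is the outcome
    FirmCut.denotation P G = some (FirmCut.outcome P G) := by
  obtain ⟨zero, -, hzero, -, -⟩ := h01
  have : Nonempty (FirmCut.GTerm L) := ⟨⟨zero, hzero⟩⟩
  refine ⟨FirmCut.existsUnique_isDFNF, fun G' h => ?_, FirmCut.not_succeeds_and_fails hP hG,
    FirmCut.denotation_eq_outcome hP hG hfl⟩
  obtain ⟨m, hU⟩ := FirmCut.Unf.of_unfolding h
  rw [FirmCut.dfnf_eq_nf]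
  exact ⟨Set.subset_eq_empty (FirmCut.freeVars_nf_subset G') (hU.ground hP hG),
    FirmCut.outerDisj_nf G'⟩
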